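/- **Setting.** A *pasting scheme* $\mathcal G$ is a finite connected plane directed multigraph without directed cycles, with two distinct vertices $s,t$ on the exterior face such that every vertex lies on a directed path from $s$ and on a directed path to $t$. The boundary of each interior face $F$ consists of two directed paths from a vertex $s_F$ to a vertex $t_F\neq s_F$: the uppermost path $\sigma_F$ (with $F$ on its right) and the lowermost path $\tau_F$ (with $F$ on its left). Write $F\lhd G$ if $\tau_F$ and $\sigma_G$ share an edge. Let $\mathcal C_{\mathcal G}$ be the contractible groupoid (exactly one morphism between any two objects) whose objects are the enumerations of the interior faces in which $F$ precedes $G$ whenever $F\lhd G$. Write $F\lessdot G$ if $F\ne G$, $F\lhd G$ and there are directed paths $u,v,u',v'$ with $u\,\tau_F\,v=u'\,\sigma_G\,v'$ where $u$ or $u'$ is empty and $v$ or $v'$ is empty. For $F\lessdot G$ let $\mathcal G^{FG}$ be the scheme obtained by replacing $F$ and $G$ by one face $F\#G$ with uppermost path $u\,\sigma_F\,v$ and lowermost path $u'\,\tau_G\,v'$ (the common edges of $F$ and $G$ and the vertices interior to their common path are deleted). Let $S_{FG}\colon\mathcal C_{\mathcal G^{FG}}\to\mathcal C_{\mathcal G}$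 be the equivalence $\overline U(F\#G)\overline V\mapsto\overline U FG\overline V$. Let $\mathfrak K$ be a $\mathrm{Gray}$-category. A *labelling* $\mathcal L$ of $\mathcal G$ in $\mathfrak K$ assigns $0$-cells to vertices, $1$-cells to edges, and to each interior face $F$ a $2$-cell from the composite along $\sigma_F$ to the composite along $\tau_F$. Let $p,q\colon S\to T$ be the composites of the $1$-cells along the uppermost and the lowermost path of $\mathcal G$ from $s$ to $t$. By composing the whiskered $2$-cells in the given order, and by sending the interchange of two consecutive faces to the whiskered interchange isomorphism of $\mathfrak K$, a labelling determines a functor $\mathcal L\colon\mathcal C_{\mathcal G}\to\mathfrak K(S,T)[p,q]$. For $F\lessdot G$ with labels $\alpha_F,\alpha_G$, let $\alpha_G.\alpha_F$ be the pasting of the two $2$-cells along $u\,\tau_F\,v=u'\,\sigma_G\,v'$; the labelling $\mathcal L_{FG}$ of $\mathcal G^{FG}$ labels $F\#G$ by $\alpha_G.\alpha_F$ and all other faces as $\mathcal L$ does, so that $\mathcal L_{FG}=\mathcal L S_{FG}$; $\mathcal L_{FG}^{\alpha'}$ has the label $\alpha'$ at $F\#G$ instead. Given a pseudo-inverse $J$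 of $S_{FG}$ and a $3$-cell $\Pi\colon\alpha_G.\alpha_F\Rrightarrow\alpha'$, let $\overline{\Pi^*}\colon\mathcal L\Rightarrow\mathcal L_{FG}^{\alpha'}J$ be the transformation whose component at $X$ is the canonical isomorphism $\mathcal L(X)\cong\mathcal L(S_{FG}JX)=\mathcal L_{FG}(JX)$ followed by $\Pi$ whiskered with the labels of the other faces. **Theorem.** Let $\mathcal L$ be a labelling of a pasting scheme $\mathcal G$ in a $\mathrm{Gray}$-category $\mathfrak K$, let $F\lessdot G$ and $H\lessdot K$ be two pairs of faces of $\mathcal G$, where $F,G,H,K$ are pairwise distinct, with labels $\alpha_F,\alpha_G,\beta_H,\beta_K$, and let $\mathcal G^{FG,HK}=(\mathcal G^{FG})^{HK}=(\mathcal G^{HK})^{FG}$. Let $\Pi\colon\alpha_G.\alpha_F\Rrightarrow\alpha'$ and $\Omega\colon\beta_K.\beta_H\Rrightarrow\beta'$ be $3$-cells. 1. The functors $\mathcal L$, $\mathcal L^{\alpha'}_{FG}$, $\mathcal L^{\beta'}_{HK}$, $\mathcal L^{\alpha',\beta'}_{FG,HK}$ on $\mathcal C_{\mathcal G}$, $\mathcal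 C_{\mathcal G^{FG}}$, $\mathcal C_{\mathcal G^{HK}}$, $\mathcal C_{\mathcal G^{FG,HK}}$ exist and are uniquely determined by the above description (and likewise for all other labels of the faces $F\#G$, $H\#K$). 2. For any choices of pseudo-inverses $$J_1\colon\mathcal C_{\mathcal G}\to\mathcal C_{\mathcal G^{FG}},\quad J_2\colon\mathcal C_{\mathcal G^{FG}}\to\mathcal C_{\mathcal G^{FG,HK}},\quad J_3\colon\mathcal C_{\mathcal G}\to\mathcal C_{\mathcal G^{HK}},\quad J_4\colon\mathcal C_{\mathcal G^{HK}}\to\mathcal C_{\mathcal G^{FG,HK}}$$ of the functors $S_{FG}$, $S_{HK}$, $S_{HK}$, $S_{FG}$ between these groupoids, the transformations $$\overline{\Pi^*}\colon\mathcal L\Rightarrow\mathcal L^{\alpha'}_{FG}J_1,\quad \overline{\Omega^*}\colon\mathcal L^{\alpha'}_{FG}\Rightarrow\mathcal L^{\alpha',\beta'}_{FG,HK}J_2,\quad \overline{\Omega^*}\colon\mathcal L\Rightarrow\mathcal L^{\beta'}_{HK}J_3,\quad \overline{\Pi^*}\colon\mathcal L^{\beta'}_{HK}\Rightarrow\mathcal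 L^{\alpha',\beta'}_{FG,HK}J_4$$ are natural, and $$(\overline{\Omega^*}J_1)\circ\overline{\Pi^*}=(\mathcal L^{\alpha',\beta'}_{FG,HK}\,\kappa)\circ(\overline{\Pi^*}J_3)\circ\overline{\Omega^*}\ \colon\ \mathcal L\Longrightarrow\mathcal L^{\alpha',\beta'}_{FG,HK}J_2J_1,$$ where $\kappa\colon J_4J_3\cong J_2J_1$ is the unique natural isomorphism. -/

import Mathlib

open CategoryTheory Bicategory

namespace GrayPasting

/-- A `Gray`-category: a category whose hom-sets carry the structure of strict 2-categories (the
1-cells of `X ⟶ Y` are the 2-cells and the 2-cells of `X ⟶ Y` are the 3-cells of `𝒦`), on which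
the 1-cells of `𝒦` act from both sides by strict 2-functors `f ≫ ·` (`pre`, `pre₃`) and `· ≫ g`
(`post`, `post₃`), strictly associatively and unitally, together with the interchange isomorphisms
for horizontally composable 2-cells `α`, `β`, natural and compatible with compositions, identities
and the actions of 1-cells. As all these structures are strict, equations between cells whose
boundaries are equal, but not by definition, are written as heterogeneous equalities. -/
class GrayCategory.{w₃, w₂, v, u} (𝒦 : Type u) extends Category.{v} 𝒦 where
  homBicategory (X Y : 𝒦) : Bicategory.{w₃, w₂} (X ⟶ Y)
  homStrict (X Y : 𝒦) : Bicategory.Strict (X ⟶ Y)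
  pre {X Y Z : 𝒦} (f : X ⟶ Y) {g g' : Y ⟶ Z} (β : g ⟶ g') : f ≫ g ⟶ f ≫ g'
  pre₃ {X Y Z : 𝒦} (f : X ⟶ Y) {g g' : Y ⟶ Z} {β β' : g ⟶ g'} (Θ : β ⟶ β') : pre f β ⟶ pre f β'
  post {X Y Z : 𝒦} {f f' : X ⟶ Y} (α : f ⟶ f') (g : Y ⟶ Z) : f ≫ g ⟶ f' ≫ g
  post₃ {X Y Z : 𝒦} {f f' : X ⟶ Y} {α α' : f ⟶ f'} (Γ : α ⟶ α') (g : Y ⟶ Z) :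
    post α g ⟶ post α' g
  -- `pre f` is a strict 2-functor
  pre_id {X Y Z : 𝒦} (f : X ⟶ Y) (g : Y ⟶ Z) : pre f (𝟙 g) = 𝟙 (f ≫ g)
  pre_comp {X Y Z : 𝒦} (f : X ⟶ Y) {g g' g'' : Y ⟶ Z} (β : g ⟶ g') (β' : g' ⟶ g'') :
    pre f (β ≫ β') = pre f β ≫ pre f β'
  pre₃_id {X Y Z : 𝒦} (f : X ⟶ Y) {g g' : Y ⟶ Z} (β : g ⟶ g') : pre₃ f (𝟙 β) = 𝟙 (pre f β)
  pre₃_comp {X Y Z : 𝒦} (f : X ⟶ Y) {g g' : Y ⟶ Z} {β β' β'' : g ⟶ g'}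
    (Θ : β ⟶ β') (Θ' : β' ⟶ β'') : pre₃ f (Θ ≫ Θ') = pre₃ f Θ ≫ pre₃ f Θ'
  pre₃_whiskerLeft {X Y Z : 𝒦} (f : X ⟶ Y) {g g' g'' : Y ⟶ Z} (β : g ⟶ g')
    {δ δ' : g' ⟶ g''} (Θ : δ ⟶ δ') : HEq (pre₃ f (β ◁ Θ)) (pre f β ◁ pre₃ f Θ)
  pre₃_whiskerRight {X Y Z : 𝒦} (f : X ⟶ Y) {g g' g'' : Y ⟶ Z} {β β' : g ⟶ g'} (Θ : β ⟶ β')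
    (δ : g' ⟶ g'') : HEq (pre₃ f (Θ ▷ δ)) (pre₃ f Θ ▷ pre f δ)
  -- `post · g` is a strict 2-functor
  post_id {X Y Z : 𝒦} (f : X ⟶ Y) (g : Y ⟶ Z) : post (𝟙 f) g = 𝟙 (f ≫ g)
  post_comp {X Y Z : 𝒦} {f f' f'' : X ⟶ Y} (α : f ⟶ f') (α' : f' ⟶ f'') (g : Y ⟶ Z) :
    post (α ≫ α') g = post α g ≫ post α' g
  post₃_id {X Y Z : 𝒦} {f f' : X ⟶ Y} (α : f ⟶ f') (g : Y ⟶ Z) : post₃ (𝟙 α) g = 𝟙 (post α g)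
  post₃_comp {X Y Z : 𝒦} {f f' : X ⟶ Y} {α α' α'' : f ⟶ f'} (Γ : α ⟶ α') (Γ' : α' ⟶ α'')
    (g : Y ⟶ Z) : post₃ (Γ ≫ Γ') g = post₃ Γ g ≫ post₃ Γ' g
  post₃_whiskerLeft {X Y Z : 𝒦} {f f' f'' : X ⟶ Y} (α : f ⟶ f') {δ δ' : f' ⟶ f''}
    (Θ : δ ⟶ δ') (g : Y ⟶ Z) : HEq (post₃ (α ◁ Θ) g) (post α g ◁ post₃ Θ g)
  post₃_whiskerRight {X Y Z : 𝒦} {f f' f'' : X ⟶ Y} {α α' : f ⟶ f'} (Γ : α ⟶ α')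
    (δ : f' ⟶ f'') (g : Y ⟶ Z) : HEq (post₃ (Γ ▷ δ) g) (post₃ Γ g ▷ post δ g)
  -- strict associativity and unitality of the action of 1-cells
  id_pre {X Y : 𝒦} {g g' : X ⟶ Y} (β : g ⟶ g') : HEq (pre (𝟙 X) β) β
  id_pre₃ {X Y : 𝒦} {g g' : X ⟶ Y} {β β' : g ⟶ g'} (Θ : β ⟶ β') : HEq (pre₃ (𝟙 X) Θ) Θ
  post_id₁ {X Y : 𝒦} {f f' : X ⟶ Y} (α : f ⟶ f') : HEq (post α (𝟙 Y)) α
  post₃_id₁ {X Y : 𝒦} {f f' : X ⟶ Y} {α α' : f ⟶ f'} (Γ : α ⟶ α') : HEq (post₃ Γ (𝟙 Y)) Γ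
  comp_pre {W X Y Z : 𝒦} (f : W ⟶ X) (g : X ⟶ Y) {h h' : Y ⟶ Z} (β : h ⟶ h') :
    HEq (pre (f ≫ g) β) (pre f (pre g β))
  comp_pre₃ {W X Y Z : 𝒦} (f : W ⟶ X) (g : X ⟶ Y) {h h' : Y ⟶ Z} {β β' : h ⟶ h'} (Θ : β ⟶ β') :
    HEq (pre₃ (f ≫ g) Θ) (pre₃ f (pre₃ g Θ))
  post_comp₁ {W X Y Z : 𝒦} {f f' : W ⟶ X} (α : f ⟶ f') (g : X ⟶ Y) (h : Y ⟶ Z) :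
    HEq (post α (g ≫ h)) (post (post α g) h)
  post₃_comp₁ {W X Y Z : 𝒦} {f f' : W ⟶ X} {α α' : f ⟶ f'} (Γ : α ⟶ α') (g : X ⟶ Y)
    (h : Y ⟶ Z) : HEq (post₃ Γ (g ≫ h)) (post₃ (post₃ Γ g) h)
  pre_post {W X Y Z : 𝒦} (f : W ⟶ X) {g g' : X ⟶ Y} (β : g ⟶ g') (h : Y ⟶ Z) :
    HEq (pre f (post β h)) (post (pre f β) h)
  pre₃_post₃ {W X Y Z : 𝒦} (f : W ⟶ X) {g g' : X ⟶ Y} {β β' : g ⟶ g'} (Θ : β ⟶ β')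
    (h : Y ⟶ Z) : HEq (pre₃ f (post₃ Θ h)) (post₃ (pre₃ f Θ) h)
  -- the interchange isomorphism
  interchange {X Y Z : 𝒦} {f f' : X ⟶ Y} {g g' : Y ⟶ Z} (α : f ⟶ f') (β : g ⟶ g') :
    post α g ≫ pre f' β ≅ pre f β ≫ post α g'
  interchange_naturality_left {X Y Z : 𝒦} {f f' : X ⟶ Y} {g g' : Y ⟶ Z} {α α' : f ⟶ f'}
    (Γ : α ⟶ α') (β : g ⟶ g') :
    (post₃ Γ g ▷ pre f' β) ≫ (interchange α' β).hom =
      (interchange α β).hom ≫ (pre f β ◁ post₃ Γ g')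
  interchange_naturality_right {X Y Z : 𝒦} {f f' : X ⟶ Y} {g g' : Y ⟶ Z} (α : f ⟶ f')
    {β β' : g ⟶ g'} (Θ : β ⟶ β') :
    (post α g ◁ pre₃ f' Θ) ≫ (interchange α β').hom =
      (interchange α β).hom ≫ (pre₃ f Θ ▷ post α g')
  interchange_id_left {X Y Z : 𝒦} (f : X ⟶ Y) {g g' : Y ⟶ Z} (β : g ⟶ g') :
    HEq (interchange (𝟙 f) β).hom (𝟙 (pre f β))
  interchange_id_right {X Y Z : 𝒦} {f f' : X ⟶ Y} (α : f ⟶ f') (g : Y ⟶ Z) :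
    HEq (interchange α (𝟙 g)).hom (𝟙 (post α g))
  interchange_comp_left {X Y Z : 𝒦} {f f' f'' : X ⟶ Y} {g g' : Y ⟶ Z} (α : f ⟶ f')
    (α' : f' ⟶ f'') (β : g ⟶ g') :
    HEq (interchange (α ≫ α') β).hom
      ((post α g ◁ (interchange α' β).hom) ≫ (α_ _ _ _).inv ≫ ((interchange α β).hom ▷ post α' g'))
  interchange_comp_right {X Y Z : 𝒦} {f f' : X ⟶ Y} {g g' g'' : Y ⟶ Z} (α : f ⟶ f')
    (β : g ⟶ g') (β' : g' ⟶ g'') :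
    HEq (interchange α (β ≫ β')).hom
      (((interchange α β).hom ▷ pre f' β') ≫ (α_ _ _ _).hom ≫ (pre f β ◁ (interchange α β').hom))
  interchange_pre {W X Y Z : 𝒦} (e : W ⟶ X) {f f' : X ⟶ Y} {g g' : Y ⟶ Z} (α : f ⟶ f')
    (β : g ⟶ g') : HEq (interchange (pre e α) β).hom (pre₃ e (interchange α β).hom)
  interchange_mid {W X Y Z : 𝒦} {f f' : W ⟶ X} (e : X ⟶ Y) {g g' : Y ⟶ Z} (α : f ⟶ f')
    (β : g ⟶ g') : HEq (interchange (post α e) β).hom (interchange α (pre e β)).hom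
  interchange_post {W X Y Z : 𝒦} {f f' : W ⟶ X} {g g' : X ⟶ Y} (α : f ⟶ f') (β : g ⟶ g')
    (h : Y ⟶ Z) : HEq (interchange α (post β h)).hom (post₃ (interchange α β).hom h)

attribute [instance] GrayCategory.homBicategory GrayCategory.homStrict

section Paths
open Quiver

variable {V : Type*} [Quiver V]

/-- The list of edges of a directed path. -/
def edges {a : V} : ∀ {b : V}, Path a b → List (Total V)
  | _, .nil => []
  | _, .cons p e => edges p ++ [⟨_, _, e⟩]

@[simp] lemma edges_nil (a : V) : edges (Path.nil : Path a a) = [] := rfl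

@[simp] lemma edges_cons {a b c : V} (p : Path a b) (e : b ⟶ c) :
    edges (p.cons e) = edges p ++ [⟨_, _, e⟩] := rfl

@[simp] lemma edges_comp {a b c : V} (p : Path a b) (q : Path b c) :
    edges (p.comp q) = edges p ++ edges q := by
  induction q with
  | nil => simp
  | cons q e ih => simp [ih]

/-- There is no directed path from a vertex to itself, apart from the empty one. -/
def Acyclic (V : Type*) [Quiver V] : Prop := ∀ (a : V) (p : Path a a), p = Path.nil

lemma exists_split {a b : V} (w : Path a b) {e : Total V} (he : e ∈ edges w) :
    ∃ (x : Path a e.left) (y : Path e.right b), w = x.comp (e.hom.toPath.comp y) := by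
  induction w with
  | nil => simp at he
  | cons w g ih =>
    rw [edges_cons, List.mem_append] at he
    rcases he with he | he
    · obtain ⟨x, y, rfl⟩ := ih he
      exact ⟨x, y.cons g, by simp [Path.comp_cons]⟩
    · rw [List.mem_singleton] at he
      subst he
      exact ⟨w, Path.nil, rfl⟩

lemma Acyclic.not_mem_left (hV : Acyclic V) {a b : V} (w : Path a b) {e : Total V}
    (he : e ∈ edges w) (h : e.left = b) : False := by
  obtain ⟨x, y, rfl⟩ := exists_split w he
  subst h
  have := hV _ (e.hom.toPath.comp y)
  have h2 := congrArg Path.length this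
  simp [Path.length_comp] at h2

/-- A path all of whose edges lie on `x · y`, starting where `y` starts, is an initial segment
of `y`. -/
lemma Acyclic.exists_comp (hV : Acyclic V) {a b c d : V} (x : Path a b) (y : Path b c)
    (p : Path b d) (hp : ∀ e ∈ edges p, e ∈ edges (x.comp y)) : ∃ z, y = p.comp z := by
  induction p with
  | nil => exact ⟨y, by simp⟩
  | cons p e ih =>
    obtain ⟨z, rfl⟩ := ih (fun g hg => hp g (by simp [hg]))
    have he := hp ⟨_, _, e⟩ (by simp)
    rw [← Path.comp_assoc, edges_comp, List.mem_append] at he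
    rcases he with he | he
    · exact (hV.not_mem_left _ he rfl).elim
    · obtain ⟨z₁, z₂, rfl⟩ := exists_split z he
      have h0 : z₁ = Path.nil := hV _ z₁
      subst h0
      exact ⟨z₂, by
        rw [Path.nil_comp, ← Path.comp_assoc, Path.comp_toPath_eq_cons]⟩

lemma Acyclic.eq_of_subset (hV : Acyclic V) {a b : V} (p q : Path a b)
    (h : ∀ e ∈ edges p, e ∈ edges q) : p = q := by
  obtain ⟨z, hz⟩ := hV.exists_comp Path.nil q p (by simpa using h)
  rw [hV _ z] at hz
  simpa using hz.symm

/-- A nonempty path all of whose edges lie on `w` is a segment of `w`. -/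
lemma Acyclic.exists_segment (hV : Acyclic V) {a b c d : V} (w : Path a b) (p : Path c d)
    (hcd : c ≠ d) (hp : ∀ e ∈ edges p, e ∈ edges w) :
    ∃ (x : Path a c) (y : Path d b), w = x.comp (p.comp y) := by
  have : ∃ e ∈ edges p, e.left = c := by
    clear hp
    induction p with
    | nil => exact (hcd rfl).elim
    | cons p e ih =>
      rename_i d' d
      by_cases h : c = d'
      · subst h; exact ⟨⟨_, _, e⟩, by simp, rfl⟩
      · obtain ⟨e, he, rfl⟩ := ih h
        exact ⟨e, by simp [he], rfl⟩
  obtain ⟨e, he, rfl⟩ := this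
  obtain ⟨x, y, rfl⟩ := exists_split w (hp e he)
  obtain ⟨z, hz⟩ := hV.exists_comp x (e.hom.toPath.comp y) p hp
  exact ⟨x, z, by rw [hz]⟩

lemma Acyclic.nodup_edges (hV : Acyclic V) {a b : V} (w : Path a b) : (edges w).Nodup := by
  induction w with
  | nil => simp
  | cons w e ih =>
    rw [edges_cons, List.nodup_append]
    refine ⟨ih, by simp, ?_⟩
    intro g hg h hh hgh
    rw [List.mem_singleton] at hh
    subst hgh; subst hh
    exact hV.not_mem_left w hg rfl

end Paths

section Plane
open Quiver

variable (V : Type*) [Quiver V]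

/-- A dart is an edge together with a sense of traversal: along its direction (`true`) or
against it (`false`). -/
abbrev Dart := Total V × Bool

variable {V}

/-- The vertex at which a dart starts. -/
def Dart.origin (d : Dart V) : V := if d.2 then d.1.left else d.1.right

/-- The same edge, traversed in the opposite sense. -/
def Dart.rev : Equiv.Perm (Dart V) :=
  Function.Involutive.toPerm (fun d => (d.1, !d.2)) (fun d => by simp)

/-- For a rotation `rot` (the next dart around the origin in counterclockwise order),
`facePerm rot d` is the dart following `d` on the boundary of the face on the right of `d`. -/
def facePerm (rot : Equiv.Perm (Dart V)) : Equiv.Perm (Dart V) := Dart.rev.trans rot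

/-- The faces (the exterior one included) of the plane graph with the given rotation:
the orbits of `facePerm`. -/
abbrev Orbit (rot : Equiv.Perm (Dart V)) : Type _ :=
  Quotient (Equiv.Perm.SameCycle.setoid (facePerm rot))

/-- The face on the right of a dart. -/
def rightFace (rot : Equiv.Perm (Dart V)) (d : Dart V) : Orbit rot := Quotient.mk _ d

end Plane

open Quiver in
/-- A pasting scheme on a finite directed (multi)graph: a plane embedding of the graph, an
acyclic orientation, and a source `s` and a sink `t` on the exterior face. The plane embedding
is given, up to isotopy, by the counterclockwise cyclic orders of the darts around the vertices
(`rot`), which describe an embedding in the sphere exactly if Euler's formula holds, and by the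
choice of the exterior face. -/
structure PastingScheme (V : Type*) [Quiver V] where
  s : V
  t : V
  rot : Equiv.Perm (Dart V)
  sameCycle_rot : ∀ d d' : Dart V, rot.SameCycle d d' ↔ d.origin = d'.origin
  euler : Nat.card V + Nat.card (Orbit rot) = Nat.card (Total V) + 2
  exterior : Orbit rot
  s_ne_t : s ≠ t
  s_mem_exterior : ∃ d : Dart V, d.origin = s ∧ rightFace rot d = exterior
  t_mem_exterior : ∃ d : Dart V, d.origin = t ∧ rightFace rot d = exterior
  reachable : ∀ v : V, Nonempty (Path s v) ∧ Nonempty (Path v t)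
  acyclic : Acyclic V

section Perm
variable {D : Type*}

lemma exists_descent (π : Equiv.Perm D) [Finite D] {P : D → Prop} {x y : D}
    (h : π.SameCycle x y) (hx : P x) (hy : ¬ P y) :
    ∃ z, π.SameCycle x z ∧ P z ∧ ¬ P (π z) := by
  obtain ⟨n, rfl⟩ := h.exists_nat_pow_eq
  by_contra! hc
  have : ∀ k, P ((π ^ k) x) := by
    intro k
    induction k with
    | zero => simpa using hx
    | succ k ih =>
      have := hc ((π ^ k) x) ⟨k, by simp⟩ ih
      rwa [pow_succ', Equiv.Perm.mul_apply]
  exact hy (this n)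

open Classical in
lemma card_descent [Fintype D] (π : Equiv.Perm D) (P : D → Prop)
    [DecidablePred fun d => P d ∧ ¬ P (π d)] [DecidablePred fun d => ¬ P d ∧ P (π d)] :
    (Finset.univ.filter fun d => P d ∧ ¬ P (π d)).card =
      (Finset.univ.filter fun d => ¬ P d ∧ P (π d)).card := by
  have h1 : (Finset.univ.filter fun d => P d).card = (Finset.univ.filter fun d => P (π d)).card := by
    refine Finset.card_bij (fun d _ => π.symm d) (by simp) (by simp) ?_
    intro b hb
    exact ⟨π b, by simpa using hb, by simp⟩
  have h2 := Finset.card_filter_add_card_filter_not (s := Finset.univ.filter fun d => P d)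
    (fun d => P (π d))
  have h3 := Finset.card_filter_add_card_filter_not (s := Finset.univ.filter fun d => P (π d))
    (fun d => P d)
  simp only [Finset.filter_filter] at h2 h3
  have h4 : (Finset.univ.filter fun d => P d ∧ P (π d)) =
      (Finset.univ.filter fun d => P (π d) ∧ P d) := by ext; simp [and_comm]
  rw [h4] at h2
  have h6 : (Finset.univ.filter fun d => P d ∧ ¬ P (π d)).card =
      (Finset.univ.filter fun d => P (π d) ∧ ¬ P d).card := by
    have h7 : (Finset.univ.filter fun d => P d ∧ ¬ P (π d)).card +
        (Finset.univ.filter fun d => P (π d) ∧ P d).card =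
        (Finset.univ.filter fun d => P (π d) ∧ ¬ P d).card +
        (Finset.univ.filter fun d => P (π d) ∧ P d).card := by
      rw [add_comm, add_comm (Finset.card (Finset.univ.filter fun d => P (π d) ∧ ¬ P d))]
      convert h2.trans (h1.trans h3.symm)
    exact Nat.add_right_cancel h7
  have h8 : (Finset.univ.filter fun d => ¬ P d ∧ P (π d)) =
      (Finset.univ.filter fun d => P (π d) ∧ ¬ P d) := by ext; simp [and_comm]
  rw [h8]
  convert h6

/-- One run of a face: for a perm `π` and a property `P` that each orbit enters only once. -/
lemma exists_run (π : Equiv.Perm D) {P : D → Prop} {z z' : D}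
    (hz : ¬ P z ∧ P (π z)) (hz' : P z' ∧ ¬ P (π z')) [Finite D] (hs : π.SameCycle z z')
    (hu : ∀ y, π.SameCycle z y → ¬ P y ∧ P (π y) → y = z)
    (hu' : ∀ y, π.SameCycle z y → P y ∧ ¬ P (π y) → y = z') :
    ∃ n, (∀ i ≤ n, P ((π ^ i) (π z))) ∧ (π ^ n) (π z) = z' ∧
      ∀ y, π.SameCycle z y → P y → ∃ i ≤ n, (π ^ i) (π z) = y := by
  classical
  have hex : ∃ n, P ((π ^ n) (π z)) ∧ ¬ P (π ((π ^ n) (π z))) := by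
    obtain ⟨n, hn⟩ := ((Equiv.Perm.sameCycle_apply_left).2 hs).exists_nat_pow_eq
    exact ⟨n, by rwa [hn]⟩
  have hsc : ∀ i : ℕ, π.SameCycle z ((π ^ i) (π z)) := fun i =>
    ⟨i + 1, by
      rw [zpow_add_one, Equiv.Perm.mul_apply, zpow_natCast]⟩
  let n := Nat.find hex
  have hn := Nat.find_spec hex
  have hmin : ∀ i < n, ¬ (P ((π ^ i) (π z)) ∧ ¬ P (π ((π ^ i) (π z)))) := fun i hi =>
    Nat.find_min hex hi
  have hall : ∀ i ≤ n, P ((π ^ i) (π z)) := by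
    intro i
    induction i with
    | zero => intro _; simpa using hz.2
    | succ i ih =>
      intro hi
      have h1 := hmin i (by omega)
      have h2 := ih (by omega)
      rw [pow_succ', Equiv.Perm.mul_apply]
      by_contra h3
      exact h1 ⟨h2, h3⟩
  refine ⟨n, hall, hu' _ (hsc n) hn, ?_⟩
  intro y hy hPy
  obtain ⟨k, hk⟩ := ((Equiv.Perm.sameCycle_apply_left).2 hy).exists_nat_pow_eq
  induction k using Nat.strong_induction_on with
  | _ k ih =>
    by_cases hkn : k ≤ n
    · exact ⟨k, hkn, hk⟩
    -- going from position `n + 1` to `k` the orbit enters `P` again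
    have : ∃ j, n < j ∧ j < k ∧ ¬ P ((π ^ j) (π z)) ∧ P (π ((π ^ j) (π z))) := by
      by_contra! hc
      have : ∀ j, n < j → j ≤ k → ¬ P ((π ^ j) (π z)) := by
        intro j
        induction j with
        | zero => intro h; omega
        | succ j ihj =>
          intro h1 h2
          rw [pow_succ', Equiv.Perm.mul_apply]
          rcases Nat.lt_or_ge n j with h3 | h3
          · exact hc j h3 (by omega) (ihj h3 (by omega))
          · obtain rfl : j = n := by omega
            exact hn.2
      exact this k (by omega) le_rfl (hk ▸ hPy)
    obtain ⟨j, hj1, hj2, hj3⟩ := this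
    have hjz := hu _ (hsc j) hj3
    refine ih (k - (j + 1)) (by omega) ?_
    have h1 : (π ^ k) (π z) = (π ^ (k - (j + 1))) ((π ^ (j + 1)) (π z)) := by
      generalize π z = x
      rw [← Equiv.Perm.mul_apply, ← pow_add]
      congr 2
      omega
    rw [h1, pow_succ' π j, Equiv.Perm.mul_apply, hjz] at hk
    exact hk

end Perm

namespace PastingScheme
open Quiver

variable {V : Type*} [Quiver V] (𝒢 : PastingScheme V)

lemma origin_next (d : Dart V) : (facePerm 𝒢.rot d).origin = (Dart.rev d).origin :=
  ((𝒢.sameCycle_rot _ _).1 ⟨1, by simp [facePerm]⟩).symm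

lemma not_into_s (e : Total V) : e.right ≠ 𝒢.s := by
  intro h
  obtain ⟨p⟩ := (𝒢.reachable e.left).1
  exact 𝒢.acyclic.not_mem_left ((h ▸ e.hom.toPath).comp p) (e := e)
    (by
      obtain ⟨a, b, f⟩ := e
      dsimp at h p ⊢
      subst h
      simp [Hom.toPath]) rfl

lemma not_out_of_t (e : Total V) : e.left ≠ 𝒢.t := by
  intro h
  obtain ⟨p⟩ := (𝒢.reachable e.right).2
  exact 𝒢.acyclic.not_mem_left (e.hom.toPath.comp p) (e := e) (by simp [Hom.toPath]) h

lemma exists_out {v : V} (hv : v ≠ 𝒢.t) : ∃ e : Total V, e.left = v := by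
  obtain ⟨p⟩ := (𝒢.reachable v).2
  generalize 𝒢.t = t at p hv
  induction p with
  | nil => exact (hv rfl).elim
  | cons p e ih =>
    rename_i b c
    by_cases h : v = b
    · subst h; exact ⟨⟨_, _, e⟩, rfl⟩
    · exact ih h

lemma exists_in {v : V} (hv : v ≠ 𝒢.s) : ∃ e : Total V, e.right = v := by
  obtain ⟨p⟩ := (𝒢.reachable v).1
  cases p with
  | nil => exact (hv rfl).elim
  | cons p e => exact ⟨⟨_, _, e⟩, rfl⟩

lemma le_succ_split {n : ℕ} {q : ℕ → Prop} :
    (∃ i ≤ n + 1, q i) ↔ (∃ i ≤ n, q i) ∨ q (n + 1) := by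
  constructor
  · rintro ⟨i, hi, h⟩
    rcases Nat.lt_or_ge n i with h' | h'
    · obtain rfl : i = n + 1 := by omega
      exact Or.inr h
    · exact Or.inl ⟨i, h', h⟩
  · rintro (⟨i, hi, h⟩ | h)
    · exact ⟨i, by omega, h⟩
    · exact ⟨n + 1, le_rfl, h⟩

/-- Following a face along darts traversed forwards gives a directed path. -/
lemma exists_forward (x : Dart V) (n : ℕ) (h : ∀ i ≤ n, ((facePerm 𝒢.rot ^ i) x).2 = true)
    (a b : V) (ha : x.origin = a) (hb : (Dart.rev ((facePerm 𝒢.rot ^ n) x)).origin = b) :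
    ∃ p : Path a b, ∀ e, e ∈ edges p ↔ ∃ i ≤ n, (facePerm 𝒢.rot ^ i) x = (e, true) := by
  induction n generalizing b with
  | zero =>
    have h0 : x.2 = true := by simpa using h 0
    obtain ⟨e, b⟩ := x
    dsimp at h0
    subst h0
    subst ha
    subst hb
    refine ⟨e.hom.toPath, ?_⟩
    intro e'
    simp only [Nat.le_zero, exists_eq_left, pow_zero, Equiv.Perm.coe_one, id_eq, Prod.mk.injEq,
      and_true]
    change e' ∈ edges ((Path.nil : Path e.left e.left).cons e.hom) ↔ _
    rw [edges_cons, edges_nil, List.nil_append, List.mem_singleton]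
    exact eq_comm
  | succ n ih =>
    have ho : (Dart.rev ((facePerm 𝒢.rot ^ n) x)).origin =
        ((facePerm 𝒢.rot ^ (n + 1)) x).origin := by
      rw [pow_succ', Equiv.Perm.mul_apply, origin_next]
    obtain ⟨p, hp⟩ := ih (fun i hi => h i (by omega)) _ ho
    have hn := h (n + 1) le_rfl
    simp only [le_succ_split]
    generalize (facePerm 𝒢.rot ^ (n + 1)) x = y at hn p hp hb ⊢
    obtain ⟨e, c⟩ := y
    dsimp at hn
    subst hn
    subst hb
    obtain ⟨p, hp⟩ : ∃ p : Path a e.left, ∀ g, g ∈ edges p ↔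
        ∃ i ≤ n, (facePerm 𝒢.rot ^ i) x = (g, true) := ⟨p, hp⟩
    refine ⟨p.comp e.hom.toPath, fun e' => ?_⟩
    change e' ∈ edges (p.comp (Path.nil.cons e.hom)) ↔ _
    rw [edges_comp, List.mem_append, hp]
    simp only [edges_cons, edges_nil, List.nil_append, List.mem_singleton, Prod.mk.injEq,
      and_true]
    rw [eq_comm (a := e)]

/-- Following a face along darts traversed backwards gives a reversed directed path. -/
lemma exists_backward (x : Dart V) (n : ℕ) (h : ∀ i ≤ n, ((facePerm 𝒢.rot ^ i) x).2 = false)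
    (a b : V) (ha : x.origin = a) (hb : (Dart.rev ((facePerm 𝒢.rot ^ n) x)).origin = b) :
    ∃ p : Path b a, ∀ e, e ∈ edges p ↔ ∃ i ≤ n, (facePerm 𝒢.rot ^ i) x = (e, false) := by
  induction n generalizing b with
  | zero =>
    have h0 : x.2 = false := by simpa using h 0
    obtain ⟨e, b⟩ := x
    dsimp at h0
    subst h0
    subst ha
    subst hb
    refine ⟨e.hom.toPath, ?_⟩
    intro e'
    simp only [Nat.le_zero, exists_eq_left, pow_zero, Equiv.Perm.coe_one, id_eq, Prod.mk.injEq,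
      and_true]
    change e' ∈ edges ((Path.nil : Path e.left e.left).cons e.hom) ↔ _
    rw [edges_cons, edges_nil, List.nil_append, List.mem_singleton]
    exact eq_comm
  | succ n ih =>
    have ho : (Dart.rev ((facePerm 𝒢.rot ^ n) x)).origin =
        ((facePerm 𝒢.rot ^ (n + 1)) x).origin := by
      rw [pow_succ', Equiv.Perm.mul_apply, origin_next]
    obtain ⟨p, hp⟩ := ih (fun i hi => h i (by omega)) _ ho
    have hn := h (n + 1) le_rfl
    simp only [le_succ_split]
    generalize (facePerm 𝒢.rot ^ (n + 1)) x = y at hn p hp hb ⊢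
    obtain ⟨e, c⟩ := y
    dsimp at hn
    subst hn
    subst hb
    obtain ⟨p, hp⟩ : ∃ p : Path e.right a, ∀ g, g ∈ edges p ↔
        ∃ i ≤ n, (facePerm 𝒢.rot ^ i) x = (g, false) := ⟨p, hp⟩
    refine ⟨e.hom.toPath.comp p, fun e' => ?_⟩
    change e' ∈ edges ((Path.nil.cons e.hom).comp p) ↔ _
    rw [edges_comp, List.mem_append, hp]
    simp only [edges_cons, edges_nil, List.nil_append, List.mem_singleton, Prod.mk.injEq,
      and_true]
    rw [eq_comm (a := e), or_comm]

lemma rightFace_eq {d d' : Dart V} :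
    rightFace 𝒢.rot d = rightFace 𝒢.rot d' ↔ (facePerm 𝒢.rot).SameCycle d d' :=
  Quotient.eq

lemma rightFace_next (x : Dart V) : rightFace 𝒢.rot (facePerm 𝒢.rot x) = rightFace 𝒢.rot x :=
  (𝒢.rightFace_eq).2 (Equiv.Perm.SameCycle.symm ⟨1, by simp⟩)

lemma rightFace_pow (x : Dart V) (i : ℕ) :
    rightFace 𝒢.rot ((facePerm 𝒢.rot ^ i) x) = rightFace 𝒢.rot x :=
  (𝒢.rightFace_eq).2 (Equiv.Perm.SameCycle.symm ⟨i, by simp⟩)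

section Count
variable [Finite (Total V)]

lemma exists_forward_dart (f : Orbit 𝒢.rot) : ∃ d, rightFace 𝒢.rot d = f ∧ d.2 = true := by
  obtain ⟨d, rfl⟩ := Quotient.exists_rep f
  by_contra! hc
  have hall : ∀ i, ((facePerm 𝒢.rot ^ i) d).2 = false := by
    intro i
    by_contra h
    exact hc ((facePerm 𝒢.rot ^ i) d) ((𝒢.rightFace_eq).2 (Equiv.Perm.SameCycle.symm ⟨i, by simp⟩))
      (by simpa using h)
  set k := orderOf (facePerm 𝒢.rot) with hk
  have hk0 : 0 < k := orderOf_pos _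
  have hpow : (facePerm 𝒢.rot ^ k) d = d := by rw [pow_orderOf_eq_one]; rfl
  obtain ⟨p, hp⟩ := 𝒢.exists_backward d (k - 1) (fun i _ => hall i) d.origin d.origin rfl
    (by
      rw [← origin_next, ← Equiv.Perm.mul_apply, ← pow_succ']
      rw [Nat.sub_add_cancel hk0, hpow])
  have h0 := 𝒢.acyclic _ p
  have h1 := (hp d.1).2 ⟨0, by omega, by
    have := hall 0
    simp only [pow_zero, Equiv.Perm.coe_one, id_eq] at this ⊢
    rw [← this]⟩
  rw [h0] at h1
  simp at h1

lemma exists_backward_dart (f : Orbit 𝒢.rot) : ∃ d, rightFace 𝒢.rot d = f ∧ d.2 = false := by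
  obtain ⟨d, rfl⟩ := Quotient.exists_rep f
  by_contra! hc
  have hall : ∀ i, ((facePerm 𝒢.rot ^ i) d).2 = true := by
    intro i
    by_contra h
    exact hc ((facePerm 𝒢.rot ^ i) d) ((𝒢.rightFace_eq).2 (Equiv.Perm.SameCycle.symm ⟨i, by simp⟩))
      (by simpa using h)
  set k := orderOf (facePerm 𝒢.rot) with hk
  have hk0 : 0 < k := orderOf_pos _
  have hpow : (facePerm 𝒢.rot ^ k) d = d := by rw [pow_orderOf_eq_one]; rfl
  obtain ⟨p, hp⟩ := 𝒢.exists_forward d (k - 1) (fun i _ => hall i) d.origin d.origin rfl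
    (by
      rw [← origin_next, ← Equiv.Perm.mul_apply, ← pow_succ']
      rw [Nat.sub_add_cancel hk0, hpow])
  have h0 := 𝒢.acyclic _ p
  have h1 := (hp d.1).2 ⟨0, by omega, by
    have := hall 0
    simp only [pow_zero, Equiv.Perm.coe_one, id_eq] at this ⊢
    rw [← this]⟩
  rw [h0] at h1
  simp at h1

lemma exists_face_descent (f : Orbit 𝒢.rot) :
    ∃ d, rightFace 𝒢.rot d = f ∧ d.2 = true ∧ ¬ (facePerm 𝒢.rot d).2 = true := by
  obtain ⟨x, rfl, hx⟩ := 𝒢.exists_forward_dart f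
  obtain ⟨y, hy, hy'⟩ := 𝒢.exists_backward_dart (rightFace 𝒢.rot x)
  obtain ⟨z, hz, hz1, hz2⟩ := exists_descent (facePerm 𝒢.rot) (P := fun d => d.2 = true)
    ((𝒢.rightFace_eq).1 hy.symm) hx (by simp [hy'])
  exact ⟨z, (𝒢.rightFace_eq).2 hz.symm, hz1, hz2⟩

lemma exists_face_ascent (f : Orbit 𝒢.rot) :
    ∃ d, rightFace 𝒢.rot d = f ∧ ¬ d.2 = true ∧ (facePerm 𝒢.rot d).2 = true := by
  obtain ⟨x, rfl, hx⟩ := 𝒢.exists_backward_dart f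
  obtain ⟨y, hy, hy'⟩ := 𝒢.exists_forward_dart (rightFace 𝒢.rot x)
  obtain ⟨z, hz, hz1, hz2⟩ := exists_descent (facePerm 𝒢.rot) (P := fun d => ¬ d.2 = true)
    ((𝒢.rightFace_eq).1 hy.symm) (by simp [hx]) (by simp [hy'])
  exact ⟨z, (𝒢.rightFace_eq).2 hz.symm, hz1, by simpa using hz2⟩

variable [Finite V]

open Classical in
lemma card_face_descent [Fintype (Dart V)] :
    (Finset.univ.filter fun d : Dart V => d.2 = true ∧ ¬ (facePerm 𝒢.rot d).2 = true).card ≤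
      Nat.card (Orbit 𝒢.rot) := by
  have : Fintype V := Fintype.ofFinite V
  have : Fintype (Total V) := Fintype.ofFinite _
  have hface := card_descent (facePerm 𝒢.rot) (fun d => d.2 = true)
  have hrot := card_descent 𝒢.rot (fun d => d.2 = true)
  -- the four kinds of corners
  have e1 : (Finset.univ.filter fun d : Dart V => d.2 = true ∧ ¬ (facePerm 𝒢.rot d).2 = true).card =
      (Finset.univ.filter fun d : Dart V => ¬ d.2 = true ∧ ¬ (𝒢.rot d).2 = true).card := by
    refine Finset.card_bij (fun d _ => Dart.rev d) ?_ (by simp) ?_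
    · intro d hd
      simpa [facePerm, Dart.rev, Function.Involutive.toPerm] using hd
    · intro d hd
      refine ⟨Dart.rev d, ?_, ?_⟩
      · simpa [facePerm, Dart.rev, Function.Involutive.toPerm] using hd
      · simp [Dart.rev, Function.Involutive.toPerm]
  have e2 : (Finset.univ.filter fun d : Dart V => ¬ d.2 = true ∧ (facePerm 𝒢.rot d).2 = true).card =
      (Finset.univ.filter fun d : Dart V => d.2 = true ∧ (𝒢.rot d).2 = true).card := by
    refine Finset.card_bij (fun d _ => Dart.rev d) ?_ (by simp) ?_
    · intro d hd
      simpa [facePerm, Dart.rev, Function.Involutive.toPerm] using hd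
    · intro d hd
      refine ⟨Dart.rev d, ?_, ?_⟩
      · simpa [facePerm, Dart.rev, Function.Involutive.toPerm] using hd
      · simp [Dart.rev, Function.Involutive.toPerm]
  have hsum : (Finset.univ.filter fun d : Dart V => d.2 = true ∧ (𝒢.rot d).2 = true).card +
      (Finset.univ.filter fun d : Dart V => d.2 = true ∧ ¬ (𝒢.rot d).2 = true).card +
      ((Finset.univ.filter fun d : Dart V => ¬ d.2 = true ∧ (𝒢.rot d).2 = true).card +
      (Finset.univ.filter fun d : Dart V => ¬ d.2 = true ∧ ¬ (𝒢.rot d).2 = true).card) =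
      2 * Nat.card (Total V) := by
    have h1 := Finset.card_filter_add_card_filter_not
      (s := Finset.univ.filter fun d : Dart V => d.2 = true) (fun d => (𝒢.rot d).2 = true)
    have h2 := Finset.card_filter_add_card_filter_not
      (s := Finset.univ.filter fun d : Dart V => ¬ d.2 = true) (fun d => (𝒢.rot d).2 = true)
    have h3 := Finset.card_filter_add_card_filter_not
      (s := (Finset.univ : Finset (Dart V))) (fun d => d.2 = true)
    simp only [Finset.filter_filter] at h1 h2
    rw [h1, h2, h3, Finset.card_univ, ← Nat.card_eq_fintype_card, Nat.card_prod]
    simp [mul_comm]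
  -- every vertex other than `s`, `t` has a corner between an outgoing and an incoming edge
  have hV : Nat.card V ≤
      (Finset.univ.filter fun d : Dart V => d.2 = true ∧ ¬ (𝒢.rot d).2 = true).card + 2 := by
    have hsub : (Finset.univ : Finset V) ⊆
        (Finset.univ.filter fun d : Dart V => d.2 = true ∧ ¬ (𝒢.rot d).2 = true).image
          Dart.origin ∪ {𝒢.s, 𝒢.t} := by
      intro v _
      by_cases hs : v = 𝒢.s
      · simp [hs]
      by_cases ht : v = 𝒢.t
      · simp [ht]
      obtain ⟨e, he⟩ := 𝒢.exists_out ht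
      obtain ⟨g, hg⟩ := 𝒢.exists_in hs
      obtain ⟨z, hz, hz1, hz2⟩ := exists_descent 𝒢.rot (P := fun d : Dart V => d.2 = true)
        (x := (e, true)) (y := (g, false))
        ((𝒢.sameCycle_rot _ _).2 (by simp [Dart.origin, he, hg])) rfl (by simp)
      refine Finset.mem_union_left _ (Finset.mem_image.2 ⟨z, by simp [hz1, hz2], ?_⟩)
      rw [← (𝒢.sameCycle_rot _ _).1 hz]
      simp [Dart.origin, he]
    calc Nat.card V = (Finset.univ : Finset V).card := by simp
      _ ≤ _ := Finset.card_le_card hsub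
      _ ≤ _ := Finset.card_union_le _ _
      _ ≤ _ := Nat.add_le_add Finset.card_image_le Finset.card_le_two
  have := 𝒢.euler
  omega

lemma descent_unique {x y : Dart V} (h : rightFace 𝒢.rot x = rightFace 𝒢.rot y)
    (hx : x.2 = true ∧ ¬ (facePerm 𝒢.rot x).2 = true)
    (hy : y.2 = true ∧ ¬ (facePerm 𝒢.rot y).2 = true) : x = y := by
  classical
  have : Fintype (Dart V) := Fintype.ofFinite _
  have : Fintype (Orbit 𝒢.rot) := Fintype.ofFinite _
  refine Finset.inj_on_of_surj_on_of_card_le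
    (s := Finset.univ.filter fun d : Dart V => d.2 = true ∧ ¬ (facePerm 𝒢.rot d).2 = true)
    (t := (Finset.univ : Finset (Orbit 𝒢.rot)))
    (fun d _ => rightFace 𝒢.rot d) (by simp) ?_ ?_ (by simpa using hx) (by simpa using hy) h
  · intro f _
    obtain ⟨d, hd, hd'⟩ := 𝒢.exists_face_descent f
    exact ⟨d, by simpa using hd', hd⟩
  · have := 𝒢.card_face_descent
    simpa [Nat.card_eq_fintype_card] using this

lemma ascent_unique {x y : Dart V} (h : rightFace 𝒢.rot x = rightFace 𝒢.rot y)
    (hx : ¬ x.2 = true ∧ (facePerm 𝒢.rot x).2 = true)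
    (hy : ¬ y.2 = true ∧ (facePerm 𝒢.rot y).2 = true) : x = y := by
  classical
  have : Fintype (Dart V) := Fintype.ofFinite _
  have : Fintype (Orbit 𝒢.rot) := Fintype.ofFinite _
  refine Finset.inj_on_of_surj_on_of_card_le
    (s := Finset.univ.filter fun d : Dart V => ¬ d.2 = true ∧ (facePerm 𝒢.rot d).2 = true)
    (t := (Finset.univ : Finset (Orbit 𝒢.rot)))
    (fun d _ => rightFace 𝒢.rot d) (by simp) ?_ ?_ (by simpa using hx) (by simpa using hy) h
  · intro f _
    obtain ⟨d, hd, hd'⟩ := 𝒢.exists_face_ascent f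
    exact ⟨d, by simpa using hd', hd⟩
  · have := 𝒢.card_face_descent
    rw [← card_descent (facePerm 𝒢.rot) (fun d => d.2 = true), Finset.card_univ,
      ← Nat.card_eq_fintype_card]
    exact this

/-- The boundary of every face of a pasting scheme consists of two directed paths with the same
endpoints: one along which the face is on the right, one along which it is on the left. -/
lemma exists_boundary (f : Orbit 𝒢.rot) : ∃ (a b : V) (σ τ : Path a b),
    (∀ e, e ∈ edges σ ↔ rightFace 𝒢.rot (e, true) = f) ∧
    (∀ e, e ∈ edges τ ↔ rightFace 𝒢.rot (e, false) = f) ∧ a ≠ b ∧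
    (f = 𝒢.exterior → a = 𝒢.s ∧ b = 𝒢.t) := by
  obtain ⟨z, rfl, hz⟩ := 𝒢.exists_face_ascent f
  obtain ⟨z', hzz', hz'⟩ := 𝒢.exists_face_descent (rightFace 𝒢.rot z)
  have hs := (𝒢.rightFace_eq).1 hzz'.symm
  have hu : ∀ y, (facePerm 𝒢.rot).SameCycle z y → ¬ y.2 = true ∧ (facePerm 𝒢.rot y).2 = true →
      y = z := fun y hy h => 𝒢.ascent_unique ((𝒢.rightFace_eq).2 hy.symm) h hz
  have hu' : ∀ y, (facePerm 𝒢.rot).SameCycle z y → y.2 = true ∧ ¬ (facePerm 𝒢.rot y).2 = true →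
      y = z' := fun y hy h => 𝒢.descent_unique
        (((𝒢.rightFace_eq).2 hy.symm).trans hzz'.symm) h hz'
  obtain ⟨n, hn1, hn2, hn3⟩ := exists_run (facePerm 𝒢.rot) (P := fun d => d.2 = true) hz hz' hs
    hu hu'
  obtain ⟨m, hm1, hm2, hm3⟩ := exists_run (facePerm 𝒢.rot) (P := fun d => ¬ d.2 = true)
    (z := z') (z' := z) (by simpa using hz') (by simpa using hz) hs.symm
    (fun y hy h => hu' y (hs.trans hy) (by simpa using h))
    (fun y hy h => hu y (hs.trans hy) (by simpa using h))
  obtain ⟨σ, hσ⟩ := 𝒢.exists_forward _ n hn1 (facePerm 𝒢.rot z).origin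
    (facePerm 𝒢.rot z').origin rfl (by rw [hn2, origin_next])
  obtain ⟨τ, hτ⟩ := 𝒢.exists_backward _ m (by simpa using hm1) (facePerm 𝒢.rot z').origin
    (facePerm 𝒢.rot z).origin rfl (by rw [hm2, origin_next])
  refine ⟨_, _, σ, τ, ?_, ?_, ?_, ?_⟩
  · intro e
    rw [hσ]
    constructor
    · rintro ⟨i, _, hi⟩
      rw [← hi, rightFace_pow, rightFace_next]
    · intro h
      exact hn3 _ ((𝒢.rightFace_eq).1 h.symm) rfl
  · intro e
    rw [hτ]
    constructor
    · rintro ⟨i, _, hi⟩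
      rw [← hi, rightFace_pow, rightFace_next, hzz']
    · intro h
      exact hm3 _ ((𝒢.rightFace_eq).1 (hzz'.trans h.symm)) (by simp)
  · intro hab
    have h1 : (facePerm 𝒢.rot z).1 ∈ edges σ := (hσ _).2 ⟨0, by omega, by
      simp only [pow_zero, Equiv.Perm.coe_one, id_eq]
      rw [← hz.2]⟩
    generalize (facePerm 𝒢.rot z').origin = b at hab σ h1
    subst hab
    rw [𝒢.acyclic _ σ] at h1
    simp at h1
  · intro hf
    constructor
    · obtain ⟨d, hd, hd'⟩ := 𝒢.s_mem_exterior
      have h1 : d.2 = true := by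
        by_contra h
        exact 𝒢.not_into_s d.1 (by simpa [Dart.origin, h] using hd)
      have h2 : ¬ ((facePerm 𝒢.rot).symm d).2 = true := by
        intro h
        have := 𝒢.origin_next ((facePerm 𝒢.rot).symm d)
        rw [Equiv.apply_symm_apply, hd] at this
        exact 𝒢.not_into_s ((facePerm 𝒢.rot).symm d).1
          (by simpa [Dart.origin, Dart.rev, Function.Involutive.toPerm, h] using this.symm)
      have h3 : (facePerm 𝒢.rot).symm d = z := by
        refine 𝒢.ascent_unique ?_ ⟨h2, by simpa using h1⟩ hz
        rw [hf, ← hd', ← 𝒢.rightFace_next, Equiv.apply_symm_apply]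
      rw [← h3, Equiv.apply_symm_apply, hd]
    · obtain ⟨d, hd, hd'⟩ := 𝒢.t_mem_exterior
      have h1 : ¬ d.2 = true := by
        intro h
        exact 𝒢.not_out_of_t d.1 (by simpa [Dart.origin, h] using hd)
      have h2 : ((facePerm 𝒢.rot).symm d).2 = true := by
        by_contra h
        have := 𝒢.origin_next ((facePerm 𝒢.rot).symm d)
        rw [Equiv.apply_symm_apply, hd] at this
        exact 𝒢.not_out_of_t ((facePerm 𝒢.rot).symm d).1
          (by simpa [Dart.origin, Dart.rev, Function.Involutive.toPerm, h] using this.symm)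
      have h3 : (facePerm 𝒢.rot).symm d = z' := by
        refine 𝒢.descent_unique ?_ ⟨h2, by simpa using h1⟩ hz'
        rw [hzz', hf, ← hd', ← 𝒢.rightFace_next, Equiv.apply_symm_apply]
      rw [← h3, Equiv.apply_symm_apply, hd]

end Count
end PastingScheme

section Boundary
open Quiver

/-- The boundary of a face: its source, its sink, its uppermost path `dom` and its lowermost
path `cod`. -/
structure Boundary (V : Type*) [Quiver V] where
  source : V
  sink : V
  dom : Path source sink
  cod : Path source sink

variable {V : Type*} [Quiver V]

/-- `Below b c`: the lowermost path of `b` and the uppermost path of `c` share an edge. -/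
def Below (b c : Boundary V) : Prop := ∃ e, e ∈ edges b.cod ∧ e ∈ edges c.dom

/-- A configuration in which a face with boundary `b` is followed by a face with boundary `c`
inside the union of the two: the lowermost path of `b`, extended by `u` and `v`, is the uppermost
path of `c`, extended by `u'` and `v'`; on either side at most one of the two is extended. So the
union has one of the four shapes given by the choice of the empty path among `u, u'` and
among `v, v'`. -/
structure GlueShape (b c : Boundary V) where
  source : V
  sink : V
  u : Path source b.source
  v : Path b.sink sink
  u' : Path source c.source
  v' : Path c.sink sink
  mid : u.comp (b.cod.comp v) = u'.comp (c.dom.comp v')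
  left : u.length = 0 ∨ u'.length = 0
  right : v.length = 0 ∨ v'.length = 0

/-- The boundary of the union of two faces. The edges common to the two faces and the vertices
interior to their common path do not occur in it. -/
def GlueShape.boundary {b c : Boundary V} (g : GlueShape b c) : Boundary V where
  source := g.source
  sink := g.sink
  dom := g.u.comp (b.dom.comp g.v)
  cod := g.u'.comp (c.cod.comp g.v')

/-- The strict linear extensions of the relation `Below` on the set `A` of faces: enumerations
of `A` in which `f` strictly precedes `g` whenever `f` is above `g`. -/
structure LinExt {Φ : Type*} (bd : Φ → Boundary V) (A : Set Φ) where
  list : List Φ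
  nodup : list.Nodup
  mem_iff : ∀ f, f ∈ list ↔ f ∈ A
  irrefl : ∀ f ∈ list, ¬ Below (bd f) (bd f)
  pairwise : list.Pairwise fun f g => ¬ Below (bd g) (bd f)

/-- A way of passing from the path `w` to the path `w'` by replacing, one after the other, the
uppermost paths of the faces in a list by their lowermost paths. -/
inductive Sweep {Φ : Type*} (bd : Φ → Boundary V) {s t : V} :
    Path s t → List Φ → Path s t → Type _
  | nil (w : Path s t) : Sweep bd w [] w
  | cons (f : Φ) (x : Path s (bd f).source) (y : Path (bd f).sink t) {w w' : Path s t}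
      {l : List Φ} (hw : w = x.comp ((bd f).dom.comp y))
      (rest : Sweep bd (x.comp ((bd f).cod.comp y)) l w') : Sweep bd w (f :: l) w'

/-- The incidence properties of the boundaries of the faces in `A` which hold in pasting schemes
and in those obtained from them by gluing. -/
structure Incidence {Φ : Type*} (bd : Φ → Boundary V) (A : Set Φ) {s t : V}
    (top bot : Path s t) : Prop where
  acyclic : Acyclic V
  ne : ∀ f ∈ A, (bd f).source ≠ (bd f).sink
  of_dom : ∀ f ∈ A, ∀ e ∈ edges (bd f).dom, e ∈ edges top ∨ ∃ g ∈ A, e ∈ edges (bd g).cod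
  dom_unique : ∀ f ∈ A, ∀ g ∈ A, ∀ e ∈ edges (bd f).dom, e ∈ edges (bd g).dom → f = g
  cod_unique : ∀ f ∈ A, ∀ g ∈ A, ∀ e ∈ edges (bd f).cod, e ∈ edges (bd g).cod → f = g
  mem_bot : ∀ e, e ∈ edges bot ↔
    (e ∈ edges top ∨ ∃ f ∈ A, e ∈ edges (bd f).cod) ∧ ∀ f ∈ A, e ∉ edges (bd f).dom

lemma Incidence.exists_sweep_aux {Φ : Type*} {bd : Φ → Boundary V} {A : Set Φ} {s t : V}
    {top bot : Path s t} (h : Incidence bd A top bot) (l : List Φ) :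
    ∀ (D : List Φ) (w : Path s t), (∀ f, f ∈ D ++ l ↔ f ∈ A) → (D ++ l).Nodup →
      (∀ f ∈ D ++ l, ¬ Below (bd f) (bd f)) →
      (D ++ l).Pairwise (fun f g => ¬ Below (bd g) (bd f)) →
      (∀ e, e ∈ edges w ↔
        (e ∈ edges top ∨ ∃ f ∈ D, e ∈ edges (bd f).cod) ∧ ∀ f ∈ D, e ∉ edges (bd f).dom) →
      Nonempty (Sweep bd w l bot) := by
  induction l with
  | nil =>
    intro D w hA _ _ _ hw
    simp only [List.append_nil] at hA
    have : w = bot := by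
      refine h.acyclic.eq_of_subset _ _ fun e he => ?_
      rw [h.mem_bot]
      rw [hw] at he
      simpa only [hA] using he
    subst this
    exact ⟨.nil _⟩
  | cons f l ih =>
    intro D w hA hnd hirr hpw hw
    have hfA : f ∈ A := (hA f).1 (by simp)
    have hDA : ∀ g ∈ D, g ∈ A := fun g hg => (hA g).1 (by simp [hg])
    have hfD : f ∉ D := by
      intro hf
      exact (List.nodup_append.1 hnd).2.2 f hf f (by simp) rfl
    have hlater : ∀ g ∈ f :: l, ∀ g' ∈ D, ¬ Below (bd g) (bd g') := fun g hg g' hg' =>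
      (List.pairwise_append.1 hpw).2.2 g' hg' g hg
    have hsub : ∀ e ∈ edges (bd f).dom, e ∈ edges w := by
      intro e he
      rw [hw]
      refine ⟨?_, fun g hg hge => hfD (h.dom_unique f hfA g (hDA g hg) e he hge ▸ hg)⟩
      rcases h.of_dom f hfA e he with h1 | ⟨g, hg, hge⟩
      · exact Or.inl h1
      · right
        have hb : Below (bd g) (bd f) := ⟨e, hge, he⟩
        have hg' := (hA g).2 hg
        rw [List.mem_append, List.mem_cons] at hg'
        rcases hg' with hg' | rfl | hg'
        · exact ⟨g, hg', hge⟩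
        · exact (hirr _ (by simp) hb).elim
        · exact ((List.pairwise_cons.1 (List.pairwise_append.1 hpw).2.1).1 g hg' hb).elim
    obtain ⟨x, y, hxy⟩ := h.acyclic.exists_segment w (bd f).dom (h.ne f hfA) hsub
    have hnodup := h.acyclic.nodup_edges w
    obtain ⟨r⟩ := ih (D ++ [f]) (x.comp ((bd f).cod.comp y)) (by simpa using hA)
      (by simpa using hnd) (by simpa using hirr) (by simpa using hpw) (by
        intro e
        have hwe := hw e
        rw [hxy] at hwe hnodup
        simp only [edges_comp, List.mem_append, List.nodup_append] at hwe hnodup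
        have hex : (∃ g ∈ D ++ [f], e ∈ edges (bd g).cod) ↔
            (∃ g ∈ D, e ∈ edges (bd g).cod) ∨ e ∈ edges (bd f).cod := by
          simp only [List.mem_append, List.mem_singleton, or_and_right, exists_or, exists_eq_left]
        have hall : (∀ g ∈ D ++ [f], e ∉ edges (bd g).dom) ↔
            (∀ g ∈ D, e ∉ edges (bd g).dom) ∧ e ∉ edges (bd f).dom := by
          simp only [List.mem_append, List.mem_singleton, or_imp, forall_and, forall_eq]
        rw [hex, hall, edges_comp, edges_comp, List.mem_append, List.mem_append]
        constructor
        · rintro (he | he | he)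
          · have h1 := hwe.1 (Or.inl he)
            exact ⟨h1.1.elim Or.inl fun h2 => Or.inr (Or.inl h2), h1.2, fun h2 =>
              hnodup.2.2 e he e (Or.inl h2) rfl⟩
          · refine ⟨Or.inr (Or.inr he), fun g hg hge => ?_, fun h2 => ?_⟩
            · exact hlater f (by simp) g hg ⟨e, he, hge⟩
            · exact hirr f (by simp) ⟨e, he, h2⟩
          · have h1 := hwe.1 (Or.inr (Or.inr he))
            exact ⟨h1.1.elim Or.inl fun h2 => Or.inr (Or.inl h2), h1.2, fun h2 =>
              hnodup.2.1.2.2 e h2 e he rfl⟩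
        · rintro ⟨h1, h2, h3⟩
          by_cases hf : e ∈ edges (bd f).cod
          · exact Or.inr (Or.inl hf)
          · rcases hwe.2 ⟨h1.imp_right fun h => h.resolve_right hf, h2⟩ with h4 | h4 | h4
            · exact Or.inl h4
            · exact (h3 h4).elim
            · exact Or.inr (Or.inr h4))
    exact ⟨.cons f x y hxy r⟩

lemma Incidence.exists_sweep {Φ : Type*} {bd : Φ → Boundary V} {A : Set Φ} {s t : V}
    {top bot : Path s t} (h : Incidence bd A top bot) (X : LinExt bd A) :
    Nonempty (Sweep bd top X.list bot) :=
  h.exists_sweep_aux X.list [] top (by simpa using X.mem_iff) (by simpa using X.nodup)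
    (by simpa using X.irrefl) (by simpa using X.pairwise) (by simp)

lemma segment_unique {a b c d : V} (hV : Acyclic V) {p : Path c d}
    {x x' : Path a c} {y y' : Path d b} (h : x.comp (p.comp y) = x'.comp (p.comp y')) :
    x = x' ∧ y = y' := by
  have hx : x = x' := by
    refine hV.eq_of_subset _ _ fun e he => ?_
    have h1 : e ∈ edges (x'.comp (p.comp y')) := by rw [← h]; simp [he]
    rw [edges_comp, List.mem_append] at h1
    rcases h1 with h1 | h1
    · exact h1
    · obtain ⟨z₁, z₂, h2⟩ := exists_split _ h1
      obtain ⟨z₃, z₄, h3⟩ := exists_split _ he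
      have h4 := congrArg Path.length (hV _ (z₁.comp (e.hom.toPath.comp z₄)))
      simp [Path.length_comp] at h4
  subst hx
  rw [Path.comp_inj_right, Path.comp_inj_right] at h
  exact ⟨rfl, h⟩

lemma sweep_subsingleton {Φ : Type*} {bd : Φ → Boundary V} {s t : V}
    (hV : Acyclic V) (l : List Φ) : ∀ {w w' : Path s t} (σ σ' : Sweep bd w l w'), σ = σ' := by
  induction l with
  | nil => intro w w' σ σ'; cases σ; cases σ'; rfl
  | cons f l ih =>
    intro w w' σ σ'
    cases σ with
    | cons _ x y hw r =>
      cases σ' with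
      | cons _ x' y' hw' r' =>
        obtain ⟨rfl, rfl⟩ := segment_unique hV (hw.symm.trans hw')
        rw [ih r r']

lemma mem_extension {E : Type*} {u b v u' c v' : List E} (h : u ++ (b ++ v) = u' ++ (c ++ v'))
    (hn : (u ++ (b ++ v)).Nodup) {x : E} (hb : x ∈ b) (hc : x ∈ c) (hl : u = [] ∨ u' = [])
    (hr : v = [] ∨ v' = []) (e : E) : (e ∈ u ∨ e ∈ v) ↔ (e ∈ c ∧ e ∉ b) := by
  have hn' := hn
  rw [h] at hn'
  simp only [List.nodup_append, List.mem_append] at hn hn'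
  have hu : e ∈ u → e ∈ c := by
    intro he
    rcases hl with rfl | rfl
    · simp at he
    · rw [List.nil_append, List.append_eq_append_iff] at h
      rcases h with ⟨a, rfl, h2⟩ | ⟨a, rfl, h2⟩
      · exact List.mem_append_left _ he
      · exact (hn.2.2 x (List.mem_append_left _ hc) x (Or.inl hb) rfl).elim
  have hv : e ∈ v → e ∈ c := by
    intro he
    rcases hr with rfl | rfl
    · simp at he
    · rw [List.append_nil, ← List.append_assoc, List.append_eq_append_iff] at h
      rcases h with ⟨a, rfl, h2⟩ | ⟨a, h1, rfl⟩
      · have : x ∈ u ++ b := List.mem_append_right _ hb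
        exact (hn'.2.2 x (List.mem_append_left _ this) x (Or.inl hc) rfl).elim
      · exact List.mem_append_right _ he
  constructor
  · rintro (he | he)
    · exact ⟨hu he, fun h' => hn.2.2 e he e (Or.inl h') rfl⟩
    · exact ⟨hv he, fun h' => hn.2.1.2.2 e h' e he rfl⟩
  · rintro ⟨h1, h2⟩
    have : e ∈ u ++ (b ++ v) := by rw [h]; simp [h1]
    simp only [List.mem_append] at this
    tauto

lemma edges_eq_nil {a b : V} {p : Path a b} (h : p.length = 0) : edges p = [] := by
  cases p with
  | nil => rfl
  | cons p e => simp at h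

lemma GlueShape.mem_dom {b c : Boundary V} (g : GlueShape b c) (hV : Acyclic V) (hbc : Below b c)
    (e : Total V) :
    e ∈ edges g.boundary.dom ↔ e ∈ edges b.dom ∨ (e ∈ edges c.dom ∧ e ∉ edges b.cod) := by
  obtain ⟨x, hx1, hx2⟩ := hbc
  have h := congrArg edges g.mid
  have hn := hV.nodup_edges (g.u.comp (b.cod.comp g.v))
  simp only [edges_comp] at h hn
  rw [← mem_extension h hn hx1 hx2 (g.left.imp edges_eq_nil edges_eq_nil)
    (g.right.imp edges_eq_nil edges_eq_nil)]
  simp only [GlueShape.boundary, edges_comp, List.mem_append]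
  tauto

lemma GlueShape.mem_cod {b c : Boundary V} (g : GlueShape b c) (hV : Acyclic V) (hbc : Below b c)
    (e : Total V) :
    e ∈ edges g.boundary.cod ↔ e ∈ edges c.cod ∨ (e ∈ edges b.cod ∧ e ∉ edges c.dom) := by
  obtain ⟨x, hx1, hx2⟩ := hbc
  have h := congrArg edges g.mid
  have hn := hV.nodup_edges (g.u.comp (b.cod.comp g.v))
  simp only [edges_comp] at h hn
  rw [h] at hn
  rw [← mem_extension h.symm hn hx2 hx1 (g.left.symm.imp edges_eq_nil edges_eq_nil)
    (g.right.symm.imp edges_eq_nil edges_eq_nil)]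
  simp only [GlueShape.boundary, edges_comp, List.mem_append]
  tauto

lemma GlueShape.source_ne_sink {b c : Boundary V} (g : GlueShape b c) (hV : Acyclic V)
    (hb : b.source ≠ b.sink) : g.boundary.source ≠ g.boundary.sink := by
  obtain ⟨s, t, u, v, u', v', mid, left, right⟩ := g
  intro h
  dsimp [GlueShape.boundary] at h
  subst h
  have h1 := congrArg Path.length (hV _ (u.comp (b.dom.comp v)))
  simp only [Path.length_comp, Path.length_nil] at h1
  exact hb (b.dom.eq_of_length_zero (by omega))

end Boundary

namespace PastingScheme
open Quiver

variable {V : Type*} [Quiver V] (𝒢 : PastingScheme V)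

/-- The interior faces. -/
def Face : Type _ := {f : Orbit 𝒢.rot // f ≠ 𝒢.exterior}

variable [Finite V] [Finite (Total V)]

/-- The boundary of an interior face: the face is on the right of the edges of its uppermost path
and on the left of the edges of its lowermost path. -/
noncomputable def bd (f : 𝒢.Face) : Boundary V where
  source := (𝒢.exists_boundary f.1).choose
  sink := (𝒢.exists_boundary f.1).choose_spec.choose
  dom := (𝒢.exists_boundary f.1).choose_spec.choose_spec.choose
  cod := (𝒢.exists_boundary f.1).choose_spec.choose_spec.choose_spec.choose

lemma mem_dom (f : 𝒢.Face) (e : Total V) :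
    e ∈ edges (𝒢.bd f).dom ↔ rightFace 𝒢.rot (e, true) = f.1 :=
  (𝒢.exists_boundary f.1).choose_spec.choose_spec.choose_spec.choose_spec.1 e

lemma mem_cod (f : 𝒢.Face) (e : Total V) :
    e ∈ edges (𝒢.bd f).cod ↔ rightFace 𝒢.rot (e, false) = f.1 :=
  (𝒢.exists_boundary f.1).choose_spec.choose_spec.choose_spec.choose_spec.2.1 e

lemma source_ne_sink (f : 𝒢.Face) : (𝒢.bd f).source ≠ (𝒢.bd f).sink :=
  (𝒢.exists_boundary f.1).choose_spec.choose_spec.choose_spec.choose_spec.2.2.1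

lemma exists_top_bot : ∃ top bot : Path 𝒢.s 𝒢.t,
    (∀ e, e ∈ edges top ↔ rightFace 𝒢.rot (e, false) = 𝒢.exterior) ∧
    (∀ e, e ∈ edges bot ↔ rightFace 𝒢.rot (e, true) = 𝒢.exterior) := by
  obtain ⟨a, b, σ, τ, h1, h2, -, h3⟩ := 𝒢.exists_boundary 𝒢.exterior
  obtain ⟨rfl, rfl⟩ := h3 rfl
  exact ⟨τ, σ, h2, h1⟩

/-- The uppermost path of the pasting scheme. -/
noncomputable def top : Path 𝒢.s 𝒢.t := 𝒢.exists_top_bot.choose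

/-- The lowermost path of the pasting scheme. -/
noncomputable def bot : Path 𝒢.s 𝒢.t := 𝒢.exists_top_bot.choose_spec.choose

lemma mem_top (e : Total V) :
    e ∈ edges 𝒢.top ↔ rightFace 𝒢.rot (e, false) = 𝒢.exterior :=
  𝒢.exists_top_bot.choose_spec.choose_spec.1 e

lemma mem_bot (e : Total V) :
    e ∈ edges 𝒢.bot ↔ rightFace 𝒢.rot (e, true) = 𝒢.exterior :=
  𝒢.exists_top_bot.choose_spec.choose_spec.2 e

/-- `F ⋖ G`: the faces `F`, `G` are different, the lowermost path of `F` and the uppermost path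
of `G` share an edge, and the union of `F` and `G` has one of the four admissible shapes. -/
def Glueable (F G : 𝒢.Face) : Prop :=
  F ≠ G ∧ Below (𝒢.bd F) (𝒢.bd G) ∧ Nonempty (GlueShape (𝒢.bd F) (𝒢.bd G))

/-- A family of disjoint pairs `fst i ⋖ snd i` of faces. -/
structure GluePairs (ι : Type*) where
  fst : ι → 𝒢.Face
  snd : ι → 𝒢.Face
  glueable : ∀ i, 𝒢.Glueable (fst i) (snd i)
  disjoint : ∀ i j, i ≠ j →
    fst i ≠ fst j ∧ fst i ≠ snd j ∧ snd i ≠ fst j ∧ snd i ≠ snd j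

namespace GluePairs

variable {𝒢} {ι : Type*} (D : 𝒢.GluePairs ι)

/-- The shape of the union of the `i`-th pair of faces (it is unique, as the two faces share an
edge and there are no directed cycles). -/
noncomputable def shape (i : ι) : GlueShape (𝒢.bd (D.fst i)) (𝒢.bd (D.snd i)) :=
  (D.glueable i).2.2.some

/-- The faces of `𝒢` together with the glued faces `fst i # snd i`, one for each `i`. -/
abbrev Cell (_ : 𝒢.GluePairs ι) : Type _ := 𝒢.Face ⊕ ι

/-- The boundaries of the faces of `𝒢` and of the glued faces. -/
noncomputable def bd : D.Cell → Boundary V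
  | .inl f => 𝒢.bd f
  | .inr i => (D.shape i).boundary

/-- The faces of the pasting scheme obtained from `𝒢` by gluing the pairs with index in `P`:
the faces of `𝒢` which belong to none of these pairs, and one glued face for each of the pairs. -/
def faces (P : Set ι) : Set D.Cell :=
  {x | match x with
    | .inl f => ∀ i ∈ P, f ≠ D.fst i ∧ f ≠ D.snd i
    | .inr i => i ∈ P}

/-- The base faces of which a face consists. -/
def parts : D.Cell → Set 𝒢.Face
  | .inl f => {f}
  | .inr i => {D.fst i, D.snd i}

lemma parts_disjoint {P : Set ι} {x y : D.Cell} (hx : x ∈ D.faces P) (hy : y ∈ D.faces P)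
    {f : 𝒢.Face} (hfx : f ∈ D.parts x) (hfy : f ∈ D.parts y) : x = y := by
  rcases x with a | i <;> rcases y with b | j
  · have h1 : f = a := hfx
    have h2 : f = b := hfy
    rw [← h1, ← h2]
  · have h1 : f = a := hfx
    subst h1
    rcases hfy with h | h
    · exact ((hx j hy).1 h).elim
    · exact ((hx j hy).2 h).elim
  · have h1 : f = b := hfy
    subst h1
    rcases hfx with h | h
    · exact ((hy i hx).1 h).elim
    · exact ((hy i hx).2 h).elim
  · by_contra hij
    have hd := D.disjoint i j (fun h => hij (by rw [h]))
    rcases hfx with h | h <;> rcases hfy with h' | h' <;> rw [h] at h'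
    · exact hd.1 h'
    · exact hd.2.1 h'
    · exact hd.2.2.1 h'
    · exact hd.2.2.2 h'

lemma dom_unique {f g : 𝒢.Face} {e : Total V} (hf : e ∈ edges (𝒢.bd f).dom)
    (hg : e ∈ edges (𝒢.bd g).dom) : f = g :=
  Subtype.ext (((𝒢.mem_dom f e).1 hf).symm.trans ((𝒢.mem_dom g e).1 hg))

lemma cod_unique {f g : 𝒢.Face} {e : Total V} (hf : e ∈ edges (𝒢.bd f).cod)
    (hg : e ∈ edges (𝒢.bd g).cod) : f = g :=
  Subtype.ext (((𝒢.mem_cod f e).1 hf).symm.trans ((𝒢.mem_cod g e).1 hg))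

lemma mem_dom_inr (i : ι) (e : Total V) : e ∈ edges (D.bd (.inr i)).dom ↔
    e ∈ edges (𝒢.bd (D.fst i)).dom ∨
      (e ∈ edges (𝒢.bd (D.snd i)).dom ∧ e ∉ edges (𝒢.bd (D.fst i)).cod) :=
  (D.shape i).mem_dom 𝒢.acyclic (D.glueable i).2.1 e

lemma mem_cod_inr (i : ι) (e : Total V) : e ∈ edges (D.bd (.inr i)).cod ↔
    e ∈ edges (𝒢.bd (D.snd i)).cod ∨
      (e ∈ edges (𝒢.bd (D.fst i)).cod ∧ e ∉ edges (𝒢.bd (D.snd i)).dom) :=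
  (D.shape i).mem_cod 𝒢.acyclic (D.glueable i).2.1 e

lemma exists_part_dom {x : D.Cell} {e : Total V} (he : e ∈ edges (D.bd x).dom) :
    ∃ f ∈ D.parts x, e ∈ edges (𝒢.bd f).dom := by
  rcases x with a | i
  · exact ⟨a, rfl, he⟩
  · rcases (D.mem_dom_inr i e).1 he with h | h
    · exact ⟨_, Or.inl rfl, h⟩
    · exact ⟨_, Or.inr rfl, h.1⟩

lemma exists_part_cod {x : D.Cell} {e : Total V} (he : e ∈ edges (D.bd x).cod) :
    ∃ f ∈ D.parts x, e ∈ edges (𝒢.bd f).cod := by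
  rcases x with a | i
  · exact ⟨a, rfl, he⟩
  · rcases (D.mem_cod_inr i e).1 he with h | h
    · exact ⟨_, Or.inr rfl, h⟩
    · exact ⟨_, Or.inl rfl, h.1⟩

/-- An edge above a part of `x` is above `x`, unless it is also below a part of `x`. -/
lemma mem_dom_of_part {x : D.Cell} {f : 𝒢.Face} {e : Total V} (hf : f ∈ D.parts x)
    (he : e ∈ edges (𝒢.bd f).dom) (h : ∀ g ∈ D.parts x, e ∉ edges (𝒢.bd g).cod) :
    e ∈ edges (D.bd x).dom := by
  rcases x with a | i
  · obtain rfl : f = a := hf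
    exact he
  · rw [mem_dom_inr]
    rcases hf with rfl | rfl
    · exact Or.inl he
    · exact Or.inr ⟨he, h _ (Or.inl rfl)⟩

lemma mem_cod_of_part {x : D.Cell} {f : 𝒢.Face} {e : Total V} (hf : f ∈ D.parts x)
    (he : e ∈ edges (𝒢.bd f).cod) (h : ∀ g ∈ D.parts x, e ∉ edges (𝒢.bd g).dom) :
    e ∈ edges (D.bd x).cod := by
  rcases x with a | i
  · obtain rfl : f = a := hf
    exact he
  · rw [mem_cod_inr]
    rcases hf with rfl | rfl
    · exact Or.inr ⟨he, h _ (Or.inr rfl)⟩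
    · exact Or.inl he

lemma exists_face (P : Set ι) (f : 𝒢.Face) : ∃ x ∈ D.faces P, f ∈ D.parts x := by
  by_cases h : ∃ i ∈ P, f = D.fst i ∨ f = D.snd i
  · obtain ⟨i, hi, h⟩ := h
    exact ⟨.inr i, hi, h⟩
  · push Not at h
    exact ⟨.inl f, h, rfl⟩

/-- The boundary of a face has an edge in common with both sides only if the parts do. -/
lemma mem_cod_of_mem_dom {x : D.Cell} {f : 𝒢.Face} {e : Total V} (he : e ∈ edges (D.bd x).dom)
    (hf : f ∈ D.parts x) (hfe : e ∈ edges (𝒢.bd f).cod) : e ∈ edges (D.bd x).cod := by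
  rcases x with a | i
  · obtain rfl : f = a := hf
    exact hfe
  · rw [mem_cod_inr]
    rw [mem_dom_inr] at he
    rcases hf with rfl | rfl
    · rcases he with h | h
      · exact Or.inr ⟨hfe, fun h' => (D.glueable i).1 (dom_unique h h')⟩
      · exact (h.2 hfe).elim
    · exact Or.inl hfe

lemma mem_dom_of_mem_cod {x : D.Cell} {f : 𝒢.Face} {e : Total V} (he : e ∈ edges (D.bd x).cod)
    (hf : f ∈ D.parts x) (hfe : e ∈ edges (𝒢.bd f).dom) : e ∈ edges (D.bd x).dom := by
  rcases x with a | i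
  · obtain rfl : f = a := hf
    exact hfe
  · rw [mem_dom_inr]
    rw [mem_cod_inr] at he
    rcases hf with rfl | rfl
    · exact Or.inl hfe
    · rcases he with h | h
      · exact Or.inr ⟨hfe, fun h' => (D.glueable i).1 (cod_unique h' h)⟩
      · exact (h.2 hfe).elim

lemma incidence (P : Set ι) : Incidence D.bd (D.faces P) 𝒢.top 𝒢.bot where
  acyclic := 𝒢.acyclic
  ne x _ := by
    rcases x with f | i
    · exact 𝒢.source_ne_sink f
    · exact (D.shape i).source_ne_sink 𝒢.acyclic (𝒢.source_ne_sink _)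
  of_dom x hx e he := by
    by_cases ht : rightFace 𝒢.rot (e, false) = 𝒢.exterior
    · exact Or.inl ((𝒢.mem_top e).2 ht)
    · right
      have hg : e ∈ edges (𝒢.bd ⟨_, ht⟩).cod := (𝒢.mem_cod _ e).2 rfl
      obtain ⟨y, hy, hgy⟩ := D.exists_face P ⟨_, ht⟩
      refine ⟨y, hy, ?_⟩
      by_cases hxy : y = x
      · subst hxy
        exact D.mem_cod_of_mem_dom he hgy hg
      · refine D.mem_cod_of_part hgy hg fun g' hg' hg'e => hxy ?_
        obtain ⟨f, hf, hfe⟩ := D.exists_part_dom he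
        exact D.parts_disjoint hy hx hg' (dom_unique hfe hg'e ▸ hf)
  dom_unique x hx y hy e he he' := by
    obtain ⟨f, hf, hfe⟩ := D.exists_part_dom he
    obtain ⟨g, hg, hge⟩ := D.exists_part_dom he'
    exact D.parts_disjoint hx hy hf (dom_unique hge hfe ▸ hg)
  cod_unique x hx y hy e he he' := by
    obtain ⟨f, hf, hfe⟩ := D.exists_part_cod he
    obtain ⟨g, hg, hge⟩ := D.exists_part_cod he'
    exact D.parts_disjoint hx hy hf (cod_unique hge hfe ▸ hg)
  mem_bot e := by
    rw [𝒢.mem_bot]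
    constructor
    · intro h
      have hno : ∀ g : 𝒢.Face, e ∉ edges (𝒢.bd g).dom := fun g hg =>
        g.2 (((𝒢.mem_dom g e).1 hg).symm.trans h)
      refine ⟨?_, fun x _ hxe => ?_⟩
      · by_cases ht : rightFace 𝒢.rot (e, false) = 𝒢.exterior
        · exact Or.inl ((𝒢.mem_top e).2 ht)
        · have hg : e ∈ edges (𝒢.bd ⟨_, ht⟩).cod := (𝒢.mem_cod _ e).2 rfl
          obtain ⟨y, hy, hgy⟩ := D.exists_face P ⟨_, ht⟩
          exact Or.inr ⟨y, hy, D.mem_cod_of_part hgy hg fun g' _ => hno g'⟩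
      · obtain ⟨f, _, hfe⟩ := D.exists_part_dom hxe
        exact hno f hfe
    · rintro ⟨h1, h2⟩
      by_contra h
      have hg : e ∈ edges (𝒢.bd ⟨_, h⟩).dom := (𝒢.mem_dom _ e).2 rfl
      obtain ⟨y, hy, hgy⟩ := D.exists_face P ⟨_, h⟩
      rcases h1 with h1 | ⟨x, hx, hxe⟩
      · refine h2 y hy (D.mem_dom_of_part hgy hg fun g' _ hg' => g'.2 ?_)
        exact ((𝒢.mem_cod g' e).1 hg').symm.trans ((𝒢.mem_top e).1 h1)
      · refine h2 y hy ?_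
        by_cases hxy : y = x
        · subst hxy
          exact D.mem_dom_of_mem_cod hxe hgy hg
        · refine D.mem_dom_of_part hgy hg fun g' hg' hg'e => hxy ?_
          obtain ⟨f, hf, hfe⟩ := D.exists_part_cod hxe
          exact D.parts_disjoint hy hx hg' (cod_unique hfe hg'e ▸ hf)

/-- The orders of composition of the scheme in which the pairs with index in `P` are glued. -/
abbrev Order (P : Set ι) : Type _ := LinExt D.bd (D.faces P)

open Classical in
/-- A glued face which is not glued in `P` is replaced by its two parts. -/
noncomputable def expand (P : Set ι) : D.Cell → List D.Cell
  | .inl f => [.inl f]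
  | .inr i => if i ∈ P then [.inr i] else [.inl (D.fst i), .inl (D.snd i)]

lemma parts_of_mem_expand {P : Set ι} {x y : D.Cell} (hy : y ∈ D.expand P x) :
    D.parts y ⊆ D.parts x := by
  rcases x with f | i
  · simp only [expand, List.mem_singleton] at hy
    rw [hy]
  · rw [expand] at hy
    split_ifs at hy
    · rw [List.mem_singleton] at hy
      rw [hy]
    · simp only [List.mem_cons, List.not_mem_nil, or_false] at hy
      rcases hy with rfl | rfl
      · exact Set.singleton_subset_iff.2 (Or.inl rfl)
      · exact Set.singleton_subset_iff.2 (Or.inr rfl)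

lemma mem_faces_of_mem_expand {P P' : Set ι} (hP : P ⊆ P') {x y : D.Cell}
    (hx : x ∈ D.faces P') (hy : y ∈ D.expand P x) : y ∈ D.faces P := by
  rcases x with f | i
  · simp only [expand, List.mem_singleton] at hy
    subst hy
    exact fun i hi => hx i (hP hi)
  · rw [expand] at hy
    split_ifs at hy with hi
    · rw [List.mem_singleton] at hy
      subst hy
      exact hi
    · simp only [List.mem_cons, List.not_mem_nil, or_false] at hy
      rcases hy with rfl | rfl
      · intro j hj
        have := D.disjoint i j (fun h => hi (h ▸ hj))
        exact ⟨this.1, this.2.1⟩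
      · intro j hj
        have := D.disjoint i j (fun h => hi (h ▸ hj))
        exact ⟨this.2.2.1, this.2.2.2⟩

/-- Faces in different blocks are related only if the blocks are. -/
lemma below_of_mem_expand {P P' : Set ι} {x x' y y' : D.Cell} (hx : x ∈ D.faces P')
    (hx' : x' ∈ D.faces P') (hy : y ∈ D.expand P x) (hy' : y' ∈ D.expand P x') (hne : x ≠ x')
    (h : Below (D.bd y) (D.bd y')) : Below (D.bd x) (D.bd x') := by
  obtain ⟨e, h1, h2⟩ := h
  obtain ⟨f, hf, hfe⟩ := D.exists_part_cod h1
  obtain ⟨g, hg, hge⟩ := D.exists_part_dom h2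
  have hf := D.parts_of_mem_expand hy hf
  have hg := D.parts_of_mem_expand hy' hg
  refine ⟨e, D.mem_cod_of_part hf hfe fun g' hg' hg'e => hne ?_,
    D.mem_dom_of_part hg hge fun f' hf' hf'e => hne ?_⟩
  · exact D.parts_disjoint hx hx' hg' (dom_unique hge hg'e ▸ hg)
  · exact (D.parts_disjoint hx' hx hf' (cod_unique hfe hf'e ▸ hf)).symm

lemma below_inr {i : ι} {f g : 𝒢.Face} (hf : f ∈ D.parts (.inr i)) (hg : g ∈ D.parts (.inr i))
    (hfg : ¬ (f = D.fst i ∧ g = D.snd i)) (h : Below (𝒢.bd f) (𝒢.bd g)) :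
    Below (D.bd (.inr i)) (D.bd (.inr i)) := by
  obtain ⟨e, h1, h2⟩ := h
  have hne := (D.glueable i).1
  refine ⟨e, (D.mem_cod_inr i e).2 ?_, (D.mem_dom_inr i e).2 ?_⟩
  · rcases hf with rfl | rfl
    · refine Or.inr ⟨h1, fun h => hfg ⟨rfl, dom_unique h2 h⟩⟩
    · exact Or.inl h1
  · rcases hg with rfl | rfl
    · exact Or.inl h2
    · refine Or.inr ⟨h2, fun h => hfg ⟨cod_unique h1 h, rfl⟩⟩

/-- Given `P ⊆ P'`, an order of composition of the scheme in which the pairs in `P'` are glued is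
turned into one of the scheme in which only those in `P` are glued by replacing the other glued
faces `fst i # snd i` by `fst i`, `snd i`, in this order. -/
noncomputable def unglueOrder {P P' : Set ι} (hP : P ⊆ P') (X : D.Order P') : D.Order P where
  list := X.list.flatMap (D.expand P)
  nodup := by
    rw [List.nodup_flatMap]
    refine ⟨fun x _ => ?_, X.nodup.imp_of_mem fun {x y} hx hy hxy => ?_⟩
    · rcases x with f | i
      · simp [expand]
      · rw [expand]
        split_ifs
        · simp
        · simpa using (D.glueable i).1
    · intro z hz hz'
      obtain ⟨f, hf⟩ : (D.parts z).Nonempty := by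
        rcases z with f | i
        · exact ⟨f, rfl⟩
        · exact ⟨_, Or.inl rfl⟩
      exact hxy (D.parts_disjoint ((X.mem_iff x).1 hx) ((X.mem_iff y).1 hy)
        (D.parts_of_mem_expand hz hf) (D.parts_of_mem_expand hz' hf))
  mem_iff y := by
    rw [List.mem_flatMap]
    constructor
    · rintro ⟨x, hx, hy⟩
      exact D.mem_faces_of_mem_expand hP ((X.mem_iff x).1 hx) hy
    · intro hy
      rcases y with f | i
      · obtain ⟨x, hx, hf⟩ := D.exists_face P' f
        refine ⟨x, (X.mem_iff x).2 hx, ?_⟩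
        rcases x with g | i
        · obtain rfl : f = g := hf
          simp [expand]
        · have hi : i ∉ P := by
            intro hi
            rcases hf with rfl | rfl
            · exact (hy i hi).1 rfl
            · exact (hy i hi).2 rfl
          rw [expand, if_neg hi]
          rcases hf with rfl | rfl
          · simp
          · simp
      · have hy : i ∈ P := hy
        exact ⟨.inr i, (X.mem_iff _).2 (hP hy), by simp [expand, hy]⟩
  irrefl := by
    intro y hy h
    obtain ⟨x, hx, hyx⟩ := List.mem_flatMap.1 hy
    refine X.irrefl x hx ?_
    rcases x with f | i
    · simp only [expand, List.mem_singleton] at hyx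
      rwa [hyx] at h
    · rw [expand] at hyx
      split_ifs at hyx
      · rw [List.mem_singleton] at hyx
        rwa [hyx] at h
      · simp only [List.mem_cons, List.not_mem_nil, or_false] at hyx
        have hne := (D.glueable i).1
        rcases hyx with rfl | rfl
        · exact D.below_inr (Or.inl rfl) (Or.inl rfl) (fun h => hne h.2) h
        · exact D.below_inr (Or.inr rfl) (Or.inr rfl) (fun h => hne h.1.symm) h
  pairwise := by
    rw [List.pairwise_flatMap]
    refine ⟨fun x hx => ?_, ?_⟩
    · rcases x with f | i
      · simp [expand]
      · rw [expand]
        split_ifs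
        · simp
        · simp only [List.pairwise_cons, List.mem_singleton, forall_eq, List.not_mem_nil,
            IsEmpty.forall_iff, implies_true, List.Pairwise.nil, and_true]
          intro h
          exact X.irrefl _ hx
            (D.below_inr (Or.inr rfl) (Or.inl rfl) (fun h => (D.glueable i).1 h.2) h)
    · refine (X.pairwise.and X.nodup).imp_of_mem fun {x x'} hx hx' hxx' => ?_
      intro y hy y' hy' h
      exact hxx'.1 (D.below_of_mem_expand ((X.mem_iff x').1 hx') ((X.mem_iff x).1 hx) hy' hy
        hxx'.2.symm h)

end GluePairs
end PastingScheme

section Evaluation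
open Quiver GrayCategory

variable {V : Type*} [Quiver V] {𝒦 : Type*} [GrayCategory 𝒦] (φ : V ⥤q 𝒦)

/-- The composite of the 1-cells labelling the edges of a path. -/
def ev {a b : V} (p : Path a b) : φ.obj a ⟶ φ.obj b := composePath (φ.mapPath p)

lemma ev_comp {a b c : V} (p : Path a b) (q : Path b c) :
    ev φ (p.comp q) = ev φ p ≫ ev φ q := by
  rw [ev, Prefunctor.mapPath_comp, composePath_comp]; rfl

lemma ev_comp₃ {a b c d : V} (x : Path a b) (p : Path b c) (y : Path c d) :
    ev φ (x.comp (p.comp y)) = ev φ x ≫ ev φ p ≫ ev φ y := by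
  rw [ev_comp, ev_comp]

/-- The whiskering of a 2-cell with the 1-cells along the paths `x` and `y`. -/
def whisker {s a b t : V} (x : Path s a) {p q : Path a b} (α : ev φ p ⟶ ev φ q) (y : Path b t) :
    ev φ (x.comp (p.comp y)) ⟶ ev φ (x.comp (q.comp y)) :=
  eqToHom (ev_comp₃ φ x p y) ≫ pre (ev φ x) (post α (ev φ y)) ≫ eqToHom (ev_comp₃ φ x q y).symm

/-- The whiskering of a 3-cell with the 1-cells along the paths `x` and `y`. -/
def whisker₃ {s a b t : V} (x : Path s a) {p q : Path a b} {α α' : ev φ p ⟶ ev φ q}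
    (Θ : α ⟶ α') (y : Path b t) : whisker φ x α y ⟶ whisker φ x α' y :=
  eqToHom (ev_comp₃ φ x p y) ◁ (pre₃ (ev φ x) (post₃ Θ (ev φ y)) ▷
    eqToHom (ev_comp₃ φ x q y).symm)

variable {Φ : Type*} (bd : Φ → Boundary V)

/-- A labelling of the faces with the given boundaries by 2-cells. -/
abbrev Cells : Type _ := ∀ f, ev φ (bd f).dom ⟶ ev φ (bd f).cod

variable {φ bd}

/-- The composite of the whiskered 2-cells labelling the faces of a sweep. -/
def eval (M : Cells φ bd) {s t : V} : ∀ {w w' : Path s t} {l : List Φ},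
    Sweep bd w l w' → (ev φ w ⟶ ev φ w')
  | _, _, _, .nil w => 𝟙 (ev φ w)
  | _, _, _, .cons f x y hw rest =>
    eqToHom (congrArg (ev φ) hw) ≫ whisker φ x (M f) y ≫ eval M rest

/-- Given a 3-cell `θ f` for each face `f`, the horizontal composite of these, whiskered by
1-cells, along a sweep. -/
def evalMap {M M' : Cells φ bd} (θ : ∀ f, M f ⟶ M' f) {s t : V} : ∀ {w w' : Path s t}
    {l : List Φ} (σ : Sweep bd w l w'), eval M σ ⟶ eval M' σ
  | _, _, _, .nil w => 𝟙 (𝟙 (ev φ w))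
  | _, _, _, .cons f x y hw rest =>
    eqToHom (congrArg (ev φ) hw) ◁
      ((whisker₃ φ x (θ f) y ▷ eval M rest) ≫ (whisker φ x (M' f) y ◁ evalMap θ rest))


section Lemmas

lemma pre_heq {X Y Z : 𝒦} {f f' : X ⟶ Y} {g g' k k' : Y ⟶ Z} {β : g ⟶ k} {β' : g' ⟶ k'}
    (hf : f = f') (hg : g = g') (hk : k = k') (h : HEq β β') : HEq (pre f β) (pre f' β') := by
  subst hf hg hk
  obtain rfl := eq_of_heq h
  rfl

lemma post_heq {X Y Z : 𝒦} {f f' k k' : X ⟶ Y} {g g' : Y ⟶ Z} {α : f ⟶ k} {α' : f' ⟶ k'}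
    (hf : f = f') (hk : k = k') (hg : g = g') (h : HEq α α') : HEq (post α g) (post α' g') := by
  subst hf hg hk
  obtain rfl := eq_of_heq h
  rfl

lemma whisker_heq {s a b t : V} (x : Path s a) {p q : Path a b} (α : ev φ p ⟶ ev φ q)
    (y : Path b t) : HEq (whisker φ x α y) (pre (ev φ x) (post α (ev φ y))) := by
  unfold whisker
  rw [eqToHom_comp_heq_iff, comp_eqToHom_heq_iff]

lemma whisker_comp {s a b t : V} (x : Path s a) {p q r : Path a b} (α : ev φ p ⟶ ev φ q)
    (β : ev φ q ⟶ ev φ r) (y : Path b t) :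
    whisker φ x (α ≫ β) y = whisker φ x α y ≫ whisker φ x β y := by
  simp [whisker, post_comp, pre_comp]

lemma whisker_eqToHom {s a b t : V} (x : Path s a) {p q : Path a b} (h : p = q)
    (y : Path b t) : whisker φ x (eqToHom (congrArg (ev φ) h)) y =
      eqToHom (congrArg (fun r : Path a b => ev φ (x.comp (r.comp y))) h) := by
  subst h
  simp [whisker, post_id, pre_id]

lemma whisker_whisker {s s' a b t' t : V} (x : Path s s') (u : Path s' a) {p q : Path a b}
    (α : ev φ p ⟶ ev φ q) (v : Path b t') (y : Path t' t) :
    HEq (whisker φ x (whisker φ u α v) y) (whisker φ (x.comp u) α (v.comp y)) := by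
  refine (whisker_heq _ _ _).trans (HEq.trans ?_ (whisker_heq _ _ _).symm)
  refine (pre_heq (f' := ev φ x) rfl ?_ ?_ (post_heq (ev_comp₃ φ u p v) (ev_comp₃ φ u q v) rfl
    (whisker_heq u α v))).trans ?_
  · rw [ev_comp₃]
  · rw [ev_comp₃]
  refine (pre_heq (f' := ev φ x) rfl ?_ ?_ (pre_post _ _ _).symm).trans ?_
  · simp
  · simp
  refine (comp_pre _ _ _).symm.trans ?_
  refine pre_heq (ev_comp φ x u).symm ?_ ?_ ?_
  · simp [ev_comp]
  · simp [ev_comp]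
  · refine (post_comp₁ _ _ _).symm.trans ?_
    refine post_heq rfl rfl (ev_comp φ v y).symm HEq.rfl

/-- The concatenation of two sweeps. -/
def Sweep.append {s t : V} : ∀ {w w' w'' : Path s t} {l l' : List Φ},
    Sweep bd w l w' → Sweep bd w' l' w'' → Sweep bd w (l ++ l') w''
  | _, _, _, _, _, .nil _, ρ => ρ
  | _, _, _, _, _, .cons f x y hw rest, ρ => .cons f x y hw (rest.append ρ)

lemma eval_append (M : Cells φ bd) {s t : V} {w w' w'' : Path s t} {l l' : List Φ}
    (σ : Sweep bd w l w') (ρ : Sweep bd w' l' w'') :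
    eval M (σ.append ρ) = eval M σ ≫ eval M ρ := by
  induction σ with
  | nil w => simp [Sweep.append, eval]
  | cons f x y hw rest ih => simp [Sweep.append, eval, ih]

end Lemmas
end Evaluation

section Gluing
open Quiver GrayCategory

variable {V : Type*} [Quiver V] {𝒦 : Type*} [GrayCategory 𝒦] {φ : V ⥤q 𝒦}

/-- The vertical composite, inside the union of two faces, of the (whiskered) 2-cells labelling the
two faces. -/
def GlueShape.pasting {b c : Boundary V} (g : GlueShape b c) (α : ev φ b.dom ⟶ ev φ b.cod)
    (β : ev φ c.dom ⟶ ev φ c.cod) : ev φ g.boundary.dom ⟶ ev φ g.boundary.cod :=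
  whisker φ g.u α g.v ≫ eqToHom (congrArg (ev φ) g.mid) ≫ whisker φ g.u' β g.v'

variable {Φ : Type*} {bd : Φ → Boundary V}

lemma whisker_whisker' {s s' a b t' t : V} (x : Path s s') (u : Path s' a) {p q : Path a b}
    (α : ev φ p ⟶ ev φ q) (v : Path b t') (y : Path t' t)
    (h1 : ev φ (x.comp ((u.comp (p.comp v)).comp y)) =
      ev φ ((x.comp u).comp (p.comp (v.comp y))))
    (h2 : ev φ ((x.comp u).comp (q.comp (v.comp y))) =
      ev φ (x.comp ((u.comp (q.comp v)).comp y))) :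
    whisker φ x (whisker φ u α v) y =
      eqToHom h1 ≫ whisker φ (x.comp u) α (v.comp y) ≫ eqToHom h2 :=
  (conj_eqToHom_iff_heq' _ _ h1 h2).2 (whisker_whisker x u α v y)

lemma whisker_pasting {b c : Boundary V} (g : GlueShape b c) (α : ev φ b.dom ⟶ ev φ b.cod)
    (β : ev φ c.dom ⟶ ev φ c.cod) {s t : V} (x : Path s g.source) (y : Path g.sink t)
    (h1 : ev φ (x.comp ((g.u.comp (b.dom.comp g.v)).comp y)) =
      ev φ ((x.comp g.u).comp (b.dom.comp (g.v.comp y))))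
    (h2 : ev φ ((x.comp g.u).comp (b.cod.comp (g.v.comp y))) =
      ev φ ((x.comp g.u').comp (c.dom.comp (g.v'.comp y))))
    (h3 : ev φ ((x.comp g.u').comp (c.cod.comp (g.v'.comp y))) =
      ev φ (x.comp ((g.u'.comp (c.cod.comp g.v')).comp y))) :
    whisker φ x (p := g.u.comp (b.dom.comp g.v)) (q := g.u'.comp (c.cod.comp g.v'))
      (g.pasting α β) y =
      eqToHom h1 ≫ whisker φ (x.comp g.u) α (g.v.comp y) ≫ eqToHom h2 ≫
        whisker φ (x.comp g.u') β (g.v'.comp y) ≫ eqToHom h3 := by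
  have e1 := whisker_comp x (whisker φ g.u α g.v)
    (eqToHom (congrArg (ev φ) g.mid) ≫ whisker φ g.u' β g.v') y
  have e2 := whisker_comp x (eqToHom (congrArg (ev φ) g.mid)) (whisker φ g.u' β g.v') y
  rw [whisker_eqToHom x g.mid y] at e2
  refine e1.trans ?_
  rw [e2, whisker_whisker' x g.u α g.v y (by simp) (by simp),
    whisker_whisker' x g.u' β g.v' y (by simp) (by simp)]
  simp

lemma exists_pasted {ψ : Cells φ bd} {b c : Φ} (g : GlueShape (bd b) (bd c)) {s t : V}
    {w w' : Path s t} {l : List Φ} (x : Path s g.source) (y : Path g.sink t)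
    (hw : w = x.comp ((g.u.comp ((bd b).dom.comp g.v)).comp y))
    (ρ : Sweep bd (x.comp ((g.u'.comp ((bd c).cod.comp g.v')).comp y)) l w') :
    ∃ σ' : Sweep bd w (b :: c :: l) w', eval ψ σ' = eqToHom (congrArg (ev φ) hw) ≫
      whisker φ x (p := g.u.comp ((bd b).dom.comp g.v)) (q := g.u'.comp ((bd c).cod.comp g.v'))
        (g.pasting (ψ b) (ψ c)) y ≫ eval ψ ρ := by
  have h1 : x.comp ((g.u.comp ((bd b).dom.comp g.v)).comp y) =
    (x.comp g.u).comp ((bd b).dom.comp (g.v.comp y)) := by simp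
  have h2 : (x.comp g.u).comp ((bd b).cod.comp (g.v.comp y)) =
    (x.comp g.u').comp ((bd c).dom.comp (g.v'.comp y)) := by
    have h := congrArg (fun r => x.comp (r.comp y)) g.mid
    simp only [Path.comp_assoc] at h ⊢
    exact h
  have h3 : x.comp ((g.u'.comp ((bd c).cod.comp g.v')).comp y) =
    (x.comp g.u').comp ((bd c).cod.comp (g.v'.comp y)) := by simp
  have h4 : ∀ {z z' : Path s t} (h : z = z') (ρ : Sweep bd z l w'), ∃ ρ' : Sweep bd z' l w',
      eval ψ ρ' = eqToHom (congrArg (ev φ) h.symm) ≫ eval ψ ρ := by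
    rintro z _ rfl ρ
    exact ⟨ρ, by simp⟩
  obtain ⟨ρ', hρ'⟩ := h4 h3 ρ
  refine ⟨.cons b (x.comp g.u) (g.v.comp y) (hw.trans h1)
    (.cons c (x.comp g.u') (g.v'.comp y) h2 ρ'), ?_⟩
  simp only [eval]
  rw [hρ', whisker_pasting g (ψ b) (ψ c) x y (congrArg _ h1) (congrArg _ h2)
    (congrArg _ h3.symm)]
  simp

/-- The vertical composite of two 2-cells with disjoint boundaries on a common path, whiskered by
1-cells: first the left one, then the right one. -/
def leftFirst {s a a' b b' t : V} (x : Path s a) {p p' : Path a a'} (α : ev φ p ⟶ ev φ p')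
    (m : Path a' b) {q q' : Path b b'} (β : ev φ q ⟶ ev φ q') (z : Path b' t) :
    ev φ (x.comp (p.comp (m.comp (q.comp z)))) ⟶ ev φ (x.comp (p'.comp (m.comp (q'.comp z)))) :=
  eqToHom (by simp [ev_comp]) ≫
    pre (ev φ x) (post (post α (ev φ m ≫ ev φ q) ≫ pre (ev φ p') (pre (ev φ m) β)) (ev φ z)) ≫
      eqToHom (by simp [ev_comp])

/-- The same two 2-cells composed in the other order: first the right one, then the left one. -/
def rightFirst {s a a' b b' t : V} (x : Path s a) {p p' : Path a a'} (α : ev φ p ⟶ ev φ p')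
    (m : Path a' b) {q q' : Path b b'} (β : ev φ q ⟶ ev φ q') (z : Path b' t) :
    ev φ (x.comp (p.comp (m.comp (q.comp z)))) ⟶ ev φ (x.comp (p'.comp (m.comp (q'.comp z)))) :=
  eqToHom (by simp [ev_comp]) ≫
    pre (ev φ x) (post (pre (ev φ p) (pre (ev φ m) β) ≫ post α (ev φ m ≫ ev φ q')) (ev φ z)) ≫
      eqToHom (by simp [ev_comp])

/-- The whiskered interchange isomorphism. -/
def exchange {s a a' b b' t : V} (x : Path s a) {p p' : Path a a'} (α : ev φ p ⟶ ev φ p')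
    (m : Path a' b) {q q' : Path b b'} (β : ev φ q ⟶ ev φ q') (z : Path b' t) :
    leftFirst x α m β z ⟶ rightFirst x α m β z :=
  eqToHom _ ◁ (pre₃ (ev φ x) (post₃ (interchange α (pre (ev φ m) β)).hom (ev φ z)) ▷ eqToHom _)

lemma whisker_left_eq {s a a' b b' t : V} (x : Path s a) {p p' : Path a a'}
    (α : ev φ p ⟶ ev φ p') (m : Path a' b) (r : Path b b') (z : Path b' t)
    (h1 : ev φ (x.comp (p.comp (m.comp (r.comp z)))) =
      ev φ x ≫ (ev φ p ≫ ev φ m ≫ ev φ r) ≫ ev φ z)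
    (h2 : ev φ x ≫ (ev φ p' ≫ ev φ m ≫ ev φ r) ≫ ev φ z =
      ev φ (x.comp (p'.comp (m.comp (r.comp z))))) :
    whisker φ x α (m.comp (r.comp z)) =
      eqToHom h1 ≫ pre (ev φ x) (post (post α (ev φ m ≫ ev φ r)) (ev φ z)) ≫ eqToHom h2 := by
  rw [conj_eqToHom_iff_heq']
  refine (whisker_heq _ _ _).trans (pre_heq rfl ?_ ?_ ?_)
  · simp [ev_comp]
  · simp [ev_comp]
  · refine HEq.trans ?_ (post_comp₁ _ _ _)
    exact post_heq rfl rfl (by simp [ev_comp]) HEq.rfl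

lemma whisker_right_eq {s a a' b b' t : V} (x : Path s a) (r : Path a a') (m : Path a' b)
    {q q' : Path b b'} (β : ev φ q ⟶ ev φ q') (z : Path b' t)
    (h1 : ev φ ((x.comp (r.comp m)).comp (q.comp z)) =
      ev φ x ≫ (ev φ r ≫ ev φ m ≫ ev φ q) ≫ ev φ z)
    (h2 : ev φ x ≫ (ev φ r ≫ ev φ m ≫ ev φ q') ≫ ev φ z =
      ev φ ((x.comp (r.comp m)).comp (q'.comp z))) :
    whisker φ (x.comp (r.comp m)) β z =
      eqToHom h1 ≫ pre (ev φ x) (post (pre (ev φ r) (pre (ev φ m) β)) (ev φ z)) ≫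
        eqToHom h2 := by
  rw [conj_eqToHom_iff_heq']
  refine (whisker_heq _ _ _).trans ?_
  refine (pre_heq (ev_comp φ x (r.comp m)) rfl rfl HEq.rfl).trans ?_
  refine (comp_pre _ _ _).trans ?_
  refine pre_heq rfl (by simp [ev_comp]) (by simp [ev_comp]) ?_
  refine (pre_post _ _ _).trans ?_
  refine post_heq (by simp [ev_comp]) (by simp [ev_comp]) rfl ?_
  refine (pre_heq (ev_comp φ r m) rfl rfl HEq.rfl).trans ?_
  exact comp_pre _ _ _

lemma leftFirst_eq {s a a' b b' t : V} (x : Path s a) {p p' : Path a a'}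
    (α : ev φ p ⟶ ev φ p') (m : Path a' b) {q q' : Path b b'} (β : ev φ q ⟶ ev φ q')
    (z : Path b' t) : leftFirst x α m β z = whisker φ x α (m.comp (q.comp z)) ≫
      eqToHom (by simp [ev_comp]) ≫ whisker φ (x.comp (p'.comp m)) β z ≫
        eqToHom (by simp [ev_comp]) := by
  rw [whisker_left_eq x α m q z (by simp [ev_comp]) (by simp [ev_comp]),
    whisker_right_eq x p' m β z (by simp [ev_comp]) (by simp [ev_comp])]
  simp [leftFirst, post_comp, pre_comp]

lemma rightFirst_eq {s a a' b b' t : V} (x : Path s a) {p p' : Path a a'}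
    (α : ev φ p ⟶ ev φ p') (m : Path a' b) {q q' : Path b b'} (β : ev φ q ⟶ ev φ q')
    (z : Path b' t) : rightFirst x α m β z = eqToHom (by simp [ev_comp]) ≫
      whisker φ (x.comp (p.comp m)) β z ≫ eqToHom (by simp [ev_comp]) ≫
        whisker φ x α (m.comp (q'.comp z)) := by
  rw [whisker_left_eq x α m q' z (by simp [ev_comp]) (by simp [ev_comp]),
    whisker_right_eq x p m β z (by simp [ev_comp]) (by simp [ev_comp])]
  simp [rightFirst, post_comp, pre_comp]

namespace PastingScheme

variable {𝒢 : PastingScheme V} [Finite V] [Finite (Total V)] {ι : Type*} {D : 𝒢.GluePairs ι}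

/-- A labelling of a scheme `𝒢`: a 0-cell for each vertex and a 1-cell for each edge (`edge`), and a
2-cell for each interior face, from the composite of its uppermost path to that of its lowermost
path. -/
structure Labelling (𝒢 : PastingScheme V) (𝒦 : Type*) [GrayCategory 𝒦] where
  edge : V ⥤q 𝒦
  face : Cells edge 𝒢.bd

namespace GluePairs

/-- The 2-cells by which the `i`-th glued face may be labelled. -/
abbrev TwoCell (D : 𝒢.GluePairs ι) (ℒ : 𝒢.Labelling 𝒦) (i : ι) : Type _ :=
  ev ℒ.edge (D.bd (.inr i)).dom ⟶ ev ℒ.edge (D.bd (.inr i)).cod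

/-- The labelling of all faces, glued or not, which is given by `ℒ` on the faces of `𝒢` and by
`A` on the glued faces. -/
def extend (D : 𝒢.GluePairs ι) (ℒ : 𝒢.Labelling 𝒦)
    (A : ∀ i, D.TwoCell ℒ i) :
    Cells ℒ.edge D.bd
  | .inl f => ℒ.face f
  | .inr i => A i

/-- The pasting of the 2-cells labelling the faces `fst i` and `snd i`. -/
noncomputable def pasting (D : 𝒢.GluePairs ι) (ℒ : 𝒢.Labelling 𝒦) (i : ι) :
    D.TwoCell ℒ i :=
  (D.shape i).pasting (ℒ.face (D.fst i)) (ℒ.face (D.snd i))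

lemma exists_expanded (ℒ : 𝒢.Labelling 𝒦)
    (A : ∀ i, D.TwoCell ℒ i) (P : Set ι)
    {s t : V} {w w' : Path s t} {l : List D.Cell} (σ : Sweep D.bd w l w')
    (hA : ∀ i ∉ P, Sum.inr i ∈ l → A i = D.pasting ℒ i) :
    ∃ σ' : Sweep D.bd w (l.flatMap (D.expand P)) w',
      eval (D.extend ℒ A) σ' = eval (D.extend ℒ A) σ := by
  induction σ with
  | nil w => exact ⟨.nil w, rfl⟩
  | cons f x y hw rest ih =>
    obtain ⟨ρ, hρ⟩ := ih fun i hi hl => hA i hi (List.mem_cons_of_mem _ hl)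
    rcases f with f | i
    · exact ⟨.cons (Sum.inl f) x y hw ρ, by
          simp only [eval]
          rw [← hρ]⟩
    · rw [List.flatMap_cons]
      by_cases hi : i ∈ P
      · rw [expand, if_pos hi]
        exact ⟨.cons (Sum.inr i) x y hw ρ, by
          simp only [eval]
          rw [← hρ]⟩
      · rw [expand, if_neg hi]
        obtain ⟨σ', hσ'⟩ := exists_pasted (ψ := D.extend ℒ A) (b := .inl (D.fst i))
          (c := .inl (D.snd i)) (D.shape i) x y hw ρ
        refine ⟨σ', hσ'.trans ?_⟩
        have hAi : D.extend ℒ A (.inr i) = D.pasting ℒ i := hA i hi (by simp)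
        simp only [eval]
        rw [hAi, ← hρ]
        rfl

/-- The composites of all faces in a given order. -/
noncomputable def comp (D : 𝒢.GluePairs ι) {φ : V ⥤q 𝒦} (M : Cells φ D.bd) {P : Set ι}
    (X : D.Order P) : ev φ 𝒢.top ⟶ ev φ 𝒢.bot :=
  eval M ((D.incidence P).exists_sweep X).some

lemma comp_unglueOrder (ℒ : 𝒢.Labelling 𝒦)
    (A : ∀ i, D.TwoCell ℒ i) {P P' : Set ι}
    (hP : P ⊆ P') (hA : ∀ i ∈ P', i ∉ P → A i = D.pasting ℒ i) (X : D.Order P') :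
    D.comp (D.extend ℒ A) (D.unglueOrder hP X) = D.comp (D.extend ℒ A) X := by
  obtain ⟨σ, hσ⟩ := exists_expanded ℒ A P ((D.incidence P').exists_sweep X).some
    fun i hi hl => hA i ((X.mem_iff _).1 hl) hi
  rw [comp, comp, ← hσ]
  exact congrArg _ (sweep_subsingleton 𝒢.acyclic _ _ _)

lemma comp_eq {φ : V ⥤q 𝒦} (M : Cells φ D.bd) {P : Set ι} (X : D.Order P) {l : List D.Cell}
    (hX : X.list = l) (σ : Sweep D.bd 𝒢.top l 𝒢.bot) : D.comp M X = eval M σ := by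
  subst hX
  exact congrArg _ (sweep_subsingleton 𝒢.acyclic _ _ _)

lemma eval_cons_cons {φ : V ⥤q 𝒦} (M : Cells φ D.bd) {f g : D.Cell} {s t : V} {w w' : Path s t} (x : Path s (D.bd f).source)
    (y : Path (D.bd f).sink t) (x' : Path s (D.bd g).source) (y' : Path (D.bd g).sink t)
    (h : w = x.comp ((D.bd f).dom.comp y))
    (h' : x.comp ((D.bd f).cod.comp y) = x'.comp ((D.bd g).dom.comp y'))
    (h'' : x'.comp ((D.bd g).cod.comp y') = w') {t' : List D.Cell} {w'' : Path s t}
    (ρ : Sweep D.bd w' t' w'') : ∃ ρ' : Sweep D.bd w (f :: g :: t') w'', eval M ρ' =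
      eqToHom (congrArg (ev φ) h) ≫ whisker φ x (M f) y ≫ eqToHom (congrArg (ev φ) h') ≫
        whisker φ x' (M g) y' ≫ eqToHom (congrArg (ev φ) h'') ≫ eval M ρ := by
  subst h''
  exact ⟨.cons f x y h (.cons g x' y' h' ρ), by simp [eval]⟩

lemma comp_eq_leftFirst {φ : V ⥤q 𝒦} (M : Cells φ D.bd) {P : Set ι} {f g : D.Cell}
    {l l' : List D.Cell} {x : Path 𝒢.s (D.bd f).source}
    {m : Path (D.bd f).sink (D.bd g).source} {z : Path (D.bd g).sink 𝒢.t}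
    (σ : Sweep D.bd 𝒢.top l (x.comp ((D.bd f).dom.comp (m.comp ((D.bd g).dom.comp z)))))
    (ρ : Sweep D.bd (x.comp ((D.bd f).cod.comp (m.comp ((D.bd g).cod.comp z)))) l' 𝒢.bot)
    (X : D.Order P) (hX : X.list = l ++ f :: g :: l') :
    D.comp M X = eval M σ ≫ leftFirst x (M f) m (M g) z ≫ eval M ρ := by
  obtain ⟨ρ', hρ'⟩ := eval_cons_cons M x (m.comp ((D.bd g).dom.comp z))
    (x.comp ((D.bd f).cod.comp m)) z rfl (by simp) (by simp) ρ
  rw [comp_eq M X hX (σ.append ρ'), eval_append, hρ', leftFirst_eq]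
  simp

lemma comp_eq_rightFirst {φ : V ⥤q 𝒦} (M : Cells φ D.bd) {P : Set ι} {f g : D.Cell}
    {l l' : List D.Cell} {x : Path 𝒢.s (D.bd f).source}
    {m : Path (D.bd f).sink (D.bd g).source} {z : Path (D.bd g).sink 𝒢.t}
    (σ : Sweep D.bd 𝒢.top l (x.comp ((D.bd f).dom.comp (m.comp ((D.bd g).dom.comp z)))))
    (ρ : Sweep D.bd (x.comp ((D.bd f).cod.comp (m.comp ((D.bd g).cod.comp z)))) l' 𝒢.bot)
    (X : D.Order P) (hX : X.list = l ++ g :: f :: l') :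
    D.comp M X = eval M σ ≫ rightFirst x (M f) m (M g) z ≫ eval M ρ := by
  obtain ⟨ρ', hρ'⟩ := eval_cons_cons M
    (w := x.comp ((D.bd f).dom.comp (m.comp ((D.bd g).dom.comp z))))
    (x.comp ((D.bd f).dom.comp m)) z x (m.comp ((D.bd g).cod.comp z)) (by simp) (by simp) rfl ρ
  rw [comp_eq M X hX (σ.append ρ'), eval_append, hρ', rightFirst_eq]
  simp

/-- The contractible groupoid of orders of composition: there is exactly one morphism between any
two of them. -/
abbrev Orders (D : 𝒢.GluePairs ι) (P : Set ι) : Type _ := Codiscrete (D.Order P)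

/-- The equivalence from the groupoid of orders of composition of the scheme in which the pairs in
`P'` are glued to the one in which those in `P` are glued. -/
noncomputable def unglue (D : 𝒢.GluePairs ι) {P P' : Set ι} (hP : P ⊆ P') :
    D.Orders P' ⥤ D.Orders P :=
  Codiscrete.functorOfFun (D.unglueOrder hP)

/-- A functor from the orders of composition to 2-cells and 3-cells which sends each order to the
composite in this order and each interchange of two consecutive faces to the corresponding
whiskered interchange isomorphism. -/
structure Composition (D : 𝒢.GluePairs ι) {φ : V ⥤q 𝒦} (M : Cells φ D.bd) (P : Set ι) where
  hom (X Y : D.Order P) : D.comp M X ⟶ D.comp M Y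
  hom_self (X : D.Order P) : hom X X = 𝟙 (D.comp M X)
  hom_comp (X Y Z : D.Order P) : hom X Y ≫ hom Y Z = hom X Z
  hom_swap (X Y : D.Order P) {f g : D.Cell} {l l' : List D.Cell}
    (hX : X.list = l ++ f :: g :: l') (hY : Y.list = l ++ g :: f :: l')
    (x : Path 𝒢.s (D.bd f).source) (m : Path (D.bd f).sink (D.bd g).source)
    (z : Path (D.bd g).sink 𝒢.t)
    (σ : Sweep D.bd 𝒢.top l (x.comp ((D.bd f).dom.comp (m.comp ((D.bd g).dom.comp z)))))
    (ρ : Sweep D.bd (x.comp ((D.bd f).cod.comp (m.comp ((D.bd g).cod.comp z)))) l' 𝒢.bot) :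
    hom X Y = eqToHom (comp_eq_leftFirst M σ ρ X hX) ≫
      eval M σ ◁ exchange x (M f) m (M g) z ▷ eval M ρ ≫
        eqToHom (comp_eq_rightFirst M σ ρ Y hY).symm

/-- The underlying functor. -/
noncomputable def Composition.functor {φ : V ⥤q 𝒦} {M : Cells φ D.bd} {P : Set ι}
    (L : D.Composition M P) : D.Orders P ⥤ (ev φ 𝒢.top ⟶ ev φ 𝒢.bot) where
  obj X := D.comp M X.as
  map {X Y} _ := L.hom X.as Y.as
  map_id X := L.hom_self X.as
  map_comp {X Y Z} _ _ := (L.hom_comp X.as Y.as Z.as).symm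

/-- The 3-cell between two composites in the order `X` which is induced by 3-cells between the
2-cells labelling the faces. -/
noncomputable def compMap {φ : V ⥤q 𝒦} {M M' : Cells φ D.bd} (θ : ∀ f, M f ⟶ M' f) {P : Set ι}
    (X : D.Order P) : D.comp M X ⟶ D.comp M' X :=
  evalMap θ ((D.incidence P).exists_sweep X).some

/-- 3-cells between the labels of the glued faces, completed by the identities of the labels of
the faces of `𝒢`. -/
noncomputable def extendMap (ℒ : 𝒢.Labelling 𝒦)
    {A A' : ∀ i, ev ℒ.edge (D.bd (.inr i)).dom ⟶ ev ℒ.edge (D.bd (.inr i)).cod}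
    (θ : ∀ i, A i ⟶ A' i) : ∀ f, D.extend ℒ A f ⟶ D.extend ℒ A' f
  | .inl f => 𝟙 (ℒ.face f)
  | .inr i => θ i

/-- Let `A i` be the pasting of the labels of the `i`-th pair of faces for all `i` in `P'` but not
in `P`. For a pseudo-inverse `J` of `D.unglue hP` and for 3-cells `θ i : A i ⟶ A' i`, this is the
component at `X` of the transformation induced by the `θ i`: the canonical isomorphism from the
composite in the order `X` to the one in the order `J X` (in which the two faces of each pair
that is glued in `P'` but not in `P` are consecutive), followed by the whiskered 3-cells. -/
noncomputable def inducedApp (ℒ : 𝒢.Labelling 𝒦)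
    {A A' : ∀ i, ev ℒ.edge (D.bd (.inr i)).dom ⟶ ev ℒ.edge (D.bd (.inr i)).cod}
    (θ : ∀ i, A i ⟶ A' i) {P P' : Set ι} (hP : P ⊆ P')
    (hA : ∀ i ∈ P', i ∉ P → A i = D.pasting ℒ i)
    (L : D.Composition (D.extend ℒ A) P) (J : D.Orders P ⥤ D.Orders P')
    (L' : D.Composition (D.extend ℒ A') P') (X : D.Orders P) :
    L.functor.obj X ⟶ (J ⋙ L'.functor).obj X :=
  L.hom X.as (D.unglueOrder hP (J.obj X).as) ≫
    eqToHom (comp_unglueOrder ℒ A hP hA (J.obj X).as) ≫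
      compMap (D.extendMap ℒ θ) (J.obj X).as

end GluePairs
end PastingScheme
end Gluing

/-- Names for two pairs of faces. -/
inductive Pair
  | fg
  | hk

namespace PastingScheme.GluePairs

section TwoPairs

variable {V : Type*} [Quiver V] [Finite V] [Finite (Quiver.Total V)] {𝒦 : Type*}
  [GrayCategory 𝒦] {𝒢 : PastingScheme V} {D : 𝒢.GluePairs Pair} {ℒ : 𝒢.Labelling 𝒦}

/-- A choice of labels of the two glued faces. -/
def labels (a : D.TwoCell ℒ .fg) (b : D.TwoCell ℒ .hk) : ∀ i, D.TwoCell ℒ i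
  | .fg => a
  | .hk => b

/-- A pair of 3-cells between labels of the two glued faces. -/
def labelsMap {a a' : D.TwoCell ℒ .fg} {b b' : D.TwoCell ℒ .hk} (ζ : a ⟶ a') (ξ : b ⟶ b') :
    ∀ i, labels a b i ⟶ labels a' b' i
  | .fg => ζ
  | .hk => ξ

lemma labels_fg (b : D.TwoCell ℒ .hk) (P : Set Pair) :
    ∀ i ∈ ({.fg} : Set Pair), i ∉ P → labels (D.pasting ℒ .fg) b i = D.pasting ℒ i := by
  rintro _ rfl _
  rfl

lemma labels_hk (a : D.TwoCell ℒ .fg) (P : Set Pair) :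
    ∀ i ∈ ({.hk} : Set Pair), i ∉ P → labels a (D.pasting ℒ .hk) i = D.pasting ℒ i := by
  rintro _ rfl _
  rfl

lemma labels_not_fg (a : D.TwoCell ℒ .fg) (P : Set Pair) :
    ∀ i ∈ P, i ∉ ({.fg} : Set Pair) → labels a (D.pasting ℒ .hk) i = D.pasting ℒ i
  | .fg, _, h => (h rfl).elim
  | .hk, _, _ => rfl

lemma labels_not_hk (b : D.TwoCell ℒ .hk) (P : Set Pair) :
    ∀ i ∈ P, i ∉ ({.hk} : Set Pair) → labels (D.pasting ℒ .fg) b i = D.pasting ℒ i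
  | .fg, _, _ => rfl
  | .hk, _, h => (h rfl).elim

end TwoPairs

end PastingScheme.GluePairs

/-- `J` is a pseudo-inverse of `S`. -/
def IsPseudoInverse {A B : Type*} [Category* A] [Category* B] (S : A ⥤ B) (J : B ⥤ A) : Prop :=
  Nonempty (S ⋙ J ≅ 𝟭 A) ∧ Nonempty (J ⋙ S ≅ 𝟭 B)

end GrayPasting

open GrayPasting PastingScheme.GluePairs

/-! ### Bundled cells of a strict 2-category. -/

namespace GrayPasting

/-! Composites of whiskered 2-cells have boundaries that agree only propositionally. The axioms of a
`Gray`-category are therefore heterogeneous equations, and the composites of a labelling contain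
transports `eqToHom`. Both disappear when a cell is bundled with its boundary: in `Cell₁` and
`Cell₂` of a hom-2-category, transports become identities and the heterogeneous axioms become
equations.

Existence of the functor is a coherence statement, proved by rewriting. A state is an order of the
faces that sweeps from the uppermost to the lowermost path. A `Step` interchanges two consecutive
faces, of which the one performed first lies to the left, and carries the whiskered interchange
3-cell. Steps terminate, since each lowers the number of pairs in left-to-right order (`inversions`;
absence of directed cycles enters here). They are locally confluent with equality of 3-cells
(`Step.join`): two steps at disjoint places commute by the middle-four interchange law. Two steps
overlapping in one face concern three faces side by side, and the resulting hexagon is the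
naturality of the interchange with respect to an interchange 3-cell (`Cell₁.hexagon`). As in
Newman's lemma, normal forms and the 3-cells leading to them are unique (`Reach.unique`). Any two
linear extensions are connected by interchanges of neighbours (`LinExt.connected`), so all orders
have the same normal form. The morphism from `X` to `Y` goes from `X` to the normal form and back to
`Y`, interchanges being invertible. Connectedness also gives uniqueness
(`Composition.subsingleton`).

For the second statement, the component of the induced transformation is regarded as a 3-cell
`induced` from an order `X` of the coarser-grained composition to an arbitrary order `Z` of the
glued scheme, not only to `J X`. It is compatible with the functors in both variables
(`hom_induced`, `induced_hom`). In `Z` this rests on two facts: whiskered 3-cells between labels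
commute with interchanges (`hom_compMap`), and gluing a pair whose label is the pasting of its
labels does not change the functor (`hom_unglueOrder`). The latter follows from uniqueness, because
interchanging a pasted face with a third face amounts to two interchanges, by compatibility of the
interchange with composition of 2-cells.

Consequently two successive gluings compose to a single `induced` 3-cell whose labels are changed by
the composite 3-cells (`induced_induced`). Both sides of the asserted equation become the 3-cell
induced by changing both labels at once, as the two 3-cells concern different faces. -/

/-- A 1-cell of a bicategory, bundled with its source and target. -/
structure Cell₁ (B : Type*) [Bicategory B] where
  {s t : B}
  hom : s ⟶ t

/-- A 2-cell of a bicategory, bundled with its boundary. -/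
structure Cell₂ (B : Type*) [Bicategory B] where
  {s t : B}
  {dom cod : s ⟶ t}
  hom : dom ⟶ cod

section Bundled
variable {B : Type*} [Bicategory B]

namespace Cell₁

/-- This lemma and `Cell₂.ext_heq` turn the heterogeneous axioms of `GrayCategory` into equations
between bundled cells, once the boundaries have been compared. -/
lemma mk_eq {s t s' t' : B} {f : s ⟶ t} {g : s' ⟶ t'} (hs : s = s') (ht : t = t')
    (h : HEq f g) : mk f = mk g := by
  subst hs ht; cases h; rfl

/-- The identity 1-cell. -/
def one (x : B) : Cell₁ B := ⟨𝟙 x⟩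

/-- The composite of two composable 1-cells. -/
def comp (a b : Cell₁ B) (h : a.t = b.s) : Cell₁ B :=
  -- The cast affects only the source of `b.hom`, so that the end points of the composite are by
  -- definition those of `a` and `b`.
  ⟨a.hom ≫ (cast (congrArg (fun x => x ⟶ b.t) h.symm) b.hom : a.t ⟶ b.t)⟩

lemma mk_eqToHom {x y : B} (h : x = y) : mk (eqToHom h) = one x := by
  subst h; rfl

@[simp] lemma comp_s (a b : Cell₁ B) (h : a.t = b.s) : (a.comp b h).s = a.s := rfl
@[simp] lemma comp_t (a b : Cell₁ B) (h : a.t = b.s) : (a.comp b h).t = b.t := rfl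

end Cell₁

namespace Cell₂

/-- The source of a 2-cell. -/
def src (Θ : Cell₂ B) : Cell₁ B := ⟨Θ.dom⟩

/-- The target of a 2-cell. -/
def tgt (Θ : Cell₂ B) : Cell₁ B := ⟨Θ.cod⟩

@[simp] lemma src_mk {s t : B} {f g : s ⟶ t} (θ : f ⟶ g) : (mk θ).src = ⟨f⟩ := rfl
@[simp] lemma tgt_mk {s t : B} {f g : s ⟶ t} (θ : f ⟶ g) : (mk θ).tgt = ⟨g⟩ := rfl
@[simp] lemma tgt_s (Θ : Cell₂ B) : Θ.tgt.s = Θ.src.s := rfl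
@[simp] lemma tgt_t (Θ : Cell₂ B) : Θ.tgt.t = Θ.src.t := rfl

lemma ext_heq {Θ Ξ : Cell₂ B} (hs : Θ.src = Ξ.src) (ht : Θ.tgt = Ξ.tgt)
    (h : HEq Θ.hom Ξ.hom) : Θ = Ξ := by
  obtain ⟨θ⟩ := Θ
  obtain ⟨ξ⟩ := Ξ
  cases hs
  cases ht
  cases h
  rfl

lemma mk_inj {s t : B} {f g : s ⟶ t} {θ ξ : f ⟶ g} (h : mk θ = mk ξ) : θ = ξ := by
  cases h; rfl

/-- The identity 2-cell of a 1-cell. -/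
def one (a : Cell₁ B) : Cell₂ B := ⟨𝟙 a.hom⟩

/-- The vertical composite of two 2-cells. -/
def vcomp : (Θ Ξ : Cell₂ B) → Θ.tgt = Ξ.src → Cell₂ B
  | @mk _ _ _ _ _ _ θ, @mk _ _ _ _ _ _ ξ, rfl => ⟨θ ≫ ξ⟩

/-- The horizontal composite of two 2-cells. -/
def hcomp (Θ Ξ : Cell₂ B) (h : Θ.src.t = Ξ.src.s) : Cell₂ B where
  s := Θ.s
  t := Ξ.t
  dom := (Θ.src.comp Ξ.src h).hom
  cod := (Θ.tgt.comp Ξ.tgt h).hom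
  -- The boundary is given outside the match, so that `hcomp_src` and `hcomp_tgt` hold by `rfl` for
  -- every proof `h`.
  hom := match Θ, Ξ, h with
    | @mk _ _ _ _ _ _ θ, @mk _ _ _ _ _ _ ξ, rfl => (θ ▷ _) ≫ (_ ◁ ξ)

@[simp] lemma one_src (a : Cell₁ B) : (one a).src = a := rfl
@[simp] lemma one_tgt (a : Cell₁ B) : (one a).tgt = a := rfl
@[simp] lemma hcomp_src (Θ Ξ : Cell₂ B) (h : Θ.src.t = Ξ.src.s) :
    (Θ.hcomp Ξ h).src = Θ.src.comp Ξ.src (id h) := rfl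
@[simp] lemma hcomp_tgt (Θ Ξ : Cell₂ B) (h : Θ.src.t = Ξ.src.s) :
    (Θ.hcomp Ξ h).tgt = Θ.tgt.comp Ξ.tgt (id h) := rfl

@[simp] lemma vcomp_src (Θ Ξ : Cell₂ B) (h : Θ.tgt = Ξ.src) :
    (Θ.vcomp Ξ h).src = Θ.src := by
  obtain ⟨θ⟩ := Θ
  obtain ⟨ξ⟩ := Ξ
  cases h
  rfl

@[simp] lemma vcomp_tgt (Θ Ξ : Cell₂ B) (h : Θ.tgt = Ξ.src) :
    (Θ.vcomp Ξ h).tgt = Ξ.tgt := by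
  obtain ⟨θ⟩ := Θ
  obtain ⟨ξ⟩ := Ξ
  cases h
  rfl

lemma vcomp_mk {s t : B} {f g h : s ⟶ t} (θ : f ⟶ g) (ξ : g ⟶ h) :
    (mk θ).vcomp (mk ξ) (id rfl) = mk (θ ≫ ξ) := rfl

lemma vcomp_assoc (Θ Ξ Ψ : Cell₂ B) (h : Θ.tgt = Ξ.src) (h' : Ξ.tgt = Ψ.src)
    (h₁ : (Θ.vcomp Ξ h).tgt = Ψ.src) (h₂ : Θ.tgt = (Ξ.vcomp Ψ h').src) :
    (Θ.vcomp Ξ h).vcomp Ψ h₁ = Θ.vcomp (Ξ.vcomp Ψ h') h₂ := by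
  obtain ⟨θ⟩ := Θ
  obtain ⟨ξ⟩ := Ξ
  obtain ⟨ψ⟩ := Ψ
  cases h
  cases h'
  exact congrArg mk (Category.assoc θ ξ ψ)

lemma one_vcomp (a : Cell₁ B) (Θ : Cell₂ B) (h : (one a).tgt = Θ.src) : (one a).vcomp Θ h = Θ := by
  obtain ⟨θ⟩ := Θ
  cases h
  simp [one, vcomp]

lemma vcomp_one (a : Cell₁ B) (Θ : Cell₂ B) (h : Θ.tgt = (one a).src) : Θ.vcomp (one a) h = Θ := by
  obtain ⟨θ⟩ := Θ
  cases h
  simp [one, vcomp]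

lemma one_hcomp_one (a b : Cell₁ B) (h : (one a).src.t = (one b).src.s) :
    (one a).hcomp (one b) h = one (a.comp b (id h)) := by
  obtain ⟨f⟩ := a
  obtain ⟨g⟩ := b
  cases h
  refine congrArg mk (?_ : (𝟙 f ▷ g) ≫ (f ◁ 𝟙 g) = 𝟙 (f ≫ g))
  simp

/-- The middle-four interchange law. -/
lemma vcomp_hcomp_vcomp (Θ Θ' Ξ Ξ' : Cell₂ B) (h : Θ.tgt = Θ'.src) (h' : Ξ.tgt = Ξ'.src)
    (h₁ : (Θ.vcomp Θ' h).src.t = (Ξ.vcomp Ξ' h').src.s) (h₂ : Θ.src.t = Ξ.src.s)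
    (h₃ : Θ'.src.t = Ξ'.src.s) (h₄ : (Θ.hcomp Ξ h₂).tgt = (Θ'.hcomp Ξ' h₃).src) :
    (Θ.vcomp Θ' h).hcomp (Ξ.vcomp Ξ' h') h₁ = (Θ.hcomp Ξ h₂).vcomp (Θ'.hcomp Ξ' h₃) h₄ := by
  obtain @⟨a, b, f, g, θ⟩ := Θ
  obtain @⟨_, _, _, g', θ'⟩ := Θ'
  obtain @⟨_, c, k, l, ξ⟩ := Ξ
  obtain @⟨_, _, _, l', ξ'⟩ := Ξ'
  cases h
  cases h'
  cases h₂
  refine congrArg mk (?_ : ((θ ≫ θ') ▷ k) ≫ (g' ◁ (ξ ≫ ξ')) =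
    ((θ ▷ k) ≫ (g ◁ ξ)) ≫ ((θ' ▷ l) ≫ (g' ◁ ξ')))
  simp only [comp_whiskerRight, whiskerLeft_comp, Category.assoc]
  rw [whisker_exchange_assoc]

end Cell₂

variable [Bicategory.Strict B]

namespace Cell₁

lemma comp_assoc (a b c : Cell₁ B) (h : a.t = b.s) (h' : (a.comp b h).t = c.s) :
    (a.comp b h).comp c h' = a.comp (b.comp c (id h')) (id h) := by
  obtain ⟨f⟩ := a
  obtain ⟨g⟩ := b
  obtain ⟨k⟩ := c
  cases h
  cases h'
  simp [comp]

lemma one_comp (x : B) (a : Cell₁ B) (h : (one x).t = a.s) : (one x).comp a h = a := by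
  obtain ⟨f⟩ := a
  cases h
  simp [comp, one]

lemma comp_one (x : B) (a : Cell₁ B) (h : a.t = (one x).s) : a.comp (one x) h = a := by
  obtain ⟨f⟩ := a
  cases h
  simp [comp, one]

lemma mk_comp {x y z : B} (f : x ⟶ y) (g : y ⟶ z) : mk (f ≫ g) = (mk f).comp (mk g) (id rfl) := rfl

lemma mk_eqToHom_comp {x y z : B} (h : x = y) (f : y ⟶ z) : mk (eqToHom h ≫ f) = mk f := by
  subst h; simp

end Cell₁

namespace Cell₂

lemma hcomp_assoc (Θ Ξ Ψ : Cell₂ B) (h : Θ.src.t = Ξ.src.s) (h' : (Θ.hcomp Ξ h).src.t = Ψ.src.s) :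
    (Θ.hcomp Ξ h).hcomp Ψ h' = Θ.hcomp (Ξ.hcomp Ψ (id h')) (id h) := by
  obtain @⟨_, _, f, f', θ⟩ := Θ
  obtain @⟨_, _, g, g', ξ⟩ := Ξ
  obtain @⟨_, _, k, k', ψ⟩ := Ψ
  cases h
  cases h'
  refine ext_heq (Cell₁.comp_assoc _ _ _ rfl rfl) (Cell₁.comp_assoc _ _ _ rfl rfl) ?_
  change HEq ((((θ ▷ g) ≫ (f' ◁ ξ)) ▷ k) ≫ ((f' ≫ g') ◁ ψ))
    ((θ ▷ (g ≫ k)) ≫ (f' ◁ ((ξ ▷ k) ≫ (g' ◁ ψ))))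
  -- The two sides differ by associators, which in a strict bicategory are transports and do not
  -- matter up to `HEq`.
  have h : (θ ▷ (g ≫ k)) ≫ (f' ◁ ((ξ ▷ k) ≫ (g' ◁ ψ))) = (α_ _ _ _).inv ≫
      ((((θ ▷ g) ≫ (f' ◁ ξ)) ▷ k) ≫ ((f' ≫ g') ◁ ψ)) ≫ (α_ _ _ _).hom := by simp
  rw [h]
  generalize (((θ ▷ g) ≫ (f' ◁ ξ)) ▷ k) ≫ ((f' ≫ g') ◁ ψ) = χ
  simp [Strict.associator_eqToIso]

lemma mk_eqToHom_comp {s t : B} {f g h : s ⟶ t} (e : f = g) (θ : g ⟶ h) :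
    mk (eqToHom e ≫ θ) = mk θ := by
  subst e; simp

lemma mk_comp_eqToHom {s t : B} {f g h : s ⟶ t} (θ : f ⟶ g) (e : g = h) :
    mk (θ ≫ eqToHom e) = mk θ := by
  subst e; simp

lemma vcomp_mk_mk {s t : B} {f g g' h : s ⟶ t} (θ : f ⟶ g) (e : g = g') (ξ : g' ⟶ h)
    (h : (mk θ).tgt = (mk ξ).src) :
    (mk θ).vcomp (mk ξ) h = mk (θ ≫ eqToHom e ≫ ξ) := by
  subst e; simp [vcomp]

lemma mk_whiskerLeft {r s t : B} (f : r ⟶ s) {g h : s ⟶ t} (θ : g ⟶ h) :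
    mk (f ◁ θ) = (one ⟨f⟩).hcomp (mk θ) (id rfl) := by
  refine ext_heq rfl rfl (heq_of_eq ?_)
  change _ = (𝟙 f ▷ g) ≫ (f ◁ θ)
  simp

lemma mk_whiskerRight {r s t : B} {f g : r ⟶ s} (θ : f ⟶ g) (h : s ⟶ t) :
    mk (θ ▷ h) = (mk θ).hcomp (one ⟨h⟩) (id rfl) := by
  refine ext_heq rfl rfl (heq_of_eq ?_)
  change _ = (θ ▷ h) ≫ (g ◁ 𝟙 h)
  simp

lemma one_hcomp (x : B) (Θ : Cell₂ B) (h : (one (Cell₁.one x)).src.t = Θ.src.s) :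
    (one (Cell₁.one x)).hcomp Θ h = Θ := by
  obtain ⟨θ⟩ := Θ
  cases h
  refine ext_heq (Cell₁.one_comp _ (mk θ).src rfl) (Cell₁.one_comp _ (mk θ).tgt rfl) ?_
  change HEq ((𝟙 _ ▷ _) ≫ (𝟙 _ ◁ θ)) θ
  simp [Strict.leftUnitor_eqToIso]

lemma hcomp_one (x : B) (Θ : Cell₂ B) (h : Θ.src.t = (one (Cell₁.one x)).src.s) :
    Θ.hcomp (one (Cell₁.one x)) h = Θ := by
  obtain ⟨θ⟩ := Θ
  cases h
  refine ext_heq (Cell₁.comp_one _ (mk θ).src rfl) (Cell₁.comp_one _ (mk θ).tgt rfl) ?_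
  change HEq ((θ ▷ 𝟙 _) ≫ (_ ◁ 𝟙 _)) θ
  simp [Strict.rightUnitor_eqToIso]

/-- `whisker₃` and `exchange` are of this shape; bundling removes the 1-cells `eqToHom` around them.
-/
lemma mk_eqToHom_whisker {x y z w : B} (h : x = y) {f g : y ⟶ z} (Θ : f ⟶ g) (h' : z = w) :
    mk (eqToHom h ◁ (Θ ▷ eqToHom h')) = mk Θ := by
  subst h h'
  exact (mk_whiskerLeft _ _).trans ((one_hcomp _ _ _).trans
    ((mk_whiskerRight _ _).trans (hcomp_one _ _ _)))

lemma mk_hcomp_mk {x y z : B} {f f' : x ⟶ y} {g g' : y ⟶ z} (Θ : f ⟶ f') (Ξ : g ⟶ g') :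
    (mk Θ).hcomp (mk Ξ) (id rfl) = mk ((Θ ▷ g) ≫ (f' ◁ Ξ)) := rfl

end Cell₂
end Bundled
end GrayPasting

/-! ### Actions of 1-cells and the interchange on bundled cells. -/

namespace GrayPasting

section Gray
open GrayCategory
variable {𝒦 : Type*} [GrayCategory 𝒦] {W X Y Z : 𝒦}

namespace Cell₁

/-- The action of a 1-cell from the left. -/
def pre (f : X ⟶ Y) (a : Cell₁ (Y ⟶ Z)) : Cell₁ (X ⟶ Z) := ⟨GrayCategory.pre f a.hom⟩

/-- The action of a 1-cell from the right. -/
def post (a : Cell₁ (X ⟶ Y)) (g : Y ⟶ Z) : Cell₁ (X ⟶ Z) := ⟨GrayCategory.post a.hom g⟩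

@[simp] lemma pre_s (f : X ⟶ Y) (a : Cell₁ (Y ⟶ Z)) : (a.pre f).s = f ≫ a.s := rfl
@[simp] lemma pre_t (f : X ⟶ Y) (a : Cell₁ (Y ⟶ Z)) : (a.pre f).t = f ≫ a.t := rfl
@[simp] lemma post_s (a : Cell₁ (X ⟶ Y)) (g : Y ⟶ Z) : (a.post g).s = a.s ≫ g := rfl
@[simp] lemma post_t (a : Cell₁ (X ⟶ Y)) (g : Y ⟶ Z) : (a.post g).t = a.t ≫ g := rfl

@[simp] lemma pre_one (f : X ⟶ Y) (g : Y ⟶ Z) : (one g).pre f = one (f ≫ g) :=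
  congrArg mk (GrayCategory.pre_id f g)

@[simp] lemma post_one (f : X ⟶ Y) (g : Y ⟶ Z) : (one f).post g = one (f ≫ g) :=
  congrArg mk (GrayCategory.post_id f g)

lemma pre_comp (f : X ⟶ Y) (a b : Cell₁ (Y ⟶ Z)) (h : a.t = b.s) :
    (a.comp b h).pre f = (a.pre f).comp (b.pre f) (id (congrArg (f ≫ ·) h)) := by
  obtain ⟨a⟩ := a
  obtain ⟨b⟩ := b
  cases h
  exact congrArg mk (GrayCategory.pre_comp f a b)

lemma post_comp (a b : Cell₁ (X ⟶ Y)) (h : a.t = b.s) (g : Y ⟶ Z) :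
    (a.comp b h).post g = (a.post g).comp (b.post g) (id (congrArg (· ≫ g) h)) := by
  obtain ⟨a⟩ := a
  obtain ⟨b⟩ := b
  cases h
  exact congrArg mk (GrayCategory.post_comp a b g)

lemma pre_pre (f : W ⟶ X) (g : X ⟶ Y) (a : Cell₁ (Y ⟶ Z)) :
    (a.pre g).pre f = a.pre (f ≫ g) :=
  (mk_eq (Category.assoc _ _ _) (Category.assoc _ _ _) (GrayCategory.comp_pre _ _ _)).symm

lemma post_post (a : Cell₁ (W ⟶ X)) (g : X ⟶ Y) (h : Y ⟶ Z) :
    (a.post g).post h = a.post (g ≫ h) :=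
  (mk_eq (Category.assoc _ _ _).symm (Category.assoc _ _ _).symm
    (GrayCategory.post_comp₁ _ _ _)).symm

lemma post_pre (f : W ⟶ X) (a : Cell₁ (X ⟶ Y)) (h : Y ⟶ Z) :
    (a.post h).pre f = (a.pre f).post h :=
  mk_eq (Category.assoc _ _ _).symm (Category.assoc _ _ _).symm (GrayCategory.pre_post _ _ _)

end Cell₁

namespace Cell₂

/-- The action of a 1-cell from the left. -/
def pre (f : X ⟶ Y) (Θ : Cell₂ (Y ⟶ Z)) : Cell₂ (X ⟶ Z) := ⟨pre₃ f Θ.hom⟩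

/-- The action of a 1-cell from the right. -/
def post (Θ : Cell₂ (X ⟶ Y)) (g : Y ⟶ Z) : Cell₂ (X ⟶ Z) := ⟨post₃ Θ.hom g⟩

@[simp] lemma pre_src (f : X ⟶ Y) (Θ : Cell₂ (Y ⟶ Z)) : (Θ.pre f).src = Θ.src.pre f := rfl
@[simp] lemma pre_tgt (f : X ⟶ Y) (Θ : Cell₂ (Y ⟶ Z)) : (Θ.pre f).tgt = Θ.tgt.pre f := rfl
@[simp] lemma post_src (Θ : Cell₂ (X ⟶ Y)) (g : Y ⟶ Z) : (Θ.post g).src = Θ.src.post g := rfl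
@[simp] lemma post_tgt (Θ : Cell₂ (X ⟶ Y)) (g : Y ⟶ Z) : (Θ.post g).tgt = Θ.tgt.post g := rfl

@[simp] lemma pre_one (f : X ⟶ Y) (a : Cell₁ (Y ⟶ Z)) : (one a).pre f = one (a.pre f) :=
  congrArg mk (GrayCategory.pre₃_id f a.hom)

@[simp] lemma post_one (a : Cell₁ (X ⟶ Y)) (g : Y ⟶ Z) : (one a).post g = one (a.post g) :=
  congrArg mk (GrayCategory.post₃_id a.hom g)

lemma pre_vcomp (f : X ⟶ Y) (Θ Ξ : Cell₂ (Y ⟶ Z)) (h : Θ.tgt = Ξ.src) :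
    (Θ.vcomp Ξ h).pre f = (Θ.pre f).vcomp (Ξ.pre f) (id (congrArg (Cell₁.pre f) h)) := by
  obtain ⟨θ⟩ := Θ
  obtain ⟨ξ⟩ := Ξ
  cases h
  exact congrArg mk (GrayCategory.pre₃_comp f θ ξ)

lemma post_vcomp (Θ Ξ : Cell₂ (X ⟶ Y)) (h : Θ.tgt = Ξ.src) (g : Y ⟶ Z) :
    (Θ.vcomp Ξ h).post g =
      (Θ.post g).vcomp (Ξ.post g) (id (congrArg (fun a : Cell₁ (X ⟶ Y) => a.post g) h)) := by
  obtain ⟨θ⟩ := Θ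
  obtain ⟨ξ⟩ := Ξ
  cases h
  exact congrArg mk (GrayCategory.post₃_comp θ ξ g)

lemma pre_pre (f : W ⟶ X) (g : X ⟶ Y) (Θ : Cell₂ (Y ⟶ Z)) :
    (Θ.pre g).pre f = Θ.pre (f ≫ g) :=
  ext_heq (Cell₁.pre_pre _ _ Θ.src) (Cell₁.pre_pre _ _ Θ.tgt) (GrayCategory.comp_pre₃ _ _ _).symm

lemma post_post (Θ : Cell₂ (W ⟶ X)) (g : X ⟶ Y) (h : Y ⟶ Z) :
    (Θ.post g).post h = Θ.post (g ≫ h) :=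
  ext_heq (Cell₁.post_post Θ.src _ _) (Cell₁.post_post Θ.tgt _ _) (GrayCategory.post₃_comp₁ _ _ _).symm

lemma post_pre (f : W ⟶ X) (Θ : Cell₂ (X ⟶ Y)) (h : Y ⟶ Z) :
    (Θ.post h).pre f = (Θ.pre f).post h :=
  ext_heq (Cell₁.post_pre _ Θ.src _) (Cell₁.post_pre _ Θ.tgt _) (GrayCategory.pre₃_post₃ _ _ _)

end Cell₂

namespace Cell₁

/-- The interchange 3-cell. -/
def interchange (a : Cell₁ (X ⟶ Y)) (b : Cell₁ (Y ⟶ Z)) : Cell₂ (X ⟶ Z) :=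
  ⟨(GrayCategory.interchange a.hom b.hom).hom⟩

@[simp] lemma interchange_src (a : Cell₁ (X ⟶ Y)) (b : Cell₁ (Y ⟶ Z)) :
    (a.interchange b).src = (a.post b.s).comp (b.pre a.t) (id rfl) := rfl

@[simp] lemma interchange_tgt (a : Cell₁ (X ⟶ Y)) (b : Cell₁ (Y ⟶ Z)) :
    (a.interchange b).tgt = (b.pre a.s).comp (a.post b.t) (id rfl) := rfl

lemma pre_interchange (e : W ⟶ X) (a : Cell₁ (X ⟶ Y)) (b : Cell₁ (Y ⟶ Z)) :
    (a.pre e).interchange b = (a.interchange b).pre e :=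
  Cell₂.ext_heq (by simp [pre_comp, pre_pre, post_pre]) (by simp [pre_comp, pre_pre, post_pre])
    (GrayCategory.interchange_pre _ _ _)

lemma post_interchange (a : Cell₁ (W ⟶ X)) (e : X ⟶ Y) (b : Cell₁ (Y ⟶ Z)) :
    (a.post e).interchange b = a.interchange (b.pre e) :=
  Cell₂.ext_heq (by simp [post_post, pre_pre]) (by simp [post_post, pre_pre])
    (GrayCategory.interchange_mid _ _ _)

lemma interchange_post (a : Cell₁ (W ⟶ X)) (b : Cell₁ (X ⟶ Y)) (h : Y ⟶ Z) :
    a.interchange (b.post h) = (a.interchange b).post h :=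
  Cell₂.ext_heq (by simp [post_comp, post_post, post_pre])
    (by simp [post_comp, post_post, post_pre]) (GrayCategory.interchange_post _ _ _)

lemma comp_interchange (a a' : Cell₁ (X ⟶ Y)) (h : a.t = a'.s) (b : Cell₁ (Y ⟶ Z)) :
    (a.comp a' h).interchange b =
      ((Cell₂.one (a.post b.s)).hcomp (a'.interchange b) (id (congrArg (· ≫ b.s) h))).vcomp
        ((a.interchange b).hcomp (Cell₂.one (a'.post b.t)) (id (congrArg (· ≫ b.t) h)))
        (id (by simp [comp_assoc, h])) := by
  -- The axiom is a heterogeneous equation, so its source and target are compared beforehand. The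
  -- associator it contains is a transport, absorbed by `Cell₂.vcomp_mk_mk`.
  have hs : ((a.comp a' h).interchange b).src =
      (a.post b.s).comp ((a'.post b.s).comp (b.pre a'.t) (id rfl))
        (id (congrArg (· ≫ b.s) h)) := by
    simp [post_comp, comp_assoc]
  have ht : ((a.comp a' h).interchange b).tgt =
      ((b.pre a.s).comp (a.post b.t) (id rfl)).comp (a'.post b.t)
        (id (congrArg (· ≫ b.t) h)) := by
    simp [post_comp, comp_assoc]
  obtain @⟨_, _, a⟩ := a
  obtain @⟨_, _, a'⟩ := a'
  obtain @⟨g, g', b⟩ := b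
  cases h
  refine (Cell₂.ext_heq (Ξ := ⟨_⟩) hs ht
    (GrayCategory.interchange_comp_left a a' b)).trans ?_
  rw [Strict.associator_eqToIso]
  refine (Cell₂.vcomp_mk_mk (GrayCategory.post a g ◁ (GrayCategory.interchange a' b).hom)
    (Strict.assoc _ _ _).symm ((GrayCategory.interchange a b).hom ▷ GrayCategory.post a' g')
    (congrArg mk (Strict.assoc _ _ _).symm)).symm.trans ?_
  congr 1
  · exact Cell₂.mk_whiskerLeft _ _
  · exact Cell₂.mk_whiskerRight _ _

lemma interchange_comp (a : Cell₁ (X ⟶ Y)) (b b' : Cell₁ (Y ⟶ Z)) (h : b.t = b'.s) :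
    a.interchange (b.comp b' h) =
      ((a.interchange b).hcomp (Cell₂.one (b'.pre a.t)) (id (congrArg (a.t ≫ ·) h))).vcomp
        ((Cell₂.one (b.pre a.s)).hcomp (a.interchange b') (id (congrArg (a.s ≫ ·) h)))
        (id (by simp [comp_assoc, h])) := by
  have hs : (a.interchange (b.comp b' h)).src =
      ((a.post b.s).comp (b.pre a.t) (id rfl)).comp (b'.pre a.t)
        (id (congrArg (a.t ≫ ·) h)) := by
    simp [pre_comp, comp_assoc]
  have ht : (a.interchange (b.comp b' h)).tgt =
      (b.pre a.s).comp ((b'.pre a.s).comp (a.post b'.t) (id rfl))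
        (id (congrArg (a.s ≫ ·) h)) := by
    simp [pre_comp, comp_assoc]
  obtain @⟨f, f', a⟩ := a
  obtain @⟨_, _, b⟩ := b
  obtain @⟨_, _, b'⟩ := b'
  cases h
  refine (Cell₂.ext_heq (Ξ := ⟨_⟩) hs ht
    (GrayCategory.interchange_comp_right a b b')).trans ?_
  rw [Strict.associator_eqToIso]
  refine (Cell₂.vcomp_mk_mk ((GrayCategory.interchange a b).hom ▷ GrayCategory.pre f' b')
    (Strict.assoc _ _ _) (GrayCategory.pre f b ◁ (GrayCategory.interchange a b').hom)
    (congrArg mk (Strict.assoc _ _ _))).symm.trans ?_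
  congr 1
  · exact Cell₂.mk_whiskerRight _ _
  · exact Cell₂.mk_whiskerLeft _ _

/-- Naturality of the interchange in its left argument. -/
lemma interchange_naturality_left (Θ : Cell₂ (X ⟶ Y)) (b : Cell₁ (Y ⟶ Z)) :
    ((Θ.post b.s).hcomp (Cell₂.one (b.pre Θ.tgt.t)) (id rfl)).vcomp (Θ.tgt.interchange b)
        (id (by simp)) =
      (Θ.src.interchange b).vcomp
        ((Cell₂.one (b.pre Θ.src.s)).hcomp (Θ.post b.t) (id rfl)) (id (by simp)) := by
  have h := congrArg Cell₂.mk (GrayCategory.interchange_naturality_left Θ.hom b.hom)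
  refine Eq.trans ?_ (h.trans ?_)
  · refine Eq.trans ?_ (Cell₂.vcomp_mk _ _)
    congr 1
    exact (Cell₂.mk_whiskerRight _ _).symm
  · refine (Cell₂.vcomp_mk _ _).symm.trans ?_
    congr 1
    exact Cell₂.mk_whiskerLeft _ _

/-- Naturality of the interchange in its right argument. -/
lemma interchange_naturality_right (a : Cell₁ (X ⟶ Y)) (Ξ : Cell₂ (Y ⟶ Z)) :
    ((Cell₂.one (a.post Ξ.src.s)).hcomp (Ξ.pre a.t) (id rfl)).vcomp (a.interchange Ξ.tgt)
        (id (by simp)) =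
      (a.interchange Ξ.src).vcomp
        ((Ξ.pre a.s).hcomp (Cell₂.one (a.post Ξ.tgt.t)) (id rfl)) (id (by simp)) := by
  have h := congrArg Cell₂.mk (GrayCategory.interchange_naturality_right a.hom Ξ.hom)
  refine Eq.trans ?_ (h.trans ?_)
  · refine Eq.trans ?_ (Cell₂.vcomp_mk _ _)
    congr 1
    exact (Cell₂.mk_whiskerLeft _ _).symm
  · refine (Cell₂.vcomp_mk _ _).symm.trans ?_
    congr 1
    exact Cell₂.mk_whiskerRight _ _

end Cell₁
end Gray
end GrayPasting

/-! ### Whiskered interchange: hexagon, naturality, compatibility with pasting. -/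

namespace GrayPasting

section Exchange
open GrayCategory
variable {𝒦 : Type*} [GrayCategory 𝒦] {S A A' B B' C C' T : 𝒦}

namespace Cell₂
variable {B : Type*} [Bicategory B]

/-- Middle-four interchange with identities: a horizontal composite may be performed on its left
factor first, as here, or on its right factor first, as in `hcomp_eq_vcomp'`. Comparing the two
makes cells at different places commute (`between_comm`). -/
lemma hcomp_eq_vcomp (Θ Ξ : Cell₂ B) (h : Θ.src.t = Ξ.src.s) :
    Θ.hcomp Ξ h = (Θ.hcomp (one Ξ.src) (id h)).vcomp ((one Θ.tgt).hcomp Ξ (id h))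
      (id (by simp)) := by
  have := vcomp_hcomp_vcomp Θ (one Θ.tgt) (one Ξ.src) Ξ (id rfl) (id rfl) (id (by simpa using h)) (id h)
    (id h) (id (by simp))
  rw [← this]
  congr 1
  · exact (vcomp_one _ _ _).symm
  · exact (one_vcomp _ _ _).symm

lemma hcomp_eq_vcomp' (Θ Ξ : Cell₂ B) (h : Θ.src.t = Ξ.src.s) :
    Θ.hcomp Ξ h = ((one Θ.src).hcomp Ξ (id h)).vcomp (Θ.hcomp (one Ξ.tgt) (id h))
      (id (by simp)) := by
  have := vcomp_hcomp_vcomp (one Θ.src) Θ Ξ (one Ξ.tgt) (id rfl) (id rfl) (id (by simpa using h)) (id h)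
    (id h) (id (by simp))
  rw [← this]
  congr 1
  · exact (one_vcomp _ _ _).symm
  · exact (vcomp_one _ _ _).symm

/-- The pasting of two commutative squares. -/
lemma vcomp_paste {Θ Θ' I J K Ξ Ξ' : Cell₂ B} (h₁ : Θ.tgt = I.src) (h₂ : J.tgt = Ξ.src)
    (h₃ : Θ'.tgt = K.src) (h₄ : I.tgt = Ξ'.src) (h₅ : Θ.tgt = Θ'.src) (h₆ : Ξ.tgt = Ξ'.src)
    (h : Θ.vcomp I h₁ = J.vcomp Ξ h₂) (h' : Θ'.vcomp K h₃ = I.vcomp Ξ' h₄) :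
    (Θ.vcomp Θ' h₅).vcomp K (id (by simpa using h₃)) =
      J.vcomp (Ξ.vcomp Ξ' h₆) (id (by simpa using h₂)) := by
  rw [vcomp_assoc _ _ _ _ h₃ _ (id (by simpa using h₅))]
  simp only [h']
  rw [← vcomp_assoc _ _ _ h₁ _ (id (by simpa using h₄))]
  simp only [h]
  rw [vcomp_assoc]

end Cell₂

/-- The naturality squares in the left and in the right argument are pasted along the interchange of
`Θ.tgt` with `Ξ.src`. -/
lemma Cell₁.interchange_naturality (Θ : Cell₂ (S ⟶ A)) (Ξ : Cell₂ (A ⟶ B)) :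
    ((Θ.post Ξ.src.s).hcomp (Ξ.pre Θ.src.t) (id rfl)).vcomp (Θ.tgt.interchange Ξ.tgt)
        (id (by simp)) =
      (Θ.src.interchange Ξ.src).vcomp ((Ξ.pre Θ.src.s).hcomp (Θ.post Ξ.src.t) (id rfl))
        (id (by simp)) := by
  have hl := interchange_naturality_left Θ Ξ.src
  have hr := interchange_naturality_right Θ.tgt Ξ
  have h1 := Cell₂.hcomp_eq_vcomp (Θ.post Ξ.src.s) (Ξ.pre Θ.src.t) rfl
  have h2 := Cell₂.hcomp_eq_vcomp' (Ξ.pre Θ.src.s) (Θ.post Ξ.src.t) rfl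
  simp only [h1, h2]
  exact Cell₂.vcomp_paste _ (id (by simp)) _ _ (id (by simp)) _ hl hr

/-- The whiskering of a 2-cell with 1-cells on both sides. -/
def Cell₁.whisker (x : S ⟶ A) (a : Cell₁ (A ⟶ B)) (z : B ⟶ T) : Cell₁ (S ⟶ T) :=
  (a.post z).pre x

/-- The whiskering of a 3-cell with 1-cells on both sides. -/
def Cell₂.whisker (x : S ⟶ A) (Θ : Cell₂ (A ⟶ B)) (z : B ⟶ T) : Cell₂ (S ⟶ T) :=
  (Θ.post z).pre x

/-- The whiskered interchange of `a` and `b`. -/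
def Cell₁.exch (x : S ⟶ A) (a : Cell₁ (A ⟶ A')) (m : A' ⟶ B) (b : Cell₁ (B ⟶ B'))
    (z : B' ⟶ T) : Cell₂ (S ⟶ T) :=
  (a.interchange (b.pre m)).whisker x z

namespace Cell₁

@[simp] lemma whisker_s (x : S ⟶ A) (a : Cell₁ (A ⟶ B)) (z : B ⟶ T) :
    (a.whisker x z).s = x ≫ a.s ≫ z := rfl

@[simp] lemma whisker_t (x : S ⟶ A) (a : Cell₁ (A ⟶ B)) (z : B ⟶ T) :
    (a.whisker x z).t = x ≫ a.t ≫ z := rfl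

@[simp] lemma _root_.GrayPasting.Cell₂.whisker_src (x : S ⟶ A) (Θ : Cell₂ (A ⟶ B)) (z : B ⟶ T) :
    (Θ.whisker x z).src = Θ.src.whisker x z := rfl

@[simp] lemma _root_.GrayPasting.Cell₂.whisker_tgt (x : S ⟶ A) (Θ : Cell₂ (A ⟶ B)) (z : B ⟶ T) :
    (Θ.whisker x z).tgt = Θ.tgt.whisker x z := rfl

@[simp] lemma _root_.GrayPasting.Cell₂.whisker_one (x : S ⟶ A) (a : Cell₁ (A ⟶ B)) (z : B ⟶ T) :
    (Cell₂.one a).whisker x z = Cell₂.one (a.whisker x z) := by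
  simp [Cell₂.whisker, whisker]

@[simp] lemma exch_src (x : S ⟶ A) (a : Cell₁ (A ⟶ A')) (m : A' ⟶ B) (b : Cell₁ (B ⟶ B'))
    (z : B' ⟶ T) : (exch x a m b z).src =
      (a.whisker x (m ≫ b.s ≫ z)).comp (b.whisker (x ≫ a.t ≫ m) z) (id (by simp)) := by
  simp [exch, whisker, post_comp, pre_comp, post_pre, pre_pre, post_post]

@[simp] lemma exch_tgt (x : S ⟶ A) (a : Cell₁ (A ⟶ A')) (m : A' ⟶ B) (b : Cell₁ (B ⟶ B'))
    (z : B' ⟶ T) : (exch x a m b z).tgt =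
      (b.whisker (x ≫ a.s ≫ m) z).comp (a.whisker x (m ≫ b.t ≫ z)) (id (by simp)) := by
  simp [exch, whisker, post_comp, pre_comp, post_pre, pre_pre, post_post]

/-- Three 2-cells on a common 1-cell: the two ways of reversing their order agree. -/
lemma hexagon (x : S ⟶ A) (a : Cell₁ (A ⟶ A')) (m : A' ⟶ B) (b : Cell₁ (B ⟶ B'))
    (m' : B' ⟶ C) (c : Cell₁ (C ⟶ C')) (z : C' ⟶ T) :
    ((exch x a m b (m' ≫ c.s ≫ z)).hcomp
        (Cell₂.one (c.whisker (x ≫ a.t ≫ m ≫ b.t ≫ m') z)) (id (by simp))).vcomp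
      (((Cell₂.one (b.whisker (x ≫ a.s ≫ m) (m' ≫ c.s ≫ z))).hcomp
          (exch x a (m ≫ b.t ≫ m') c z) (id (by simp))).vcomp
        ((exch (x ≫ a.s ≫ m) b m' c z).hcomp
          (Cell₂.one (a.whisker x (m ≫ b.t ≫ m' ≫ c.t ≫ z))) (id (by simp)))
        (id (by simp [comp_assoc]))) (id (by simp [comp_assoc])) =
    (((Cell₂.one (a.whisker x (m ≫ b.s ≫ m' ≫ c.s ≫ z))).hcomp
        (exch (x ≫ a.t ≫ m) b m' c z) (id (by simp))).vcomp
      ((exch x a (m ≫ b.s ≫ m') c z).hcomp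
          (Cell₂.one (b.whisker (x ≫ a.t ≫ m) (m' ≫ c.t ≫ z))) (id (by simp)))
        (id (by simp [comp_assoc]))).vcomp
      ((Cell₂.one (c.whisker (x ≫ a.s ≫ m ≫ b.s ≫ m') z)).hcomp
        (exch x a m b (m' ≫ c.t ≫ z)) (id (by simp))) (id (by simp [comp_assoc])) := by
  -- The interchange of `a` and `b` is itself a 3-cell, and the interchange with `c` is natural with
  -- respect to it. Its source and target are composites of two 2-cells, and `comp_interchange`
  -- splits the interchange of each with `c` into two. This produces the six edges of the hexagon.
  have h := interchange_naturality_left (exch x a m b m') (c.post z)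
  simp only [exch_src, exch_tgt, comp_interchange] at h
  simpa [exch, whisker, Cell₂.whisker, pre_interchange, post_interchange, interchange_post,
    Cell₂.post_pre, Cell₂.pre_pre, Cell₂.post_post, post_pre, pre_pre, post_post] using h

/-- Naturality of the whiskered interchange. -/
lemma exch_naturality (x : S ⟶ A) (Θ : Cell₂ (A ⟶ A')) (m : A' ⟶ B) (Ξ : Cell₂ (B ⟶ B'))
    (z : B' ⟶ T) :
    ((Θ.whisker x (m ≫ Ξ.src.s ≫ z)).hcomp (Ξ.whisker (x ≫ Θ.src.t ≫ m) z)
        (id (by simp))).vcomp (exch x Θ.tgt m Ξ.tgt z) (id (by simp)) =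
      (exch x Θ.src m Ξ.src z).vcomp ((Ξ.whisker (x ≫ Θ.src.s ≫ m) z).hcomp
        (Θ.whisker x (m ≫ Ξ.src.t ≫ z)) (id (by simp))) (id (by simp)) := by
  -- The outer whiskerings are moved onto the arguments: the interchange is compatible with them.
  have h := interchange_naturality (Θ.pre x) ((Ξ.pre m).post z)
  simpa [exch, whisker, Cell₂.whisker, pre_interchange, post_interchange, interchange_post,
    Cell₂.post_pre, Cell₂.pre_pre, Cell₂.post_post, post_pre, pre_pre, post_post] using h

/-- The interchange of a composite of two whiskered 2-cells with a 2-cell on their right. -/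
lemma exch_comp_left (x : S ⟶ A) (u : A ⟶ B) (a : Cell₁ (B ⟶ B')) (v : B' ⟶ A') (u' : A ⟶ C)
    (b : Cell₁ (C ⟶ C')) (v' : C' ⟶ A') (h : (a.whisker u v).t = (b.whisker u' v').s)
    {D D' : 𝒦} (m : A' ⟶ D) (c : Cell₁ (D ⟶ D')) (z : D' ⟶ T) :
    exch x ((a.whisker u v).comp (b.whisker u' v') h) m c z =
      ((Cell₂.one (a.whisker (x ≫ u) (v ≫ m ≫ c.s ≫ z))).hcomp
        (exch (x ≫ u') b (v' ≫ m) c z) (id (by simpa using congrArg (x ≫ · ≫ m ≫ c.s ≫ z) h))).vcomp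
      ((exch (x ≫ u) a (v ≫ m) c z).hcomp
        (Cell₂.one (b.whisker (x ≫ u') (v' ≫ m ≫ c.t ≫ z)))
        (id (by simpa using congrArg (x ≫ · ≫ m ≫ c.t ≫ z) h)))
      (id (by
        have : x ≫ u ≫ a.t ≫ v ≫ m = x ≫ u' ≫ b.s ≫ v' ≫ m := by
          simpa using congrArg (x ≫ · ≫ m) h
        simp [comp_assoc, this])) := by
  -- The left whiskering by `x` is distributed over the composite, so that `comp_interchange`
  -- applies to two whiskered 2-cells.
  have h1 : ((a.whisker (x ≫ u) v).comp (b.whisker (x ≫ u') v') (id (by simpa using congrArg (x ≫ ·) h))) = ((a.whisker u v).comp (b.whisker u' v') h).pre x := by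
    simp [pre_comp, whisker, pre_pre]
  have h2 := comp_interchange (a.whisker (x ≫ u) v) (b.whisker (x ≫ u') v')
    (id (by simpa using congrArg (x ≫ ·) h)) ((c.pre m).post z)
  rw [h1] at h2
  simpa [exch, whisker, Cell₂.whisker, pre_interchange, post_interchange, interchange_post,
    Cell₂.post_pre, Cell₂.pre_pre, Cell₂.post_post, post_pre, pre_pre, post_post] using h2

/-- The interchange of a composite of two whiskered 2-cells with a 2-cell on their left. -/
lemma exch_comp_right (x : S ⟶ C) (c : Cell₁ (C ⟶ C')) (m : C' ⟶ A) {D D' : 𝒦} (u : A ⟶ B)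
    (a : Cell₁ (B ⟶ B')) (v : B' ⟶ A') (u' : A ⟶ D) (b : Cell₁ (D ⟶ D')) (v' : D' ⟶ A')
    (h : (a.whisker u v).t = (b.whisker u' v').s) (z : A' ⟶ T) :
    exch x c m ((a.whisker u v).comp (b.whisker u' v') h) z =
      ((exch x c (m ≫ u) a (v ≫ z)).hcomp
        (Cell₂.one (b.whisker (x ≫ c.t ≫ m ≫ u') (v' ≫ z)))
        (id (by simpa using congrArg (x ≫ c.t ≫ m ≫ · ≫ z) h))).vcomp
      ((Cell₂.one (a.whisker (x ≫ c.s ≫ m ≫ u) (v ≫ z))).hcomp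
        (exch x c (m ≫ u') b (v' ≫ z))
        (id (by simpa using congrArg (x ≫ c.s ≫ m ≫ · ≫ z) h)))
      (id (by
        have : u ≫ a.t ≫ v ≫ z = u' ≫ b.s ≫ v' ≫ z := by simpa using congrArg (· ≫ z) h
        simp [comp_assoc, this])) := by
  have h1 : (a.whisker (m ≫ u) (v ≫ z)).comp (b.whisker (m ≫ u') (v' ≫ z))
      (id (by simpa using congrArg (m ≫ · ≫ z) h)) =
        (((a.whisker u v).comp (b.whisker u' v') h).pre m).post z := by
    simp [pre_comp, post_comp, whisker, pre_pre, post_post, post_pre]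
  have h2 := interchange_comp (c.pre x) (a.whisker (m ≫ u) (v ≫ z))
    (b.whisker (m ≫ u') (v' ≫ z)) (id (by simpa using congrArg (m ≫ · ≫ z) h))
  rw [h1] at h2
  simpa [exch, whisker, Cell₂.whisker, pre_interchange, post_interchange, interchange_post,
    Cell₂.post_pre, Cell₂.pre_pre, Cell₂.post_post, post_pre, pre_pre, post_post] using h2

lemma whisker_comp (x : S ⟶ A) (a b : Cell₁ (A ⟶ B)) (h : a.t = b.s) (z : B ⟶ T) :
    (a.comp b h).whisker x z =
      (a.whisker x z).comp (b.whisker x z) (id (congrArg (x ≫ · ≫ z) h)) := by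
  simp [whisker, post_comp, pre_comp]

lemma whisker_whisker (x : S ⟶ A) (u : A ⟶ B) (a : Cell₁ (B ⟶ B')) (v : B' ⟶ A') (z : A' ⟶ T) :
    (a.whisker u v).whisker x z = a.whisker (x ≫ u) (v ≫ z) := by
  simp [whisker, post_pre, pre_pre, post_post]

lemma _root_.GrayPasting.Cell₂.whisker_vcomp (x : S ⟶ A) (Θ Ξ : Cell₂ (A ⟶ B))
    (h : Θ.tgt = Ξ.src) (z : B ⟶ T) : (Θ.vcomp Ξ h).whisker x z =
      (Θ.whisker x z).vcomp (Ξ.whisker x z) (id (congrArg (Cell₁.whisker x · z) h)) := by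
  simp [Cell₂.whisker, Cell₂.post_vcomp, Cell₂.pre_vcomp]

end Cell₁
end Exchange
end GrayPasting

/-! ### Composites along sweeps as bundled cells. -/

namespace GrayPasting

section SweepCells
open Quiver GrayCategory

variable {V : Type*} [Quiver V] {𝒦 : Type*} [GrayCategory 𝒦] {φ : V ⥤q 𝒦}
  {Φ : Type*} {bd : Φ → Boundary V}

/-- After bundling, whiskering along paths is whiskering by the composites of their labels. This
lemma, `mk_whisker₃` and `mk_exchange` reduce statements about labellings to the calculus of bundled
cells. -/
lemma mk_whisker {s a b t : V} (x : Path s a) {p q : Path a b} (α : ev φ p ⟶ ev φ q)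
    (y : Path b t) : Cell₁.mk (whisker φ x α y) = (Cell₁.mk α).whisker (ev φ x) (ev φ y) :=
  Cell₁.mk_eq (ev_comp₃ φ x p y) (ev_comp₃ φ x q y) (whisker_heq x α y)

lemma mk_whisker₃ {s a b t : V} (x : Path s a) {p q : Path a b} {α α' : ev φ p ⟶ ev φ q}
    (Θ : α ⟶ α') (y : Path b t) :
    Cell₂.mk (whisker₃ φ x Θ y) = (Cell₂.mk Θ).whisker (ev φ x) (ev φ y) :=
  Cell₂.mk_eqToHom_whisker _ _ _

lemma mk_exchange {s a a' b b' t : V} (x : Path s a) {p p' : Path a a'} (α : ev φ p ⟶ ev φ p')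
    (m : Path a' b) {q q' : Path b b'} (β : ev φ q ⟶ ev φ q') (z : Path b' t) :
    Cell₂.mk (exchange x α m β z) = Cell₁.exch (ev φ x) ⟨α⟩ (ev φ m) ⟨β⟩ (ev φ z) :=
  Cell₂.mk_eqToHom_whisker _ _ _

/-- The 2-cell labelling a face, as a bundled 1-cell of a hom-2-category. -/
def cell (M : Cells φ bd) (f : Φ) : Cell₁ (φ.obj (bd f).source ⟶ φ.obj (bd f).sink) := ⟨M f⟩

@[simp] lemma cell_s (M : Cells φ bd) (f : Φ) : (cell M f).s = ev φ (bd f).dom := rfl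
@[simp] lemma cell_t (M : Cells φ bd) (f : Φ) : (cell M f).t = ev φ (bd f).cod := rfl

/-- The composite of the 2-cells along a sweep, as a bundled 1-cell. -/
def evalCell (M : Cells φ bd) {s t : V} {w w' : Path s t} {l : List Φ} (σ : Sweep bd w l w') :
    Cell₁ (φ.obj s ⟶ φ.obj t) := ⟨eval M σ⟩

/-- The horizontal composite of the 3-cells along a sweep, as a bundled 2-cell. -/
def mapCell {M M' : Cells φ bd} (θ : ∀ f, M f ⟶ M' f) {s t : V} {w w' : Path s t} {l : List Φ}
    (σ : Sweep bd w l w') : Cell₂ (φ.obj s ⟶ φ.obj t) := ⟨evalMap θ σ⟩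

section
variable (M : Cells φ bd) {M' : Cells φ bd} (θ : ∀ f, M f ⟶ M' f) {s t : V} {w w' : Path s t}
  {l : List Φ} (σ : Sweep bd w l w')

@[simp] lemma evalCell_s : (evalCell M σ).s = ev φ w := rfl
@[simp] lemma evalCell_t : (evalCell M σ).t = ev φ w' := rfl
@[simp] lemma mapCell_src : (mapCell θ σ).src = evalCell M σ := rfl
@[simp] lemma mapCell_tgt : (mapCell θ σ).tgt = evalCell M' σ := rfl

end

lemma evalCell_cons (M : Cells φ bd) {s t : V} {w w' : Path s t} {l : List Φ} (f : Φ)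
    (x : Path s (bd f).source) (y : Path (bd f).sink t) (hw : w = x.comp ((bd f).dom.comp y))
    (σ : Sweep bd (x.comp ((bd f).cod.comp y)) l w') :
    evalCell M (.cons f x y hw σ) =
      ((cell M f).whisker (ev φ x) (ev φ y)).comp (evalCell M σ)
        (id (ev_comp₃ φ x _ y).symm) := by
  subst hw
  refine (Cell₁.mk_eqToHom_comp _ _).trans ((Cell₁.mk_comp _ _).trans ?_)
  congr 1
  exact mk_whisker x (M f) y

lemma mapCell_cons {M M' : Cells φ bd} (θ : ∀ f, M f ⟶ M' f) {s t : V} {w w' : Path s t}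
    {l : List Φ} (f : Φ) (x : Path s (bd f).source) (y : Path (bd f).sink t)
    (hw : w = x.comp ((bd f).dom.comp y)) (σ : Sweep bd (x.comp ((bd f).cod.comp y)) l w') :
    mapCell θ (.cons f x y hw σ) =
      ((Cell₂.mk (θ f)).whisker (ev φ x) (ev φ y)).hcomp (mapCell θ σ)
        (id (ev_comp₃ φ x _ y).symm) := by
  subst hw
  refine (Cell₂.mk_whiskerLeft _ _).trans ?_
  simp only [Cell₁.mk_eqToHom]
  refine (Cell₂.one_hcomp _ _ _).trans ?_
  refine (Cell₂.mk_hcomp_mk _ _).symm.trans ?_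
  simp only [mk_whisker₃]
  rfl

lemma evalCell_append (M : Cells φ bd) {s t : V} {w w' w'' : Path s t} {l l' : List Φ}
    (σ : Sweep bd w l w') (ρ : Sweep bd w' l' w'') :
    evalCell M (σ.append ρ) = (evalCell M σ).comp (evalCell M ρ) (id rfl) :=
  congrArg Cell₁.mk (eval_append M σ ρ)

lemma mapCell_append {M M' : Cells φ bd} (θ : ∀ f, M f ⟶ M' f) {s t : V} {w w' w'' : Path s t}
    {l l' : List Φ} (σ : Sweep bd w l w') (ρ : Sweep bd w' l' w'') :
    mapCell θ (σ.append ρ) = (mapCell θ σ).hcomp (mapCell θ ρ) (id rfl) := by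
  induction σ with
  | nil w => exact (Cell₂.one_hcomp _ _ _).symm
  | cons f x y hw rest ih =>
    simp only [Sweep.append, mapCell_cons, ih]
    rw [Cell₂.hcomp_assoc]

/-- Face by face, by the middle-four interchange law. -/
lemma mapCell_vcomp {M M' M'' : Cells φ bd} (θ : ∀ f, M f ⟶ M' f) (θ' : ∀ f, M' f ⟶ M'' f)
    {s t : V} {w w' : Path s t} {l : List Φ} (σ : Sweep bd w l w') :
    (mapCell θ σ).vcomp (mapCell θ' σ) (id rfl) = mapCell (fun f => θ f ≫ θ' f) σ := by
  induction σ with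
  | nil w => exact Cell₂.one_vcomp (Cell₁.one (ev φ w)) _ rfl
  | cons f x y hw rest ih =>
    simp only [mapCell_cons, ← ih]
    have e := Cell₂.whisker_vcomp (ev φ x) (⟨θ f⟩ :
      Cell₂ (φ.obj (bd f).source ⟶ φ.obj (bd f).sink)) ⟨θ' f⟩ rfl (ev φ y)
    rw [Cell₂.vcomp_mk] at e
    simp only [e]
    exact (Cell₂.vcomp_hcomp_vcomp _ _ _ _ _ _ _ _ _ _).symm

/-- Sweeps along equal paths. -/
def Sweep.cast {s t : V} {w₁ w₂ w₁' w₂' : Path s t} {l : List Φ} (σ : Sweep bd w₁ l w₁')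
    (h : w₁ = w₂) (h' : w₁' = w₂') : Sweep bd w₂ l w₂' := h ▸ h' ▸ σ

@[simp] lemma evalCell_cast (M : Cells φ bd) {s t : V} {w₁ w₂ w₁' w₂' : Path s t} {l : List Φ}
    (σ : Sweep bd w₁ l w₁') (h : w₁ = w₂) (h' : w₁' = w₂') :
    evalCell M (σ.cast h h') = evalCell M σ := by
  subst h h'; rfl

@[simp] lemma mapCell_cast {M M' : Cells φ bd} (θ : ∀ f, M f ⟶ M' f) {s t : V}
    {w₁ w₂ w₁' w₂' : Path s t} {l : List Φ} (σ : Sweep bd w₁ l w₁') (h : w₁ = w₂)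
    (h' : w₁' = w₂') : mapCell θ (σ.cast h h') = mapCell θ σ := by
  subst h h'; rfl

end SweepCells
end GrayPasting

/-! ### 3-cells in a context, and interchanges within a sweep. -/

namespace GrayPasting

section Between
variable {B : Type*} [Bicategory B]

namespace Cell₂

lemma exists_hom {s t : B} {f g : s ⟶ t} {Θ : Cell₂ B} (h : Θ.src = ⟨f⟩) (h' : Θ.tgt = ⟨g⟩) :
    ∃ θ : f ⟶ g, mk θ = Θ := by
  obtain ⟨θ⟩ := Θ
  cases h
  cases h'
  exact ⟨θ, rfl⟩

lemma isIso_vcomp {Θ Ξ : Cell₂ B} (h : Θ.tgt = Ξ.src) (hΘ : IsIso Θ.hom) (hΞ : IsIso Ξ.hom) :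
    IsIso (Θ.vcomp Ξ h).hom := by
  obtain ⟨θ⟩ := Θ
  obtain ⟨ξ⟩ := Ξ
  cases h
  change IsIso (θ ≫ ξ)
  change IsIso θ at hΘ
  change IsIso ξ at hΞ
  infer_instance

lemma isIso_hcomp {Θ Ξ : Cell₂ B} (h : Θ.src.t = Ξ.src.s) (hΘ : IsIso Θ.hom)
    (hΞ : IsIso Ξ.hom) : IsIso (Θ.hcomp Ξ h).hom := by
  obtain @⟨_, _, f, f', θ⟩ := Θ
  obtain @⟨_, _, g, g', ξ⟩ := Ξ
  cases h
  change IsIso ((θ ▷ g) ≫ (f' ◁ ξ))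
  change IsIso θ at hΘ
  change IsIso ξ at hΞ
  infer_instance

lemma isIso_one (a : Cell₁ B) : IsIso (one a).hom := by
  change IsIso (𝟙 a.hom)
  infer_instance

/-- The horizontal composite of a 2-cell with 1-cells on both sides. -/
def between (a : Cell₁ B) (Θ : Cell₂ B) (b : Cell₁ B) (h : a.t = Θ.src.s) (h' : Θ.src.t = b.s) :
    Cell₂ B :=
  (one a).hcomp (Θ.hcomp (one b) (id h')) (id h)

@[simp] lemma between_src (a : Cell₁ B) (Θ : Cell₂ B) (b : Cell₁ B) (h : a.t = Θ.src.s)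
    (h' : Θ.src.t = b.s) :
    (between a Θ b h h').src = a.comp (Θ.src.comp b (id h')) (id h) := rfl

@[simp] lemma between_tgt (a : Cell₁ B) (Θ : Cell₂ B) (b : Cell₁ B) (h : a.t = Θ.src.s)
    (h' : Θ.src.t = b.s) :
    (between a Θ b h h').tgt = a.comp (Θ.tgt.comp b (id h')) (id h) := rfl

/-- The identities on both sides are doubled, and the middle-four interchange law is used once for
each side. -/
lemma between_vcomp (a : Cell₁ B) (Θ Ξ : Cell₂ B) (b : Cell₁ B) (e : Θ.tgt = Ξ.src)
    (h : a.t = Θ.src.s) (h' : Θ.src.t = b.s) :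
    between a (Θ.vcomp Ξ e) b (id (by simpa using h)) (id (by simpa using h')) =
      (between a Θ b h h').vcomp
        (between a Ξ b (id (h.trans (congrArg Cell₁.s e : Θ.tgt.s = _)))
          (id ((congrArg Cell₁.t e : Θ.tgt.t = _).symm.trans h')))
        (id (by simp [e])) := by
  obtain ⟨θ⟩ := Θ
  obtain ⟨ξ⟩ := Ξ
  cases e
  have h1 := vcomp_hcomp_vcomp ⟨θ⟩ ⟨ξ⟩ (one b) (one b) rfl rfl h' h' h' (id rfl)
  have h2 : (one b).vcomp (one b) (id rfl) = one b := one_vcomp _ _ _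
  have h3 : (one a).vcomp (one a) (id rfl) = one a := one_vcomp _ _ _
  have h4 := vcomp_hcomp_vcomp (one a) (one a) ((mk θ).hcomp (one b) h')
    ((mk ξ).hcomp (one b) h') rfl rfl h h h (id rfl)
  unfold between
  simp only [h3] at h4
  simp only [← h4]
  simp only [h2] at h1
  simp only [← h1]

lemma isIso_between (a : Cell₁ B) (Θ : Cell₂ B) (b : Cell₁ B) (h : a.t = Θ.src.s)
    (h' : Θ.src.t = b.s) (hΘ : IsIso Θ.hom) : IsIso (between a Θ b h h').hom :=
  isIso_hcomp _ (isIso_one a) (isIso_hcomp _ hΘ (isIso_one b))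

lemma one_comp (a b : Cell₁ B) (h : a.t = b.s) :
    one (a.comp b h) = (one a).hcomp (one b) (id h) := (one_hcomp_one a b h).symm

variable [Bicategory.Strict B]

/-- With `between_comp_right`, part of the context is moved next to the 3-cell. Interchanges at
different places of a sweep thereby get a common context, in which identities such as the hexagon
apply. -/
lemma between_comp_left (a a' : Cell₁ B) (Θ : Cell₂ B) (b : Cell₁ B) (h : a.t = a'.s)
    (h₁ : (a.comp a' h).t = Θ.src.s) (h₂ : Θ.src.t = b.s) :
    between (a.comp a' h) Θ b h₁ h₂ =
      between a ((one a').hcomp Θ (id h₁)) b (id h) (id h₂) := by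
  simp only [between, one_comp, hcomp_assoc]

lemma between_comp_right (a : Cell₁ B) (Θ : Cell₂ B) (b b' : Cell₁ B) (h : b.t = b'.s)
    (h₁ : a.t = Θ.src.s) (h₂ : Θ.src.t = (b.comp b' h).s) :
    between a Θ (b.comp b' h) h₁ h₂ =
      between a (Θ.hcomp (one b) (id h₂)) b' (id h₁) (id h) := by
  simp only [between, one_comp, hcomp_assoc]

/-- 2-cells at different places of a composite commute. -/
lemma between_comm (a : Cell₁ B) (Θ : Cell₂ B) (b : Cell₁ B) (Ξ : Cell₂ B) (c : Cell₁ B)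
    (h₁ : a.t = Θ.src.s) (h₂ : Θ.src.t = b.s) (h₃ : b.t = Ξ.src.s) (h₄ : Ξ.src.t = c.s) :
    (between a Θ (b.comp (Ξ.src.comp c (id h₄)) (id h₃)) h₁ (id h₂)).vcomp
      (between (a.comp (Θ.tgt.comp b (id h₂)) (id h₁)) Ξ c (id h₃) h₄)
      (id (by simp only [between_src, between_tgt, Cell₁.comp_assoc])) =
    (between (a.comp (Θ.src.comp b (id h₂)) (id h₁)) Ξ c (id h₃) h₄).vcomp
      (between a Θ (b.comp (Ξ.tgt.comp c (id h₄)) (id h₃)) h₁ (id h₂))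
      (id (by simp only [between_src, between_tgt, Cell₁.comp_assoc])) := by
  -- Both sides are the horizontal composite of `Θ`, `b` and `Ξ`, performed from the left and from
  -- the right; the outer context `a`, `c` is added by `between_vcomp`.
  have e := (hcomp_eq_vcomp Θ ((one b).hcomp Ξ (id h₃)) (id h₂)).symm.trans
    (hcomp_eq_vcomp' Θ ((one b).hcomp Ξ (id h₃)) (id h₂))
  simp only [between_comp_left, between_comp_right]
  have e2 := between_vcomp a (Θ.hcomp (one ((one b).hcomp Ξ (id h₃)).src) (id h₂))
    ((one Θ.tgt).hcomp ((one b).hcomp Ξ (id h₃)) (id h₂)) c (id (by simp)) (id h₁) (id h₄)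
  have e3 := between_vcomp a ((one Θ.src).hcomp ((one b).hcomp Ξ (id h₃)) (id h₂))
    (Θ.hcomp (one ((one b).hcomp Ξ (id h₃)).tgt) (id h₂)) c (id (by simp)) (id h₁) (id h₄)
  simp only [e] at e2
  have e4 := e2.symm.trans e3
  simp only [hcomp_src, hcomp_tgt, one_src, one_tgt, one_comp, hcomp_assoc] at e4 ⊢
  exact e4

end Cell₂
end Between

section
open GrayCategory
variable {𝒦 : Type*} [GrayCategory 𝒦] {X Y Z W : 𝒦}

lemma Cell₂.isIso_pre (f : X ⟶ Y) {Θ : Cell₂ (Y ⟶ Z)} (h : IsIso Θ.hom) :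
    IsIso (Θ.pre f).hom := by
  obtain ⟨θ⟩ := Θ
  change IsIso θ at h
  exact ⟨pre₃ f (inv θ),
    (pre₃_comp f θ (inv θ)).symm.trans ((congrArg (pre₃ f) (IsIso.hom_inv_id θ)).trans
      (pre₃_id f _)),
    (pre₃_comp f (inv θ) θ).symm.trans ((congrArg (pre₃ f) (IsIso.inv_hom_id θ)).trans
      (pre₃_id f _))⟩

lemma Cell₂.isIso_post {Θ : Cell₂ (X ⟶ Y)} (h : IsIso Θ.hom) (g : Y ⟶ Z) :
    IsIso (Θ.post g).hom := by
  obtain ⟨θ⟩ := Θ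
  change IsIso θ at h
  exact ⟨post₃ (inv θ) g,
    (post₃_comp θ (inv θ) g).symm.trans ((congrArg (post₃ · g) (IsIso.hom_inv_id θ)).trans
      (post₃_id _ g)),
    (post₃_comp (inv θ) θ g).symm.trans ((congrArg (post₃ · g) (IsIso.inv_hom_id θ)).trans
      (post₃_id _ g))⟩

/-- Invertibility of the interchanges makes it possible to compare two orders by way of a common
normal form. -/
lemma Cell₁.isIso_exch {A' B' : 𝒦} (x : W ⟶ X) (a : Cell₁ (X ⟶ A')) (m : A' ⟶ Y)
    (b : Cell₁ (Y ⟶ B')) (z : B' ⟶ Z) : IsIso (exch x a m b z).hom := by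
  refine Cell₂.isIso_pre _ (Cell₂.isIso_post ?_ _)
  change IsIso (GrayCategory.interchange _ _).hom
  infer_instance

end

section Sweeps
open Quiver

variable {V : Type*} [Quiver V] {Φ : Type*} {bd : Φ → Boundary V} {s t : V}

lemma Sweep.exists_append {l l' : List Φ} {w w' : Path s t} (σ : Sweep bd w (l ++ l') w') :
    ∃ (w₁ : Path s t) (σ₁ : Sweep bd w l w₁) (σ₂ : Sweep bd w₁ l' w'), σ = σ₁.append σ₂ := by
  induction l generalizing w with
  | nil => exact ⟨w, .nil w, σ, rfl⟩
  | cons f l ih =>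
    cases σ with
    | cons _ x y hw rest =>
      obtain ⟨w₁, σ₁, σ₂, h⟩ := ih rest
      exact ⟨w₁, .cons f x y hw σ₁, σ₂, by rw [Sweep.append, ← h]⟩

/-- Without directed cycles a path has a given segment at one place only, so each face of the list
determines the next path. -/
lemma Sweep.end_unique (hV : Acyclic V) {l : List Φ} {w w₁ w₂ : Path s t}
    (σ₁ : Sweep bd w l w₁) (σ₂ : Sweep bd w l w₂) : w₁ = w₂ := by
  induction l generalizing w with
  | nil => cases σ₁; cases σ₂; rfl
  | cons f l ih =>
    cases σ₁ with
    | cons _ x y hw r =>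
      cases σ₂ with
      | cons _ x' y' hw' r' =>
        obtain ⟨rfl, rfl⟩ := segment_unique hV (hw.symm.trans hw')
        exact ih r r'

variable {w w₁ w₂ w' : Path s t} {l l' : List Φ} {f g : Φ}

/-- A sweep through two faces with disjoint uppermost paths, the left one first. -/
def Sweep.leftFirst (σ : Sweep bd w l w₁) (x : Path s (bd f).source)
    (m : Path (bd f).sink (bd g).source) (z : Path (bd g).sink t) (ρ : Sweep bd w₂ l' w')
    (h₁ : w₁ = x.comp ((bd f).dom.comp (m.comp ((bd g).dom.comp z))))
    (h₂ : w₂ = x.comp ((bd f).cod.comp (m.comp ((bd g).cod.comp z)))) :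
    Sweep bd w (l ++ f :: g :: l') w' :=
  σ.append (.cons f x (m.comp ((bd g).dom.comp z)) h₁
    (.cons g (x.comp ((bd f).cod.comp m)) z (by simp) (ρ.cast (by simp [h₂]) rfl)))

/-- A sweep through two faces with disjoint uppermost paths, the right one first. -/
def Sweep.rightFirst (σ : Sweep bd w l w₁) (x : Path s (bd f).source)
    (m : Path (bd f).sink (bd g).source) (z : Path (bd g).sink t) (ρ : Sweep bd w₂ l' w')
    (h₁ : w₁ = x.comp ((bd f).dom.comp (m.comp ((bd g).dom.comp z))))
    (h₂ : w₂ = x.comp ((bd f).cod.comp (m.comp ((bd g).cod.comp z)))) :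
    Sweep bd w (l ++ g :: f :: l') w' :=
  σ.append (.cons g (x.comp ((bd f).dom.comp m)) z (by simp [h₁])
    (.cons f x (m.comp ((bd g).cod.comp z)) (by simp) (ρ.cast h₂ rfl)))

variable {𝒦 : Type*} [GrayCategory 𝒦] {φ : V ⥤q 𝒦} (M : Cells φ bd)

/-- The interchange of two faces within a sweep. -/
def swapCell (σ : Sweep bd w l w₁) (x : Path s (bd f).source)
    (m : Path (bd f).sink (bd g).source) (z : Path (bd g).sink t) (ρ : Sweep bd w₂ l' w')
    (h₁ : w₁ = x.comp ((bd f).dom.comp (m.comp ((bd g).dom.comp z))))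
    (h₂ : w₂ = x.comp ((bd f).cod.comp (m.comp ((bd g).cod.comp z)))) :
    Cell₂ (φ.obj s ⟶ φ.obj t) :=
  Cell₂.between (evalCell M σ)
    (Cell₁.exch (ev φ x) (cell M f) (ev φ m) (cell M g) (ev φ z)) (evalCell M ρ)
    (id (by simp [h₁, ev_comp])) (id (by simp [h₂, ev_comp]))

section
variable (σ : Sweep bd w l w₁) (x : Path s (bd f).source)
    (m : Path (bd f).sink (bd g).source) (z : Path (bd g).sink t) (ρ : Sweep bd w₂ l' w')
    (h₁ : w₁ = x.comp ((bd f).dom.comp (m.comp ((bd g).dom.comp z))))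
    (h₂ : w₂ = x.comp ((bd f).cod.comp (m.comp ((bd g).cod.comp z))))

lemma swapCell_src : (swapCell M σ x m z ρ h₁ h₂).src =
    evalCell M (σ.leftFirst x m z ρ h₁ h₂) := by
  simp [swapCell, Sweep.leftFirst, evalCell_append, evalCell_cons, Cell₁.comp_assoc, ev_comp]

lemma swapCell_tgt : (swapCell M σ x m z ρ h₁ h₂).tgt =
    evalCell M (σ.rightFirst x m z ρ h₁ h₂) := by
  simp [swapCell, Sweep.rightFirst, evalCell_append, evalCell_cons, Cell₁.comp_assoc, ev_comp]

lemma isIso_swapCell : IsIso (swapCell M σ x m z ρ h₁ h₂).hom :=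
  Cell₂.isIso_between _ _ _ _ _ (Cell₁.isIso_exch _ _ _ _ _)

end

/-- The passage between the two forms of an interchange: the 3-cell with transports which occurs in
`Composition.hom_swap`, and the bundled `swapCell` with which the rewriting argument works. -/
lemma mk_swap {x : Path s (bd f).source} {m : Path (bd f).sink (bd g).source}
    {z : Path (bd g).sink t}
    (σ : Sweep bd w l (x.comp ((bd f).dom.comp (m.comp ((bd g).dom.comp z)))))
    (ρ : Sweep bd (x.comp ((bd f).cod.comp (m.comp ((bd g).cod.comp z)))) l' w')
    {α β : ev φ w ⟶ ev φ w'}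
    (h : α = eval M σ ≫ GrayPasting.leftFirst x (M f) m (M g) z ≫ eval M ρ)
    (h' : eval M σ ≫ GrayPasting.rightFirst x (M f) m (M g) z ≫ eval M ρ = β) :
    Cell₂.mk (eqToHom h ≫ eval M σ ◁ exchange x (M f) m (M g) z ▷ eval M ρ ≫ eqToHom h') =
      swapCell M σ x m z ρ rfl rfl := by
  subst h h'
  refine (Cell₂.mk_eqToHom_comp _ _).trans ((Cell₂.mk_comp_eqToHom _ _).trans ?_)
  refine (Cell₂.mk_whiskerLeft _ _).trans ?_
  unfold swapCell Cell₂.between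
  congr 1
  refine (Cell₂.mk_whiskerRight _ _).trans ?_
  congr 1
  exact mk_exchange x (M f) m (M g) z

end Sweeps
end GrayPasting

namespace GrayPasting

section
variable {B : Type*} [Bicategory B]

namespace Cell₂

lemma between_hexagon (a b : Cell₁ B) {P₁ P₂ P₃ Q₁ Q₂ Q₃ : Cell₂ B} (h₁ : P₂.tgt = P₃.src)
    (h₂ : P₁.tgt = (P₂.vcomp P₃ h₁).src) (h₃ : Q₁.tgt = Q₂.src)
    (h₄ : (Q₁.vcomp Q₂ h₃).tgt = Q₃.src)
    (h : P₁.vcomp (P₂.vcomp P₃ h₁) h₂ = (Q₁.vcomp Q₂ h₃).vcomp Q₃ h₄)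
    (p₁ : a.t = P₁.src.s) (p₁' : P₁.src.t = b.s) (p₂ : a.t = P₂.src.s) (p₂' : P₂.src.t = b.s)
    (p₃ : a.t = P₃.src.s) (p₃' : P₃.src.t = b.s) (q₁ : a.t = Q₁.src.s) (q₁' : Q₁.src.t = b.s)
    (q₂ : a.t = Q₂.src.s) (q₂' : Q₂.src.t = b.s) (q₃ : a.t = Q₃.src.s) (q₃' : Q₃.src.t = b.s)
    (r₁ : (between a P₂ b p₂ p₂').tgt = (between a P₃ b p₃ p₃').src)
    (r₂ : (between a P₁ b p₁ p₁').tgt =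
      ((between a P₂ b p₂ p₂').vcomp (between a P₃ b p₃ p₃') r₁).src)
    (r₃ : (between a Q₂ b q₂ q₂').tgt = (between a Q₃ b q₃ q₃').src)
    (r₄ : (between a Q₁ b q₁ q₁').tgt =
      ((between a Q₂ b q₂ q₂').vcomp (between a Q₃ b q₃ q₃') r₃).src) :
    (between a P₁ b p₁ p₁').vcomp
        ((between a P₂ b p₂ p₂').vcomp (between a P₃ b p₃ p₃') r₁) r₂ =
      (between a Q₁ b q₁ q₁').vcomp
        ((between a Q₂ b q₂ q₂').vcomp (between a Q₃ b q₃ q₃') r₃) r₄ := by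
  rw [vcomp_assoc Q₁ Q₂ Q₃ h₃ (id (by simpa using h₄)) _ (id (by simpa using h₃))] at h
  have e₁ := between_vcomp a P₂ P₃ b h₁ p₂ p₂'
  have e₂ := between_vcomp a P₁ (P₂.vcomp P₃ h₁) b h₂ p₁ p₁'
  have e₃ := between_vcomp a Q₂ Q₃ b (id (by simpa using h₄)) q₂ q₂'
  have e₄ := between_vcomp a Q₁ (Q₂.vcomp Q₃ (id (by simpa using h₄))) b
    (id (by simpa using h₃)) q₁ q₁'
  simp only [e₁, e₃, h] at e₂ e₄
  exact e₂.symm.trans e₄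

end Cell₂
end

/-! ### Interchanges of faces as a rewriting system; local confluence. -/

section Rewriting
open Quiver

section
variable {V : Type*} [Quiver V] {Φ : Type*} {bd : Φ → Boundary V} {s t : V}
  {𝒦 : Type*} [GrayCategory 𝒦] {φ : V ⥤q 𝒦}

/-- A sweep extended by one face at its start. -/
def Sweep.cons' (f : Φ) (x : Path s (bd f).source) (y : Path (bd f).sink t)
    {w w₁ w' : Path s t} {l : List Φ} (h : w = x.comp ((bd f).dom.comp y))
    (h' : w₁ = x.comp ((bd f).cod.comp y)) (σ : Sweep bd w₁ l w') : Sweep bd w (f :: l) w' :=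
  .cons f x y h (σ.cast h' rfl)

/-- The sweep through one face. -/
def Sweep.single (f : Φ) (x : Path s (bd f).source) (y : Path (bd f).sink t)
    {w w₁ : Path s t} (h : w = x.comp ((bd f).dom.comp y))
    (h' : w₁ = x.comp ((bd f).cod.comp y)) : Sweep bd w [f] w₁ :=
  .cons' f x y h h' (.nil _)

lemma evalCell_cons' (M : Cells φ bd) (f : Φ) (x : Path s (bd f).source)
    (y : Path (bd f).sink t) {w w₁ w' : Path s t} {l : List Φ}
    (h : w = x.comp ((bd f).dom.comp y)) (h' : w₁ = x.comp ((bd f).cod.comp y))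
    (σ : Sweep bd w₁ l w') : evalCell M (.cons' f x y h h' σ) =
      ((cell M f).whisker (ev φ x) (ev φ y)).comp (evalCell M σ)
        (id (by subst h'; exact (ev_comp₃ φ x _ y).symm)) := by
  subst h'
  exact evalCell_cons M f x y h σ

lemma mapCell_cons' {M M' : Cells φ bd} (θ : ∀ f, M f ⟶ M' f) (f : Φ) (x : Path s (bd f).source)
    (y : Path (bd f).sink t) {w w₁ w' : Path s t} {l : List Φ}
    (h : w = x.comp ((bd f).dom.comp y)) (h' : w₁ = x.comp ((bd f).cod.comp y))
    (σ : Sweep bd w₁ l w') : mapCell θ (.cons' f x y h h' σ) =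
      ((Cell₂.mk (θ f)).whisker (ev φ x) (ev φ y)).hcomp (mapCell θ σ)
        (id (by subst h'; exact (ev_comp₃ φ x _ y).symm)) := by
  subst h'
  exact mapCell_cons θ f x y h σ

lemma evalCell_single (M : Cells φ bd) (f : Φ) (x : Path s (bd f).source)
    (y : Path (bd f).sink t) {w w₁ : Path s t}
    (h : w = x.comp ((bd f).dom.comp y)) (h' : w₁ = x.comp ((bd f).cod.comp y)) :
    evalCell M (.single f x y h h') = (cell M f).whisker (ev φ x) (ev φ y) :=
  (evalCell_cons' M f x y h h' _).trans (Cell₁.comp_one _ _ _)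

end

variable {V : Type*} [Quiver V] {Φ : Type*} {bd : Φ → Boundary V} {s t : V}
  {𝒦 : Type*} [GrayCategory 𝒦] {φ : V ⥤q 𝒦} (M : Cells φ bd) (w w' : Path s t)

/-- The interchange of two consecutive faces, the first of which is on the left. -/
def Step (k k' : List Φ) (Θ : Cell₂ (φ.obj s ⟶ φ.obj t)) : Prop :=
  ∃ (l r : List Φ) (f g : Φ) (w₁ w₂ : Path s t) (σ : Sweep bd w l w₁)
    (x : Path s (bd f).source) (m : Path (bd f).sink (bd g).source) (z : Path (bd g).sink t)
    (ρ : Sweep bd w₂ r w')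
    (h₁ : w₁ = x.comp ((bd f).dom.comp (m.comp ((bd g).dom.comp z))))
    (h₂ : w₂ = x.comp ((bd f).cod.comp (m.comp ((bd g).cod.comp z)))),
    k = l ++ f :: g :: r ∧ k' = l ++ g :: f :: r ∧ Θ = swapCell M σ x m z ρ h₁ h₂

/-- Composites of interchanges of consecutive faces. -/
inductive Reach : List Φ → List Φ → Cell₂ (φ.obj s ⟶ φ.obj t) → Prop
  | refl {k : List Φ} (σ : Sweep bd w k w') : Reach k k (Cell₂.one (evalCell M σ))
  | cons {k k' k'' : List Φ} {Θ Ξ : Cell₂ (φ.obj s ⟶ φ.obj t)} (h : Step M w w' k k' Θ)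
    (r : Reach k' k'' Ξ) (e : Θ.tgt = Ξ.src) : Reach k k'' (Θ.vcomp Ξ e)

variable {M w w'} {k k' k'' : List Φ} {Θ Ξ : Cell₂ (φ.obj s ⟶ φ.obj t)}

/-- A composite depends only on the list of faces, since the list has at most one sweep between two
given paths. Hence the 3-cells of two steps are composable as soon as the lists match. -/
lemma evalCell_congr (hV : Acyclic V) {k k' : List Φ} (h : k = k') (σ : Sweep bd w k w')
    (σ' : Sweep bd w k' w') : evalCell M σ = evalCell M σ' := by
  subst h
  rw [sweep_subsingleton hV _ σ σ']

lemma Step.src (h : Step M w w' k k' Θ) (hV : Acyclic V) (σ : Sweep bd w k w') :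
    Θ.src = evalCell M σ := by
  obtain ⟨l, r, f, g, w₁, w₂, σ, x, m, z, ρ, h₁, h₂, rfl, rfl, rfl⟩ := h
  rw [swapCell_src]
  exact evalCell_congr hV rfl _ _

lemma Step.tgt (h : Step M w w' k k' Θ) (hV : Acyclic V) (σ : Sweep bd w k' w') :
    Θ.tgt = evalCell M σ := by
  obtain ⟨l, r, f, g, w₁, w₂, σ, x, m, z, ρ, h₁, h₂, rfl, rfl, rfl⟩ := h
  rw [swapCell_tgt]
  exact evalCell_congr hV rfl _ _

lemma Step.sweep (h : Step M w w' k k' Θ) :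
    Nonempty (Sweep bd w k w') ∧ Nonempty (Sweep bd w k' w') := by
  obtain ⟨l, r, f, g, w₁, w₂, σ, x, m, z, ρ, h₁, h₂, rfl, rfl, rfl⟩ := h
  exact ⟨⟨σ.leftFirst x m z ρ h₁ h₂⟩, ⟨σ.rightFirst x m z ρ h₁ h₂⟩⟩

lemma Step.isIso (h : Step M w w' k k' Θ) : IsIso Θ.hom := by
  obtain ⟨l, r, f, g, w₁, w₂, σ, x, m, z, ρ, h₁, h₂, rfl, rfl, rfl⟩ := h
  exact isIso_swapCell M σ x m z ρ h₁ h₂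

lemma Reach.sweep (h : Reach M w w' k k' Θ) :
    Nonempty (Sweep bd w k w') ∧ Nonempty (Sweep bd w k' w') := by
  induction h with
  | refl σ => exact ⟨⟨σ⟩, ⟨σ⟩⟩
  | cons h r e ih => exact ⟨h.sweep.1, ih.2⟩

lemma Reach.src (h : Reach M w w' k k' Θ) (hV : Acyclic V) (σ : Sweep bd w k w') :
    Θ.src = evalCell M σ := by
  cases h with
  | refl σ' => exact evalCell_congr hV rfl _ _
  | cons h r e => rw [Cell₂.vcomp_src, h.src hV]

lemma Reach.tgt (h : Reach M w w' k k' Θ) (hV : Acyclic V) (σ : Sweep bd w k' w') :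
    Θ.tgt = evalCell M σ := by
  induction h with
  | refl σ' => exact evalCell_congr hV rfl _ _
  | cons h r e ih => rw [Cell₂.vcomp_tgt, ih σ]

lemma Reach.isIso (h : Reach M w w' k k' Θ) : IsIso Θ.hom := by
  induction h with
  | refl σ' => exact Cell₂.isIso_one _
  | cons h r e ih => exact Cell₂.isIso_vcomp e h.isIso ih

lemma Reach.trans (h : Reach M w w' k k' Θ) (h' : Reach M w w' k' k'' Ξ) (e : Θ.tgt = Ξ.src) :
    Reach M w w' k k'' (Θ.vcomp Ξ e) := by
  induction h with
  | refl σ => rwa [Cell₂.one_vcomp]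
  | cons h r e' ih =>
    rw [Cell₂.vcomp_assoc _ _ _ _ (id (by simpa using e)) _ (id (by simpa using e'))]
    exact .cons h (ih h' _) _

lemma Step.reach (h : Step M w w' k k' Θ) (hV : Acyclic V) : Reach M w w' k k' Θ := by
  obtain ⟨σ⟩ := h.sweep.2
  have h' := Reach.cons h (.refl σ) (id (h.tgt hV σ))
  rwa [Cell₂.vcomp_one] at h'

lemma Step.reach_two (h : Step M w w' k k' Θ) (h' : Step M w w' k' k'' Ξ) (hV : Acyclic V)
    (e : Θ.tgt = Ξ.src) : Reach M w w' k k'' (Θ.vcomp Ξ e) :=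
  .cons h (h'.reach hV) e

variable (M w w') in
/-- Two interchanges which can be completed to a commutative diagram. -/
def Join (k₁ k₂ : List Φ) (Θ₁ Θ₂ : Cell₂ (φ.obj s ⟶ φ.obj t)) : Prop :=
  ∃ (k₃ : List Φ) (Ξ₁ Ξ₂ : Cell₂ (φ.obj s ⟶ φ.obj t)) (h₁ : Θ₁.tgt = Ξ₁.src)
    (h₂ : Θ₂.tgt = Ξ₂.src), Reach M w w' k₁ k₃ Ξ₁ ∧ Reach M w w' k₂ k₃ Ξ₂ ∧
      Θ₁.vcomp Ξ₁ h₁ = Θ₂.vcomp Ξ₂ h₂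

lemma Join.symm {k₁ k₂ : List Φ} {Θ₁ Θ₂ : Cell₂ (φ.obj s ⟶ φ.obj t)}
    (h : Join M w w' k₁ k₂ Θ₁ Θ₂) : Join M w w' k₂ k₁ Θ₂ Θ₁ := by
  obtain ⟨k₃, Ξ₁, Ξ₂, h₁, h₂, r₁, r₂, e⟩ := h
  exact ⟨k₃, Ξ₂, Ξ₁, h₂, h₁, r₂, r₁, e.symm⟩

section
variable {l l' r : List Φ} {f g h : Φ} {w₁ w₂ : Path s t}

lemma step_swapCell (σ : Sweep bd w l w₁)
    (x : Path s (bd f).source) (m : Path (bd f).sink (bd g).source) (z : Path (bd g).sink t)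
    (ρ : Sweep bd w₂ r w')
    (h₁ : w₁ = x.comp ((bd f).dom.comp (m.comp ((bd g).dom.comp z))))
    (h₂ : w₂ = x.comp ((bd f).cod.comp (m.comp ((bd g).cod.comp z))))
    (hk : k = l ++ f :: g :: r) (hk' : k' = l ++ g :: f :: r) :
    Step M w w' k k' (swapCell M σ x m z ρ h₁ h₂) :=
  ⟨l, r, f, g, w₁, w₂, σ, x, m, z, ρ, h₁, h₂, hk, hk', rfl⟩

lemma evalCell_leftFirst (σ : Sweep bd w l w₁)
    (x : Path s (bd f).source) (m : Path (bd f).sink (bd g).source) (z : Path (bd g).sink t)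
    (ρ : Sweep bd w₂ r w')
    (h₁ : w₁ = x.comp ((bd f).dom.comp (m.comp ((bd g).dom.comp z))))
    (h₂ : w₂ = x.comp ((bd f).cod.comp (m.comp ((bd g).cod.comp z)))) :
    evalCell M (σ.leftFirst x m z ρ h₁ h₂) = (evalCell M σ).comp
      ((Cell₁.exch (ev φ x) (cell M f) (ev φ m) (cell M g) (ev φ z)).src.comp (evalCell M ρ)
        (id (by simp [h₂, ev_comp]))) (id (by simp [h₁, ev_comp])) :=
  (swapCell_src M σ x m z ρ h₁ h₂).symm

lemma evalCell_rightFirst (σ : Sweep bd w l w₁)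
    (x : Path s (bd f).source) (m : Path (bd f).sink (bd g).source) (z : Path (bd g).sink t)
    (ρ : Sweep bd w₂ r w')
    (h₁ : w₁ = x.comp ((bd f).dom.comp (m.comp ((bd g).dom.comp z))))
    (h₂ : w₂ = x.comp ((bd f).cod.comp (m.comp ((bd g).cod.comp z)))) :
    evalCell M (σ.rightFirst x m z ρ h₁ h₂) = (evalCell M σ).comp
      ((Cell₁.exch (ev φ x) (cell M f) (ev φ m) (cell M g) (ev φ z)).tgt.comp (evalCell M ρ)
        (id (by simp [h₂, ev_comp]))) (id (by simp [h₁, ev_comp])) :=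
  (swapCell_tgt M σ x m z ρ h₁ h₂).symm

/-- The critical pair: `f`, `g`, `h` lie on a path from left to right and are performed in this
order; either `f`, `g` or `g`, `h` are interchanged. In both cases two more steps lead to the order
`h`, `g`, `f`, and the hexagon identifies the 3-cells. -/
lemma join_overlap (hV : Acyclic V) (σ : Sweep bd w l w₁) (x : Path s (bd f).source)
    (m : Path (bd f).sink (bd g).source) (m' : Path (bd g).sink (bd h).source)
    (z : Path (bd h).sink t) (ρ : Sweep bd w₂ r w')
    (h₁ : w₁ = x.comp ((bd f).dom.comp (m.comp ((bd g).dom.comp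
      (m'.comp ((bd h).dom.comp z))))))
    (h₂ : w₂ = x.comp ((bd f).cod.comp (m.comp ((bd g).cod.comp
      (m'.comp ((bd h).cod.comp z)))))) :
    Join M w w' (l ++ g :: f :: h :: r) (l ++ f :: h :: g :: r)
      (swapCell M σ x m (m'.comp ((bd h).dom.comp z))
        (.cons' h (x.comp ((bd f).cod.comp (m.comp ((bd g).cod.comp m')))) z rfl
          (id (by simp [h₂])) ρ) h₁ (id (by simp)))
      (swapCell M (σ.append (.single f x (m.comp ((bd g).dom.comp
        (m'.comp ((bd h).dom.comp z)))) h₁ rfl)) (x.comp ((bd f).cod.comp m)) m' z ρ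
        (id (by simp)) (id (by simp [h₂]))) := by
  -- `P₂` and `P₃` continue with `g f h`, `g h f`, `h g f`; `Q₂` and `Q₃` continue with `f h g`, `h
  -- f g`, `h g f`.
  have P₂ := step_swapCell (M := M) (k := l ++ g :: f :: h :: r) (k' := l ++ g :: h :: f :: r)
    (σ.append (.single g (x.comp ((bd f).dom.comp m)) (m'.comp ((bd h).dom.comp z))
      (id (by simp [h₁])) rfl)) x (m.comp ((bd g).cod.comp m')) z ρ (id (by simp))
      (id (by simp [h₂])) (id (by simp)) (id (by simp))
  have P₃ := step_swapCell (M := M) (k := l ++ g :: h :: f :: r) (k' := l ++ h :: g :: f :: r)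
    σ (x.comp ((bd f).dom.comp m)) m' z
    (.cons' f x (m.comp ((bd g).cod.comp (m'.comp ((bd h).cod.comp z)))) rfl h₂ ρ)
    (id (by simp [h₁])) (id (by simp)) (id (by simp)) (id (by simp))
  have Q₂ := step_swapCell (M := M) (k := l ++ f :: h :: g :: r) (k' := l ++ h :: f :: g :: r)
    σ x (m.comp ((bd g).dom.comp m')) z
    (.cons' g (x.comp ((bd f).cod.comp m)) (m'.comp ((bd h).cod.comp z)) rfl
      (id (by simp [h₂])) ρ) (id (by simp [h₁])) (id (by simp)) (id (by simp)) (id (by simp))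
  have Q₃ := step_swapCell (M := M) (k := l ++ h :: f :: g :: r) (k' := l ++ h :: g :: f :: r)
    (σ.append (.single h (x.comp ((bd f).dom.comp (m.comp ((bd g).dom.comp m')))) z
      (id (by simp [h₁])) rfl)) x m (m'.comp ((bd h).cod.comp z)) ρ (id (by simp))
      (id (by simp [h₂])) (id (by simp)) (id (by simp))
  have eP := (P₂.tgt hV P₃.sweep.1.some).trans (P₃.src hV _).symm
  have eQ := (Q₂.tgt hV Q₃.sweep.1.some).trans (Q₃.src hV _).symm
  refine ⟨_, _, _, id ?_, id ?_, P₂.reach_two P₃ hV (id eP), Q₂.reach_two Q₃ hV (id eQ), ?_⟩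
  · rw [Cell₂.vcomp_src, P₂.src hV P₂.sweep.1.some, swapCell_tgt]
    exact evalCell_congr hV rfl _ _
  · rw [Cell₂.vcomp_src, Q₂.src hV Q₂.sweep.1.some, swapCell_tgt]
    exact evalCell_congr hV (by simp) _ _
  have hex := Cell₁.hexagon (ev φ x) (cell M f) (ev φ m) (cell M g) (ev φ m') (cell M h) (ev φ z)
  -- All six interchanges are written in the common context consisting of the composites along `σ`
  -- and `ρ`.
  simp only [swapCell, evalCell_append, evalCell_cons', evalCell_single, ev_comp,
    Cell₂.between_comp_left, Cell₂.between_comp_right]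
  simp only [cell_s, cell_t] at hex
  exact Cell₂.between_hexagon _ _ _ _ _ _ hex _ _ _ _ _ _ _ _ _ _ _ _ _ _ _ _

/-- The two interchanges act at different places of the composite, with the sweep `τ` between them,
and commute by `Cell₂.between_comm`. -/
lemma join_disjoint (hV : Acyclic V) {l l' r : List Φ} {f g f' g' : Φ} {w₁ w₂ w₃ w₄ : Path s t}
    (σ : Sweep bd w l w₁) (x : Path s (bd f).source) (m : Path (bd f).sink (bd g).source)
    (z : Path (bd g).sink t) (τ : Sweep bd w₂ l' w₃) (x' : Path s (bd f').source)
    (m' : Path (bd f').sink (bd g').source) (z' : Path (bd g').sink t) (ρ : Sweep bd w₄ r w')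
    (h₁ : w₁ = x.comp ((bd f).dom.comp (m.comp ((bd g).dom.comp z))))
    (h₂ : w₂ = x.comp ((bd f).cod.comp (m.comp ((bd g).cod.comp z))))
    (h₃ : w₃ = x'.comp ((bd f').dom.comp (m'.comp ((bd g').dom.comp z'))))
    (h₄ : w₄ = x'.comp ((bd f').cod.comp (m'.comp ((bd g').cod.comp z')))) :
    Join M w w' (l ++ g :: f :: (l' ++ f' :: g' :: r)) ((l ++ f :: g :: l') ++ g' :: f' :: r)
      (swapCell M σ x m z (τ.leftFirst x' m' z' ρ h₃ h₄) h₁ h₂)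
      (swapCell M (σ.leftFirst x m z τ h₁ h₂) x' m' z' ρ h₃ h₄) := by
  have P₂ := step_swapCell (M := M) (k := l ++ g :: f :: (l' ++ f' :: g' :: r))
    (k' := l ++ g :: f :: (l' ++ g' :: f' :: r))
    (σ.rightFirst x m z τ h₁ h₂) x' m' z' ρ h₃ h₄ (id (by simp)) (id (by simp))
  have Q₂ := step_swapCell (M := M) (k := (l ++ f :: g :: l') ++ g' :: f' :: r)
    (k' := l ++ g :: f :: (l' ++ g' :: f' :: r))
    σ x m z (τ.rightFirst x' m' z' ρ h₃ h₄) h₁ h₂ (id (by simp)) (id (by simp))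
  refine ⟨_, _, _, id ?_, id ?_, P₂.reach hV, Q₂.reach hV, ?_⟩
  · rw [P₂.src hV P₂.sweep.1.some, swapCell_tgt]
    exact evalCell_congr hV rfl _ _
  · rw [Q₂.src hV Q₂.sweep.1.some, swapCell_tgt]
    exact evalCell_congr hV (by simp) _ _
  have h := Cell₂.between_comm (evalCell M σ)
    (Cell₁.exch (ev φ x) (cell M f) (ev φ m) (cell M g) (ev φ z)) (evalCell M τ)
    (Cell₁.exch (ev φ x') (cell M f') (ev φ m') (cell M g') (ev φ z')) (evalCell M ρ)
    (id (by simp [h₁, ev_comp])) (id (by simp [h₂, ev_comp])) (id (by simp [h₃, ev_comp]))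
    (id (by simp [h₄, ev_comp]))
  simp only [swapCell, evalCell_leftFirst, evalCell_rightFirst]
  exact h

end

/-- The list determines the paths reached by the sweeps, and uniqueness of segments determines `x`,
`m` and `z`. So the 3-cell of a step depends only on the interchanged positions. -/
lemma swapCell_unique (hV : Acyclic V) {l r : List Φ} {f g : Φ} {w₁ w₂ w₁' w₂' : Path s t}
    {σ : Sweep bd w l w₁} {x : Path s (bd f).source} {m : Path (bd f).sink (bd g).source}
    {z : Path (bd g).sink t} {ρ : Sweep bd w₂ r w'} {σ' : Sweep bd w l w₁'}
    {x' : Path s (bd f).source} {m' : Path (bd f).sink (bd g).source}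
    {z' : Path (bd g).sink t} {ρ' : Sweep bd w₂' r w'}
    {h₁ : w₁ = x.comp ((bd f).dom.comp (m.comp ((bd g).dom.comp z)))}
    {h₂ : w₂ = x.comp ((bd f).cod.comp (m.comp ((bd g).cod.comp z)))}
    {h₁' : w₁' = x'.comp ((bd f).dom.comp (m'.comp ((bd g).dom.comp z')))}
    {h₂' : w₂' = x'.comp ((bd f).cod.comp (m'.comp ((bd g).cod.comp z')))} :
    swapCell M σ x m z ρ h₁ h₂ = swapCell M σ' x' m' z' ρ' h₁' h₂' := by
  obtain rfl := Sweep.end_unique hV σ σ'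
  obtain rfl := sweep_subsingleton hV _ σ σ'
  obtain ⟨rfl, h⟩ := segment_unique hV (h₁.symm.trans h₁')
  obtain ⟨rfl, rfl⟩ := segment_unique hV h
  subst h₂
  subst h₂'
  obtain rfl := sweep_subsingleton hV _ ρ ρ'
  rfl

/-- The relative positions of two pairs of neighbours, the second not before the first: equal,
overlapping in one element, disjoint. Each gives one case of local confluence. -/
lemma append_pair_eq {l l' r r' : List Φ} {f g f' g' : Φ}
    (h : l ++ f :: g :: r = l' ++ f' :: g' :: r') (hl : l.length ≤ l'.length) :
    (l = l' ∧ f = f' ∧ g = g' ∧ r = r') ∨ (l' = l ++ [f] ∧ g = f' ∧ r = g' :: r') ∨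
      ∃ l'', l' = l ++ f :: g :: l'' ∧ r = l'' ++ f' :: g' :: r' := by
  induction l generalizing l' with
  | nil =>
    rcases l' with _ | ⟨a, _ | ⟨b, l''⟩⟩
    · simp at h; simp [h]
    · simp at h; simp [h]
    · simp at h; simp [h]
  | cons a l ih =>
    rcases l' with _ | ⟨b, l'⟩
    · simp at hl
    · simp only [List.cons_append, List.cons.injEq] at h
      obtain ⟨rfl, h⟩ := h
      rcases ih h (by simpa using hl) with h | h | ⟨l'', h, h'⟩
      · simp [h]
      · simp [h]
      · exact Or.inr (Or.inr ⟨l'', by simp [h], h'⟩)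

lemma Step.join (hV : Acyclic V) {k₁ k₂ : List Φ}
    (h : Step M w w' k k₁ Θ) (h' : Step M w w' k k₂ Ξ) : Join M w w' k₁ k₂ Θ Ξ := by
  obtain ⟨l, r, f, g, w₁, w₂, σ, x, m, z, ρ, h₁, h₂, rfl, rfl, rfl⟩ := h
  obtain ⟨l', r', f', g', w₁', w₂', σ', x', m', z', ρ', h₁', h₂', hk, rfl, rfl⟩ := h'
  wlog hl : l.length ≤ l'.length generalizing l r f g l' r' f' g' w₁ w₂ w₁' w₂'
  · exact (this l' r' f' g' w₁' w₂' σ' x' m' z' ρ' h₁' h₂' l r f g w₁ w₂ σ x m z ρ h₁ h₂ hk.symm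
      (by omega)).symm
  rcases append_pair_eq hk hl with ⟨rfl, rfl, rfl, rfl⟩ | ⟨rfl, rfl, rfl⟩ | ⟨l'', rfl, rfl⟩
  -- Equal positions: both steps are the same, and the identity completes the diagram.
  · have e : swapCell M σ x m z ρ h₁ h₂ = swapCell M σ' x' m' z' ρ' h₁' h₂' :=
      swapCell_unique hV
    rw [← e]
    let τ := σ.rightFirst x m z ρ h₁ h₂
    have e' : (swapCell M σ x m z ρ h₁ h₂).tgt = (Cell₂.one (evalCell M τ)).src :=
      swapCell_tgt _ _ _ _ _ _ _ _
    exact ⟨_, _, _, e', e', .refl τ, .refl τ, rfl⟩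
  -- Overlapping positions: `σ'` consists of `σ` and the face `f`. By uniqueness of segments `f` is
  -- swept at `x`, and the place of `g` is the same in both steps; so `f`, `g`, `g'` lie side by
  -- side on the path after `σ`.
  · obtain ⟨_, σ₁, σ₂, hσ⟩ := σ'.exists_append
    obtain rfl := Sweep.end_unique hV σ σ₁
    obtain rfl := sweep_subsingleton hV _ σ σ₁
    cases σ₂ with
    | cons _ x'' y hw rest =>
      cases rest
      obtain ⟨rfl, rfl⟩ := segment_unique hV (h₁.symm.trans hw)
      obtain ⟨rfl, rfl⟩ : x' = x.comp ((bd f).cod.comp m) ∧ z = m'.comp ((bd g').dom.comp z') := by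
        refine (segment_unique hV (p := (bd g).dom) ?_).imp_left Eq.symm
        simpa using h₁'
      have h := join_overlap (M := M) (w := w) (w' := w') hV σ x m m' z' ρ' h₁
        (id (by simp [h₂']))
      rw [swapCell_unique hV (σ' := σ) (ρ' := ρ) (h₁' := h₁) (h₂' := h₂),
        swapCell_unique hV (σ' := σ') (ρ' := ρ') (h₁' := h₁') (h₂' := h₂')] at h
      simpa using h
  · obtain ⟨_, σ₁, σ₂, hσ⟩ := σ'.exists_append
    obtain rfl := Sweep.end_unique hV σ σ₁
    obtain rfl := sweep_subsingleton hV _ σ σ₁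
    -- Disjoint positions: once `f` and `g` have been removed from the remainder of `σ'`, a sweep
    -- through the faces between the two positions is left.
    obtain ⟨τ⟩ : Nonempty (Sweep bd w₂ l'' w₁') := by
      cases σ₂ with
      | cons _ x₁ y hw rest =>
        obtain ⟨rfl, rfl⟩ := segment_unique hV (h₁.symm.trans hw)
        cases rest with
        | cons _ x₂ y₂ hw₂ rest =>
          obtain ⟨rfl, rfl⟩ : x₂ = x.comp ((bd f).cod.comp m) ∧ y₂ = z := by
            refine segment_unique hV (p := (bd g).dom) ?_
            simpa using hw₂.symm
          exact ⟨rest.cast (id (by simp [h₂])) rfl⟩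
    have h := join_disjoint (M := M) (w := w) (w' := w') hV σ x m z τ x' m' z' ρ' h₁ h₂ h₁' h₂'
    rw [swapCell_unique hV (σ' := σ) (ρ' := ρ) (h₁' := h₁) (h₂' := h₂),
      swapCell_unique hV (σ' := σ') (ρ' := ρ') (h₁' := h₁') (h₂' := h₂')] at h
    exact h

/-! ### Termination and uniqueness of normal forms. -/

section Termination
open Classical

/-- The number of pairs of faces in a list the first of which is on the left of the second. -/
noncomputable def inversions (bd : Φ → Boundary V) : List Φ → ℕ
  | [] => 0
  | f :: l => l.countP (fun g => Nonempty (Path (bd f).sink (bd g).source)) + inversions bd l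

lemma inversions_swap (hV : Acyclic V) (hne : ∀ f, (bd f).source ≠ (bd f).sink) {f g : Φ}
    (m : Path (bd f).sink (bd g).source) (l r : List Φ) :
    inversions bd (l ++ g :: f :: r) < inversions bd (l ++ f :: g :: r) := by
  induction l with
  | nil =>
    -- A path back from `g` to `f` would close a directed cycle containing the nonempty path `(bd
    -- f).dom`. So the pair counts in the old order only.
    have h : ¬ Nonempty (Path (bd g).sink (bd f).source) := by
      rintro ⟨p⟩
      have h1 := congrArg Path.length (hV _ ((bd f).dom.comp (m.comp ((bd g).dom.comp p))))
      simp only [Path.length_comp, Path.length_nil] at h1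
      exact hne f ((bd f).dom.eq_of_length_zero (by omega))
    have h' : Nonempty (Path (bd f).sink (bd g).source) := ⟨m⟩
    simp only [List.nil_append, inversions, List.countP_cons, h, h', decide_true, decide_false]
    simp
    omega
  | cons a l ih =>
    -- The contribution of an earlier face depends on the later faces only up to permutation.
    have h : (l ++ g :: f :: r).Perm (l ++ f :: g :: r) := (List.Perm.swap _ _ _).append_left l
    simp only [List.cons_append, inversions, h.countP_eq]
    omega

lemma Step.inversions_lt (hV : Acyclic V) (hne : ∀ f, (bd f).source ≠ (bd f).sink)
    (h : Step M w w' k k' Θ) : inversions bd k' < inversions bd k := by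
  obtain ⟨l, r, f, g, w₁, w₂, σ, x, m, z, ρ, h₁, h₂, rfl, rfl, rfl⟩ := h
  exact inversions_swap hV hne m l r

end Termination

variable (M w w') in
/-- No further interchange is possible. -/
def IsNormal (k : List Φ) : Prop := ∀ k' Θ, ¬ Step M w w' k k' Θ

lemma exists_normal (hV : Acyclic V) (hne : ∀ f, (bd f).source ≠ (bd f).sink)
    (σ : Sweep bd w k w') : ∃ n Θ, Reach M w w' k n Θ ∧ IsNormal M w w' n := by
  induction hn : inversions bd k using Nat.strong_induction_on generalizing k with
  | _ N ih =>
    by_cases h : IsNormal M w w' k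
    · exact ⟨k, _, .refl σ, h⟩
    · simp only [IsNormal, not_forall, not_not] at h
      obtain ⟨k', Θ, h⟩ := h
      obtain ⟨τ⟩ := h.sweep.2
      obtain ⟨n, Ξ, r, hn'⟩ := ih _ (hn ▸ h.inversions_lt hV hne) τ rfl
      exact ⟨n, _, .cons h r ((h.tgt hV τ).trans (r.src hV τ).symm), hn'⟩

/-- All composites of interchanges leading to orders without further interchanges agree. -/
lemma Reach.unique (hV : Acyclic V) (hne : ∀ f, (bd f).source ≠ (bd f).sink) {n n' : List Φ}
    (r : Reach M w w' k n Θ) (r' : Reach M w w' k n' Ξ) (hn : IsNormal M w w' n)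
    (hn' : IsNormal M w w' n') : n = n' ∧ Θ = Ξ := by
  induction hN : inversions bd k using Nat.strong_induction_on generalizing k Θ Ξ n n' with
  | _ N ih =>
    cases r with
    | refl σ =>
      cases r' with
      | refl σ' =>
        obtain rfl := sweep_subsingleton hV _ σ σ'
        exact ⟨rfl, rfl⟩
      | cons h _ _ => exact (hn _ _ h).elim
    | cons h r e =>
      cases r' with
      | refl σ' => exact (hn' _ _ h).elim
      | cons h' r' e' =>
        -- Newman's argument: the two first steps are joined at `k₃`, which is continued to a normal
        -- form `n₃`. The induction hypothesis for each successor of `k` identifies the given normal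
        -- form and 3-cell with those through `k₃`.
        obtain ⟨k₃, Ξ₁, Ξ₂, h₁, h₂, r₁, r₂, e₃⟩ := h.join hV h'
        obtain ⟨τ⟩ := r₁.sweep.2
        obtain ⟨n₃, Ψ, r₃, hn₃⟩ := exists_normal (M := M) hV hne τ
        have e₁ := (r₁.tgt hV τ).trans (r₃.src hV τ).symm
        have e₂ := (r₂.tgt hV τ).trans (r₃.src hV τ).symm
        obtain ⟨rfl, rfl⟩ := ih _ (hN ▸ h.inversions_lt hV hne) r (r₁.trans r₃ e₁) hn hn₃ rfl
        obtain ⟨rfl, rfl⟩ := ih _ (hN ▸ h'.inversions_lt hV hne) r' (r₂.trans r₃ e₂) hn' hn₃ rfl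
        refine ⟨rfl, ?_⟩
        rw [← Cell₂.vcomp_assoc _ _ _ h₁ _ (id (by simpa using e₁)),
          ← Cell₂.vcomp_assoc _ _ _ h₂ _ (id (by simpa using e₂))]
        simp only [e₃]

end Rewriting
end GrayPasting

/-! ### Connectedness of the set of orders. -/

namespace GrayPasting

section Connected
open Quiver

section
variable {V : Type*} [Quiver V]

lemma comp_eq_comp {a b b' c : V} {x : Path a b} {y : Path b c} {x' : Path a b'} {y' : Path b' c}
    (h : x.comp y = x'.comp y') : (∃ m : Path b b', x' = x.comp m ∧ y = m.comp y') ∨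
      ∃ m : Path b' b, x = x'.comp m ∧ y' = m.comp y := by
  induction y with
  | nil => exact Or.inr ⟨y', h, rfl⟩
  | cons y e ih =>
    cases y' with
    | nil => exact Or.inl ⟨y.cons e, h.symm, rfl⟩
    | cons y' e' =>
      simp only [Path.comp_cons] at h
      obtain rfl := Path.obj_eq_of_cons_eq_cons h
      have h₁ := eq_of_heq (Path.heq_of_cons_eq_cons h)
      have h₂ := eq_of_heq (Path.hom_heq_of_cons_eq_cons h)
      subst h₂
      rcases ih h₁ with ⟨m, h, h'⟩ | ⟨m, h, h'⟩
      · exact Or.inl ⟨m, h, by rw [h', Path.comp_cons]⟩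
      · exact Or.inr ⟨m, h, by rw [h', Path.comp_cons]⟩

lemma edges_ne_nil {a b : V} (h : a ≠ b) (p : Path a b) : ∃ e, e ∈ edges p := by
  cases p with
  | nil => exact (h rfl).elim
  | cons p e => exact ⟨⟨_, _, e⟩, by simp⟩

lemma segments_disjoint_left {b c b' c' d : V} {p : Path b c} {y : Path c d} {m : Path b b'}
    {q : Path b' c'} {y' : Path c' d} (hq : b' ≠ c') (hpq : ∀ e ∈ edges p, e ∉ edges q)
    (h : p.comp y = m.comp (q.comp y')) :
    ∃ n : Path c b', m = p.comp n ∧ y = n.comp (q.comp y') := by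
  rcases comp_eq_comp h with h | ⟨n, rfl, h'⟩
  · exact h
  -- Here `q` begins no later than the end of `p`. Either `q` is contained in `p`, or the path `n`
  -- from the beginning of `q` to the end of `p` is part of both and hence empty.
  · rcases comp_eq_comp h' with ⟨k, rfl, _⟩ | ⟨k, rfl, _⟩
    · obtain ⟨e, he⟩ := edges_ne_nil hq q
      exact (hpq e (by simp [he]) he).elim
    · cases n with
      | nil => exact ⟨.nil, rfl, by simpa using h'.symm⟩
      | cons n e => exact (hpq ⟨_, _, e⟩ (by simp) (by simp)).elim

/-- Two segments of a path without common edges: one comes before the other. -/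
lemma segments_disjoint {a b c b' c' d : V} {x : Path a b} {p : Path b c} {y : Path c d}
    {x' : Path a b'} {q : Path b' c'} {y' : Path c' d} (hp : b ≠ c) (hq : b' ≠ c')
    (hpq : ∀ e ∈ edges p, e ∉ edges q) (h : x.comp (p.comp y) = x'.comp (q.comp y')) :
    (∃ m : Path c b', x' = x.comp (p.comp m) ∧ y = m.comp (q.comp y')) ∨
      ∃ m : Path c' b, x = x'.comp (q.comp m) ∧ y' = m.comp (p.comp y) := by
  rcases comp_eq_comp h with ⟨m, rfl, h'⟩ | ⟨m, rfl, h'⟩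
  · obtain ⟨n, rfl, rfl⟩ := segments_disjoint_left hq hpq h'
    exact Or.inl ⟨n, rfl, rfl⟩
  · obtain ⟨n, rfl, rfl⟩ := segments_disjoint_left hp
      (fun e he he' => hpq e he' he) h'
    exact Or.inr ⟨n, rfl, rfl⟩

variable {Φ : Type*} {bd : Φ → Boundary V} {A : Set Φ}

lemma LinExt.ext' {X Y : LinExt bd A} (h : X.list = Y.list) : X = Y := by
  cases X; cases Y; cases h; rfl

lemma LinExt.not_below (X : LinExt bd A) {l r : List Φ} {f g : Φ}
    (h : X.list = l ++ f :: g :: r) : ¬ Below (bd g) (bd f) := by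
  have := X.pairwise
  rw [h, List.pairwise_append, List.pairwise_cons] at this
  exact this.2.1.1 g (by simp)

/-- Only the relative position of `f` and `g` changes, so the single new condition is that `f` is
not above `g`. -/
lemma LinExt.exists_swap (X : LinExt bd A) {l r : List Φ} {f g : Φ}
    (h : X.list = l ++ f :: g :: r) (hfg : ¬ Below (bd f) (bd g)) :
    ∃ Y : LinExt bd A, Y.list = l ++ g :: f :: r := by
  have hp : (l ++ g :: f :: r).Perm X.list := by
    rw [h]
    exact (List.Perm.swap _ _ _).append_left l
  refine ⟨⟨_, hp.nodup_iff.2 X.nodup, fun f => hp.mem_iff.trans (X.mem_iff f),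
    fun f hf => X.irrefl f (hp.mem_iff.1 hf), ?_⟩, rfl⟩
  have := X.pairwise
  rw [h] at this
  simp only [List.pairwise_append, List.pairwise_cons, List.mem_cons, forall_eq_or_imp] at this ⊢
  grind

/-- Any two linear extensions are connected by interchanges of consecutive elements. -/
lemma LinExt.connected {R : LinExt bd A → LinExt bd A → Prop} (hr : ∀ X, R X X)
    (ht : ∀ X Y Z, R X Y → R Y Z → R X Z)
    (hs : ∀ (X Y : LinExt bd A) (l r : List Φ) (f g : Φ), X.list = l ++ f :: g :: r →
      Y.list = l ++ g :: f :: r → R X Y) (X Y : LinExt bd A) : R X Y := by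
  -- Sorting by insertion: with `p` the prefix already common to both lists, the next element of `Y`
  -- is moved to the left in `X` until it follows `p`.
  suffices H : ∀ (l' p l : List Φ) (X : LinExt bd A), X.list = p ++ l → Y.list = p ++ l' →
      R X Y from H _ [] _ X rfl rfl
  clear X
  intro l'
  induction l' with
  | nil =>
    intro p l X hX hY
    have : X = Y := by
      refine LinExt.ext' ?_
      have h : ∀ f ∈ l, False := by
        intro f hf
        have h1 := (X.mem_iff f).1 (by simp [hX, hf])
        rw [← Y.mem_iff, hY, List.append_nil] at h1
        have h2 := X.nodup
        rw [hX, List.nodup_append] at h2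
        exact h2.2.2 f h1 f hf rfl
      rw [hX, hY, List.eq_nil_iff_forall_not_mem.2 h]
    rw [this]
    exact hr Y
  | cons f l' ih =>
    intro p l X hX hY
    have hfl : f ∈ l := by
      have h1 := (Y.mem_iff f).1 (by simp [hY])
      rw [← X.mem_iff, hX, List.mem_append] at h1
      refine h1.resolve_left fun h1 => ?_
      have h2 := Y.nodup
      rw [hY, List.nodup_append] at h2
      exact h2.2.2 f h1 f (by simp) rfl
    obtain ⟨a, b, rfl⟩ := List.append_of_mem hfl
    clear hfl
    induction a using List.reverseRecOn generalizing X b with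
    | nil => exact ih (p ++ [f]) b X (by simpa using hX) (by simpa using hY)
    | append_singleton a c iha =>
      have hX' : X.list = (p ++ a) ++ c :: f :: b := by simpa using hX
      -- The predecessor `c` of `f` in `X` is neither in the common prefix nor equal to `f`, hence
      -- comes after `f` in `Y`. Therefore `c` is not above `f`, and the two may be interchanged.
      have hc : c ∈ l' := by
        have h1 := (X.mem_iff c).1 (by simp [hX])
        rw [← Y.mem_iff, hY, List.mem_append, List.mem_cons] at h1
        have h2 := X.nodup
        rw [hX'] at h2
        simp only [List.nodup_append, List.nodup_cons, List.mem_cons, List.mem_append] at h2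
        grind
      have hcf : ¬ Below (bd c) (bd f) := by
        have h1 := Y.pairwise
        rw [hY, List.pairwise_append, List.pairwise_cons] at h1
        exact h1.2.1.1 c hc
      obtain ⟨Z, hZ⟩ := X.exists_swap hX' hcf
      exact ht X Z Y (hs X Z _ _ _ _ hX' hZ) (iha Z (c :: b) (by simpa using hZ))

variable {s t : V}

/-- Consecutive elements that may be interchanged lie beside each other on a path. -/
lemma exists_swap_data {w w' : Path s t} {l r : List Φ} {f g : Φ}
    (hf : (bd f).source ≠ (bd f).sink) (hg : (bd g).source ≠ (bd g).sink)
    (hfg : ¬ Below (bd f) (bd g)) (σ : Sweep bd w (l ++ f :: g :: r) w') :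
    (∃ (x : Path s (bd f).source) (m : Path (bd f).sink (bd g).source) (z : Path (bd g).sink t),
      Nonempty (Sweep bd w l (x.comp ((bd f).dom.comp (m.comp ((bd g).dom.comp z))))) ∧
      Nonempty (Sweep bd (x.comp ((bd f).cod.comp (m.comp ((bd g).cod.comp z)))) r w')) ∨
    (∃ (x : Path s (bd g).source) (m : Path (bd g).sink (bd f).source) (z : Path (bd f).sink t),
      Nonempty (Sweep bd w l (x.comp ((bd g).dom.comp (m.comp ((bd f).dom.comp z))))) ∧
      Nonempty (Sweep bd (x.comp ((bd g).cod.comp (m.comp ((bd f).cod.comp z)))) r w')) := by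
  obtain ⟨w₁, σ₁, σ₂, -⟩ := σ.exists_append
  cases σ₂ with
  | cons _ x y hw rest =>
    cases rest with
    | cons _ x' y' hw' rest =>
      -- The lowermost path of `f` and the uppermost path of `g` are segments of one path, the one
      -- between the two faces in the sweep. They share no edge, so one comes before the other.
      rcases segments_disjoint hf hg (fun e he he' => hfg ⟨e, he, he'⟩) hw' with
        ⟨m, rfl, rfl⟩ | ⟨m, rfl, rfl⟩
      · exact Or.inl ⟨x, m, y', ⟨σ₁.cast rfl hw⟩, ⟨rest.cast (by simp) rfl⟩⟩
      · exact Or.inr ⟨x', m, y, ⟨σ₁.cast rfl (by simp [hw])⟩, ⟨rest⟩⟩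

end

/-! ### Existence and uniqueness of the functor of a labelling. -/

namespace PastingScheme.GluePairs
variable {V : Type*} [Quiver V] [Finite V] [Finite (Total V)] {𝒢 : PastingScheme V} {ι : Type*}
  {D : 𝒢.GluePairs ι} {P : Set ι}

lemma source_ne_sink (D : 𝒢.GluePairs ι) : ∀ f, (D.bd f).source ≠ (D.bd f).sink
  | .inl f => 𝒢.source_ne_sink f
  | .inr i => (D.shape i).source_ne_sink 𝒢.acyclic (𝒢.source_ne_sink _)

/-- An equivalence relation on orders holds everywhere if it holds for interchanges of neighbours.
By symmetry the face performed first may be taken to lie on the left, which is the situation of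
`Composition.hom_swap`. -/
lemma order_connected {R : D.Order P → D.Order P → Prop} (hr : ∀ X, R X X)
    (hsymm : ∀ X Y, R X Y → R Y X) (ht : ∀ X Y Z, R X Y → R Y Z → R X Z)
    (hs : ∀ (X Y : D.Order P) (l r : List D.Cell) (f g : D.Cell) (x : Path 𝒢.s (D.bd f).source)
      (m : Path (D.bd f).sink (D.bd g).source) (z : Path (D.bd g).sink 𝒢.t)
      (_ : Sweep D.bd 𝒢.top l (x.comp ((D.bd f).dom.comp (m.comp ((D.bd g).dom.comp z)))))
      (_ : Sweep D.bd (x.comp ((D.bd f).cod.comp (m.comp ((D.bd g).cod.comp z)))) r 𝒢.bot),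
      X.list = l ++ f :: g :: r → Y.list = l ++ g :: f :: r → R X Y) (X Y : D.Order P) :
    R X Y := by
  refine LinExt.connected hr ht ?_ X Y
  intro X Y l r f g hX hY
  obtain ⟨σ⟩ := (D.incidence P).exists_sweep X
  rw [hX] at σ
  rcases exists_swap_data (D.source_ne_sink f) (D.source_ne_sink g)
    (Y.not_below hY) σ with ⟨x, m, z, ⟨σ⟩, ⟨ρ⟩⟩ | ⟨x, m, z, ⟨σ⟩, ⟨ρ⟩⟩
  · exact hs X Y l r f g x m z σ ρ hX hY
  · exact hsymm _ _ (hs Y X l r g f x m z σ ρ hY hX)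

variable {𝒦 : Type*} [GrayCategory 𝒦] {φ : V ⥤q 𝒦} {M : Cells φ D.bd}

lemma Composition.hom_swap_cell (L : D.Composition M P) (X Y : D.Order P) {f g : D.Cell}
    {l r : List D.Cell} (hX : X.list = l ++ f :: g :: r) (hY : Y.list = l ++ g :: f :: r)
    {w₁ w₂ : Path 𝒢.s 𝒢.t} (σ : Sweep D.bd 𝒢.top l w₁) (x : Path 𝒢.s (D.bd f).source)
    (m : Path (D.bd f).sink (D.bd g).source) (z : Path (D.bd g).sink 𝒢.t)
    (ρ : Sweep D.bd w₂ r 𝒢.bot)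
    (h₁ : w₁ = x.comp ((D.bd f).dom.comp (m.comp ((D.bd g).dom.comp z))))
    (h₂ : w₂ = x.comp ((D.bd f).cod.comp (m.comp ((D.bd g).cod.comp z)))) :
    Cell₂.mk (L.hom X Y) = swapCell M σ x m z ρ h₁ h₂ := by
  subst h₁ h₂
  rw [L.hom_swap X Y hX hY x m z σ ρ]
  exact mk_swap M σ ρ _ _

lemma Composition.hom_inv (L : D.Composition M P) (X Y : D.Order P) :
    L.hom X Y ≫ L.hom Y X = 𝟙 (D.comp M X) := (L.hom_comp X Y X).trans (L.hom_self X)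

/-- The morphisms are prescribed on interchanges; agreement passes to inverses and composites, and
the orders are connected. -/
lemma Composition.subsingleton (L L' : D.Composition M P) : L = L' := by
  have h : ∀ X Y, L.hom X Y = L'.hom X Y := by
    refine order_connected ?_ ?_ ?_ ?_
    · intro X
      rw [L.hom_self, L'.hom_self]
    · intro X Y h
      calc L.hom Y X = L.hom Y X ≫ L'.hom X Y ≫ L'.hom Y X := by rw [L'.hom_inv, Category.comp_id]
        _ = L'.hom Y X := by rw [← h, ← Category.assoc, L.hom_inv, Category.id_comp]
    · intro X Y Z h h'
      rw [← L.hom_comp X Y Z, h, h', L'.hom_comp]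
    · intro X Y l r f g x m z σ ρ hX hY
      rw [L.hom_swap X Y hX hY x m z σ ρ, L'.hom_swap X Y hX hY x m z σ ρ]
  obtain ⟨f, _, _, _⟩ := L
  obtain ⟨f', _, _, _⟩ := L'
  obtain rfl : f = f' := funext fun X => funext fun Y => h X Y
  rfl

lemma comp_cell (M : Cells φ D.bd) (X : D.Order P) {l : List D.Cell} (hX : X.list = l)
    (σ : Sweep D.bd 𝒢.top l 𝒢.bot) : Cell₁.mk (D.comp M X) = evalCell M σ :=
  congrArg Cell₁.mk (comp_eq M X hX σ)

/-- Morphisms between orders are compared through their common normal form. -/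
lemma nonempty_composition (M : Cells φ D.bd) (P : Set ι) : Nonempty (D.Composition M P) := by
  rcases isEmpty_or_nonempty (D.Order P) with h | ⟨⟨X₀⟩⟩
  · exact ⟨⟨fun X => h.elim X, fun X => h.elim X, fun X => h.elim X, fun X => h.elim X⟩⟩
  obtain ⟨σ₀⟩ := (D.incidence P).exists_sweep X₀
  obtain ⟨n, Θ₀, r₀, hn⟩ := exists_normal (M := M) 𝒢.acyclic D.source_ne_sink σ₀
  obtain ⟨τ⟩ := r₀.sweep.2
  -- Every order reaches the normal form `n` of `X₀`: the existence of a reduction to `n` is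
  -- invariant under interchanges, by uniqueness of normal forms, and the orders are connected.
  have H : ∀ X : D.Order P, ∃ θ : D.comp M X ⟶ eval M τ,
      Reach M 𝒢.top 𝒢.bot X.list n (Cell₂.mk θ) := by
    have H' : ∀ X Y : D.Order P, (∃ Θ, Reach M 𝒢.top 𝒢.bot X.list n Θ) ↔
        ∃ Θ, Reach M 𝒢.top 𝒢.bot Y.list n Θ := by
      refine order_connected (fun _ => Iff.rfl) (fun _ _ h => h.symm)
        (fun _ _ _ h h' => h.trans h') ?_
      intro X Y l r f g x m z σ ρ hX hY
      have S := step_swapCell (M := M) σ x m z ρ rfl rfl hX hY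
      constructor
      · rintro ⟨Θ, hΘ⟩
        obtain ⟨σ'⟩ := S.sweep.2
        obtain ⟨n', Ξ, hΞ, hn'⟩ := exists_normal (M := M) 𝒢.acyclic D.source_ne_sink σ'
        obtain ⟨rfl, -⟩ := Reach.unique 𝒢.acyclic D.source_ne_sink hΘ
          (.cons S hΞ ((S.tgt 𝒢.acyclic σ').trans (hΞ.src 𝒢.acyclic σ').symm)) hn hn'
        exact ⟨Ξ, hΞ⟩
      · rintro ⟨Θ, hΘ⟩
        obtain ⟨σ'⟩ := S.sweep.2
        exact ⟨_, .cons S hΘ ((S.tgt 𝒢.acyclic σ').trans (hΘ.src 𝒢.acyclic σ').symm)⟩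
    intro X
    obtain ⟨Θ, hΘ⟩ := (H' X₀ X).1 ⟨Θ₀, r₀⟩
    obtain ⟨σ⟩ := (D.incidence P).exists_sweep X
    obtain ⟨θ, hθ⟩ := Cell₂.exists_hom (f := D.comp M X) (g := eval M τ)
      ((hΘ.src 𝒢.acyclic σ).trans (comp_cell M X rfl σ).symm) (hΘ.tgt 𝒢.acyclic τ)
    exact ⟨θ, hθ ▸ hΘ⟩
  choose θ hθ using H
  have hiso : ∀ X, IsIso (θ X) := fun X => (hθ X).isIso
  -- Functoriality is automatic for this choice. The condition on interchanges says that `θ X` is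
  -- the interchange followed by `θ Y`; both sides are reductions of `X` to `n`, hence equal.
  refine ⟨⟨fun X Y => θ X ≫ inv (θ Y), by simp, by simp, ?_⟩⟩
  intro X Y f g l r hX hY x m z σ ρ
  rw [IsIso.comp_inv_eq]
  refine Cell₂.mk_inj ?_
  rw [← Cell₂.vcomp_mk]
  have e := mk_swap M σ ρ (comp_eq_leftFirst M σ ρ X hX) (comp_eq_rightFirst M σ ρ Y hY).symm
  have S := step_swapCell (M := M) σ x m z ρ rfl rfl hX hY
  have R := Reach.cons (e ▸ S) (hθ Y) (id rfl)
  exact (Reach.unique 𝒢.acyclic D.source_ne_sink (hθ X) R hn hn).2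

lemma nonempty_unique_composition (M : Cells φ D.bd) (P : Set ι) :
    Nonempty (Unique (D.Composition M P)) :=
  ⟨⟨(nonempty_composition M P).some⟩, fun _ => Composition.subsingleton _ _⟩

end PastingScheme.GluePairs
end Connected
end GrayPasting

/-! ### Interchanges, changes of labels, and pastings. -/

namespace GrayPasting

lemma Cell₁.mk_comp_eqToHom_comp {B : Type*} [Bicategory B] [Bicategory.Strict B] {x y y' z : B}
    (f : x ⟶ y) (h : y = y') (g : y' ⟶ z) :
    mk (f ≫ eqToHom h ≫ g) = (mk f).comp (mk g) (id h) := by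
  subst h
  rw [eqToHom_refl, Category.id_comp]
  rfl

namespace Cell₂
variable {B : Type*} [Bicategory B]

/-- A square of 2-cells, composed horizontally with 2-cells on both sides. -/
lemma between_naturality {Γ Ψ E E' Θ Ξ : Cell₂ B} (h₁ : E.tgt = Ξ.src) (h₂ : Θ.tgt = E'.src)
    (h : E.vcomp Ξ h₁ = Θ.vcomp E' h₂) (p₁ : Γ.src.t = E.src.s) (p₂ : E.src.t = Ψ.src.s)
    (p₃ : Ξ.src.t = Ψ.src.s) (p₄ : Γ.src.t = (Ξ.hcomp Ψ p₃).src.s) (p₅ : Θ.src.t = Ψ.src.s)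
    (p₆ : Γ.src.t = (Θ.hcomp Ψ p₅).src.s) (p₇ : Γ.tgt.t = E'.src.s) (p₈ : E'.src.t = Ψ.tgt.s)
    (q₁ : (between Γ.src E Ψ.src p₁ p₂).tgt = (Γ.hcomp (Ξ.hcomp Ψ p₃) p₄).src)
    (q₂ : (Γ.hcomp (Θ.hcomp Ψ p₅) p₆).tgt = (between Γ.tgt E' Ψ.tgt p₇ p₈).src) :
    (between Γ.src E Ψ.src p₁ p₂).vcomp (Γ.hcomp (Ξ.hcomp Ψ p₃) p₄) q₁ =
      (Γ.hcomp (Θ.hcomp Ψ p₅) p₆).vcomp (between Γ.tgt E' Ψ.tgt p₇ p₈) q₂ := by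
  have hp₂ : (E.vcomp Ξ h₁).src.t = ((one Ψ.src).vcomp Ψ (id rfl)).src.s := by simpa using p₂
  have hp₅ : (Θ.vcomp E' h₂).src.t = (Ψ.vcomp (one Ψ.tgt) (id rfl)).src.s := by simpa using p₅
  -- `e₁` and `e₂` adjoin `Ψ` on the right of the two sides of the square; `e₃` and `e₄` adjoin `Γ`
  -- on the left.
  have e₁ := vcomp_hcomp_vcomp E Ξ (one Ψ.src) Ψ h₁ (id rfl) hp₂ (id p₂) p₃ (id (by simp [h₁]))
  have e₂ := vcomp_hcomp_vcomp Θ E' Ψ (one Ψ.tgt) h₂ (id rfl) hp₅ p₅ (id p₈) (id (by simp [h₂]))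
  have e₃ := vcomp_hcomp_vcomp (one Γ.src) Γ (E.hcomp (one Ψ.src) (id p₂)) (Ξ.hcomp Ψ p₃) (id rfl)
    (id (by simp [h₁])) (id (by simpa using p₁)) (id p₁) p₄ (id q₁)
  have e₄ := vcomp_hcomp_vcomp Γ (one Γ.tgt) (Θ.hcomp Ψ p₅) (E'.hcomp (one Ψ.tgt) (id p₈)) (id rfl)
    (id (by simp [h₂])) (id (by simpa using p₆)) p₆ (id p₇) (id q₂)
  simp only [one_vcomp, vcomp_one, ← h] at e₁ e₂ e₃ e₄
  simp only [← e₁, ← e₂] at e₃ e₄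
  exact e₃.symm.trans e₄

end Cell₂

section
open Quiver GrayCategory

variable {V : Type*} [Quiver V] {𝒦 : Type*} [GrayCategory 𝒦] {φ : V ⥤q 𝒦}

/-- Bundling removes the transport along `g.mid`, so that the pasting is a composite of two
whiskered 2-cells, the form required by `Cell₁.exch_comp_left` and `Cell₁.exch_comp_right`. -/
lemma mk_pasting {b c : Boundary V} (g : GlueShape b c) (α : ev φ b.dom ⟶ ev φ b.cod)
    (β : ev φ c.dom ⟶ ev φ c.cod) : Cell₁.mk (g.pasting α β) =
      ((Cell₁.mk α).whisker (ev φ g.u) (ev φ g.v)).comp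
        ((Cell₁.mk β).whisker (ev φ g.u') (ev φ g.v'))
        (id (by simpa [ev_comp] using congrArg (ev φ) g.mid)) := by
  refine (Cell₁.mk_comp_eqToHom_comp _ (congrArg (ev φ) g.mid) _).trans ?_
  congr 1
  · exact mk_whisker _ _ _
  · exact mk_whisker _ _ _

variable {Φ : Type*} {bd : Φ → Boundary V} {s t : V}

section
variable {M M' : Cells φ bd} (θ : ∀ f, M f ⟶ M' f) {l r : List Φ} {f g : Φ}
  {w w' w₁ w₂ : Path s t} (σ : Sweep bd w l w₁) (x : Path s (bd f).source)
  (m : Path (bd f).sink (bd g).source) (z : Path (bd g).sink t) (ρ : Sweep bd w₂ r w')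
  (h₁ : w₁ = x.comp ((bd f).dom.comp (m.comp ((bd g).dom.comp z))))
  (h₂ : w₂ = x.comp ((bd f).cod.comp (m.comp ((bd g).cod.comp z))))

/-- The 3-cells along the sweep split into those along `σ`, those of `f` and `g`, and those along
`ρ`. The middle part is naturality of the interchange, and the outer parts act independently of it.
-/
lemma swapCell_naturality
    (h : (swapCell M σ x m z ρ h₁ h₂).tgt = (mapCell θ (σ.rightFirst x m z ρ h₁ h₂)).src)
    (h' : (mapCell θ (σ.leftFirst x m z ρ h₁ h₂)).tgt = (swapCell M' σ x m z ρ h₁ h₂).src) :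
    (swapCell M σ x m z ρ h₁ h₂).vcomp (mapCell θ (σ.rightFirst x m z ρ h₁ h₂)) h =
      (mapCell θ (σ.leftFirst x m z ρ h₁ h₂)).vcomp (swapCell M' σ x m z ρ h₁ h₂) h' := by
  have e := Cell₁.exch_naturality (ev φ x)
    (Cell₂.mk (θ f) : Cell₂ (φ.obj (bd f).source ⟶ φ.obj (bd f).sink)) (ev φ m)
    (Cell₂.mk (θ g) : Cell₂ (φ.obj (bd g).source ⟶ φ.obj (bd g).sink)) (ev φ z)
  have e' := Cell₂.between_naturality (Γ := mapCell θ σ) (Ψ := mapCell θ ρ) _ _ e.symm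
    (id (by simp [h₁, ev_comp])) (id (by simp [h₂, ev_comp])) (id (by simp [h₂, ev_comp]))
    (id (by simp [h₁, ev_comp])) (id (by simp [h₂, ev_comp]))
    (id (by simp [h₁, ev_comp])) (id (by simp [h₁, ev_comp])) (id (by simp [h₂, ev_comp]))
    (id (by simp)) (id (by simp))
  have e₁ : mapCell θ (σ.rightFirst x m z ρ h₁ h₂) = _ := mapCell_append θ σ _
  have e₂ : mapCell θ (σ.leftFirst x m z ρ h₁ h₂) = _ := mapCell_append θ σ _
  simp only [mapCell_cons, mapCell_cast, ev_comp] at e₁ e₂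
  simp only [e₁, e₂]
  simp only [Cell₂.hcomp_assoc] at e'
  exact e'

end

section
variable (M : Cells φ bd) {l r : List Φ} {f g h : Φ} {w w' w₁ w₂ : Path s t}
  (σ : Sweep bd w l w₁) (ρ : Sweep bd w₂ r w')

/-- The interchange of a pasting of two faces with a face on its right. -/
lemma swapCell_pasting_left (sh : GlueShape (bd f) (bd g)) (x : Path s sh.source)
    (m : Path sh.sink (bd h).source) (z : Path (bd h).sink t) (p p₁ p₂ p₃ p₄ p₅ p₆ p₇ p₈ p₉) :
    Cell₂.between (evalCell M σ) (Cell₁.exch (ev φ x)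
        (((cell M f).whisker (ev φ sh.u) (ev φ sh.v)).comp
          ((cell M g).whisker (ev φ sh.u') (ev φ sh.v')) p) (ev φ m) (cell M h) (ev φ z))
        (evalCell M ρ) p₁ p₂ =
      (swapCell M (σ.append (.single f (x.comp sh.u) (sh.v.comp (m.comp ((bd h).dom.comp z))) p₃
        rfl)) (x.comp sh.u') (sh.v'.comp m) z ρ p₄ p₅).vcomp
      (swapCell M σ (x.comp sh.u) (sh.v.comp m) z (.cons' g (x.comp sh.u')
        (sh.v'.comp (m.comp ((bd h).cod.comp z))) p₆ p₇ ρ) p₈ (id rfl)) p₉ := by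
  have e := Cell₁.exch_comp_left (ev φ x) (ev φ sh.u) (cell M f) (ev φ sh.v) (ev φ sh.u')
    (cell M g) (ev φ sh.v') p (ev φ m) (cell M h) (ev φ z)
  simp only [swapCell, evalCell_append, evalCell_single, evalCell_cons', ev_comp, e,
    Cell₂.between_comp_left, Cell₂.between_comp_right]
  exact Cell₂.between_vcomp _ _ _ _ _ _ _

/-- The interchange of a pasting of two faces with a face on its left. -/
lemma swapCell_pasting_right (sh : GlueShape (bd f) (bd g)) (x : Path s (bd h).source)
    (m : Path (bd h).sink sh.source) (z : Path sh.sink t) (p p₁ p₂ p₃ p₄ p₅ p₆ p₇ p₈ p₉) :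
    Cell₂.between (evalCell M σ) (Cell₁.exch (ev φ x) (cell M h) (ev φ m)
        (((cell M f).whisker (ev φ sh.u) (ev φ sh.v)).comp
          ((cell M g).whisker (ev φ sh.u') (ev φ sh.v')) p) (ev φ z)) (evalCell M ρ) p₁ p₂ =
      (swapCell M σ x (m.comp sh.u) (sh.v.comp z)
        (.cons' g (x.comp ((bd h).cod.comp (m.comp sh.u'))) (sh.v'.comp z) p₃ p₄ ρ) p₅
          (id rfl)).vcomp
      (swapCell M (σ.append (.single f (x.comp ((bd h).dom.comp (m.comp sh.u)))
        (sh.v.comp z) p₆ rfl)) x (m.comp sh.u') (sh.v'.comp z) ρ p₇ p₈) p₉ := by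
  have e := Cell₁.exch_comp_right (ev φ x) (cell M h) (ev φ m) (ev φ sh.u) (cell M f)
    (ev φ sh.v) (ev φ sh.u') (cell M g) (ev φ sh.v') p (ev φ z)
  simp only [swapCell, evalCell_append, evalCell_single, evalCell_cons', ev_comp, e,
    Cell₂.between_comp_left, Cell₂.between_comp_right]
  exact Cell₂.between_vcomp _ _ _ _ _ _ _

end

end
end GrayPasting

/-! ### Changes of labels along orders, and ungluing. -/

namespace GrayPasting

section
open Quiver

/-- A common edge would occur twice on the path `x · b.cod · m · c.dom · z`, which is impossible
without directed cycles. -/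
lemma not_below_of_comp {V : Type*} [Quiver V] (hV : Acyclic V) {b c : Boundary V} {s t : V}
    (x : Path s b.source) (m : Path b.sink c.source) (z : Path c.sink t) : ¬ Below b c := by
  rintro ⟨e, he, he'⟩
  have h := hV.nodup_edges (x.comp (b.cod.comp (m.comp (c.dom.comp z))))
  simp only [edges_comp, List.nodup_append, List.mem_append] at h
  exact h.2.1.2.2 e he e (Or.inr (Or.inl he')) rfl

section
open GrayCategory
variable {V : Type*} [Quiver V] {𝒦 : Type*} [GrayCategory 𝒦] {φ : V ⥤q 𝒦} {Φ : Type*}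
  {bd : Φ → Boundary V}

/-- The identity of a pasting is the composite of the identities of its two factors. Hence a glued
face with an identity 3-cell may be replaced by its two parts without changing the 3-cell along the
sweep. -/
lemma exists_pasted_map {M M' : Cells φ bd} (θ : ∀ f, M f ⟶ M' f) {b c : Φ}
    (hb : Cell₂.mk (θ b) = Cell₂.one (cell M b)) (hc : Cell₂.mk (θ c) = Cell₂.one (cell M c))
    (g : GlueShape (bd b) (bd c)) {s t : V} {w w' : Path s t} {l : List Φ} (x : Path s g.source)
    (y : Path g.sink t) (hw : w = x.comp ((g.u.comp ((bd b).dom.comp g.v)).comp y))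
    (ρ : Sweep bd (x.comp ((g.u'.comp ((bd c).cod.comp g.v')).comp y)) l w') :
    ∃ σ' : Sweep bd w (b :: c :: l) w', mapCell θ σ' =
      ((Cell₂.one (Cell₁.mk (g.pasting (M b) (M c)) :
        Cell₁ (φ.obj g.source ⟶ φ.obj g.sink))).whisker (ev φ x) (ev φ y)).hcomp
        (mapCell θ ρ) (id (ev_comp₃ φ x (g.u'.comp ((bd c).cod.comp g.v')) y).symm) := by
  have hmid : (x.comp g.u).comp ((bd b).cod.comp (g.v.comp y)) =
      (x.comp g.u').comp ((bd c).dom.comp (g.v'.comp y)) := by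
    simpa only [Path.comp_assoc] using congrArg (fun q => x.comp (q.comp y)) g.mid
  refine ⟨.cons' b (x.comp g.u) (g.v.comp y) (id (by simp [hw])) rfl
      (.cons' c (x.comp g.u') (g.v'.comp y) hmid (id (by simp)) ρ), ?_⟩
  have e : (Cell₁.mk (g.pasting (M b) (M c)) : Cell₁ (φ.obj g.source ⟶ φ.obj g.sink)) =
    ((cell M b).whisker (ev φ g.u) (ev φ g.v)).comp ((cell M c).whisker (ev φ g.u') (ev φ g.v'))
      (id (by simpa [ev_comp] using congrArg (ev φ) g.mid)) := mk_pasting _ _ _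
  simp only [e, mapCell_cons', hb, hc, Cell₂.whisker_one, Cell₁.whisker_comp,
    Cell₁.whisker_whisker, ev_comp]
  simp only [Cell₂.one_comp, Cell₂.hcomp_assoc]

end

namespace PastingScheme.GluePairs
variable {V : Type*} [Quiver V] [Finite V] [Finite (Total V)] {𝒢 : PastingScheme V} {ι : Type*}
  {D : 𝒢.GluePairs ι} {P P' : Set ι} {𝒦 : Type*} [GrayCategory 𝒦]

section
variable {φ : V ⥤q 𝒦} {M M' M'' : Cells φ D.bd}

lemma compMap_cell (θ : ∀ f, M f ⟶ M' f) (X : D.Order P) {l : List D.Cell} (hX : X.list = l)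
    (σ : Sweep D.bd 𝒢.top l 𝒢.bot) : Cell₂.mk (D.compMap θ X) = mapCell θ σ := by
  subst hX
  rw [sweep_subsingleton 𝒢.acyclic _ σ ((D.incidence P).exists_sweep X).some]
  rfl

lemma compMap_comp (θ : ∀ f, M f ⟶ M' f) (θ' : ∀ f, M' f ⟶ M'' f) (X : D.Order P) :
    D.compMap θ X ≫ D.compMap θ' X = D.compMap (fun f => θ f ≫ θ' f) X := by
  refine Cell₂.mk_inj ?_
  rw [← Cell₂.vcomp_mk]
  exact mapCell_vcomp θ θ' _

/-- The 3-cells induced by 3-cells between labels of faces are natural. -/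
lemma hom_compMap (L : D.Composition M P) (L' : D.Composition M' P) (θ : ∀ f, M f ⟶ M' f)
    (X Y : D.Order P) : L.hom X Y ≫ D.compMap θ Y = D.compMap θ X ≫ L'.hom X Y := by
  revert X Y
  -- The squares that commute are closed under identities, inverses and composition, so only
  -- interchanges remain, for which this is `swapCell_naturality`.
  refine order_connected ?_ ?_ ?_ ?_
  · intro X
    rw [L.hom_self, L'.hom_self, Category.comp_id, Category.id_comp]
  · intro X Y h
    calc L.hom Y X ≫ D.compMap θ X
        = L.hom Y X ≫ (D.compMap θ X ≫ L'.hom X Y) ≫ L'.hom Y X := by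
          rw [Category.assoc, L'.hom_inv, Category.comp_id]
      _ = D.compMap θ Y ≫ L'.hom Y X := by
          rw [← h, ← Category.assoc, ← Category.assoc, L.hom_inv, Category.id_comp]
  · intro X Y Z h h'
    rw [← L.hom_comp X Y Z, Category.assoc, h', ← Category.assoc, h, Category.assoc, L'.hom_comp]
  · intro X Y l r f g x m z σ ρ hX hY
    refine Cell₂.mk_inj ?_
    rw [← Cell₂.vcomp_mk, ← Cell₂.vcomp_mk]
    have h := L.hom_swap_cell X Y hX hY σ x m z ρ rfl rfl
    have h' := L'.hom_swap_cell X Y hX hY σ x m z ρ rfl rfl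
    simp only [h, h', compMap_cell θ X hX (σ.leftFirst x m z ρ rfl rfl),
      compMap_cell θ Y hY (σ.rightFirst x m z ρ rfl rfl)]
    exact swapCell_naturality θ σ x m z ρ rfl rfl _ _

end

variable (ℒ : 𝒢.Labelling 𝒦)

lemma mk_D_pasting (D : 𝒢.GluePairs ι) (i : ι) :
    (Cell₁.mk (D.pasting ℒ i) : Cell₁ (ℒ.edge.obj (D.shape i).source ⟶ ℒ.edge.obj (D.shape i).sink)) =
      ((Cell₁.mk (ℒ.face (D.fst i))).whisker (ev ℒ.edge (D.shape i).u)
        (ev ℒ.edge (D.shape i).v)).comp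
      ((Cell₁.mk (ℒ.face (D.snd i))).whisker (ev ℒ.edge (D.shape i).u')
        (ev ℒ.edge (D.shape i).v'))
      (id (by simpa [ev_comp] using congrArg (ev ℒ.edge) (D.shape i).mid)) :=
  mk_pasting _ _ _

/-- The hypothesis `hθ` requires `θ i` to be the identity of the pasting. It is stated for bundled
cells because `A i` and `A' i` are not the pasting by definition. -/
lemma exists_expanded_map {A A' : ∀ i, D.TwoCell ℒ i} (θ : ∀ i, A i ⟶ A' i) (P : Set ι)
    {s t : V} {w w' : Path s t} {l : List D.Cell} (σ : Sweep D.bd w l w')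
    (hθ : ∀ i ∉ P, Sum.inr i ∈ l → Cell₂.mk (θ i) = Cell₂.one ⟨D.pasting ℒ i⟩) :
    ∃ σ' : Sweep D.bd w (l.flatMap (D.expand P)) w',
      mapCell (D.extendMap ℒ θ) σ' = mapCell (D.extendMap ℒ θ) σ := by
  induction σ with
  | nil w => exact ⟨.nil w, rfl⟩
  | cons f x y hw rest ih =>
    obtain ⟨ρ, hρ⟩ := ih fun i hi hl => hθ i hi (List.mem_cons_of_mem _ hl)
    rw [List.flatMap_cons]
    rcases f with f | i
    · refine ⟨.cons (Sum.inl f) x y hw ρ, (mapCell_cons _ _ _ _ _ _).trans ?_⟩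
      simp only [mapCell_cons, hρ]
    by_cases hi : i ∈ P
    · rw [expand, if_pos hi]
      refine ⟨.cons (Sum.inr i) x y hw ρ, (mapCell_cons _ _ _ _ _ _).trans ?_⟩
      simp only [mapCell_cons, hρ]
    rw [expand, if_neg hi]
    obtain ⟨σ', hσ'⟩ := exists_pasted_map (D.extendMap ℒ θ) (b := .inl (D.fst i))
      (c := .inl (D.snd i)) rfl rfl (D.shape i) x y hw ρ
    refine ⟨σ', hσ'.trans ?_⟩
    have h := congrArg (fun Θ => Cell₂.whisker (ev ℒ.edge x) Θ (ev ℒ.edge y))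
      (hθ i hi (by simp))
    rw [mapCell_cons]
    congr 1
    · exact h.symm

lemma compMap_unglueOrder {A A' : ∀ i, D.TwoCell ℒ i} (θ : ∀ i, A i ⟶ A' i) (hP : P ⊆ P')
    (hθ : ∀ i ∈ P', i ∉ P → Cell₂.mk (θ i) = Cell₂.one ⟨D.pasting ℒ i⟩) (X : D.Order P') :
    Cell₂.mk (D.compMap (D.extendMap ℒ θ) (D.unglueOrder hP X)) =
      Cell₂.mk (D.compMap (D.extendMap ℒ θ) X) := by
  obtain ⟨σ⟩ := (D.incidence P').exists_sweep X
  obtain ⟨σ', hσ'⟩ := exists_expanded_map ℒ θ P σ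
    fun i hi hl => hθ i ((X.mem_iff _).1 hl) hi
  rw [compMap_cell _ X rfl σ, compMap_cell _ (D.unglueOrder hP X) rfl σ']
  exact hσ'

section
variable {φ : V ⥤q 𝒦} {M : Cells φ D.bd} (L : D.Composition M P) {l r : List D.Cell}
  {f g h : D.Cell}

lemma Composition.mk_hom_comp (X Y Z : D.Order P) :
    Cell₂.mk (L.hom X Z) = (Cell₂.mk (L.hom X Y)).vcomp (Cell₂.mk (L.hom Y Z)) (id rfl) := by
  rw [Cell₂.vcomp_mk, L.hom_comp]

variable {w₁ w₂ : Path 𝒢.s 𝒢.t} (σ : Sweep D.bd 𝒢.top l w₁) (ρ : Sweep D.bd w₂ r 𝒢.bot)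
  (sh : GlueShape (D.bd f) (D.bd g))

lemma _root_.GrayPasting.GlueShape.comp_mid {V : Type*} [Quiver V] {b c : Boundary V}
    (g : GlueShape b c) {s t : V} (x : Path s g.source) (y : Path g.sink t) :
    x.comp (g.u.comp (b.cod.comp (g.v.comp y))) =
      x.comp (g.u'.comp (c.dom.comp (g.v'.comp y))) := by
  simpa only [Path.comp_assoc] using congrArg (fun q => x.comp (q.comp y)) g.mid

lemma Composition.hom_pasting_left {X Y : D.Order P} (hX : X.list = l ++ f :: g :: h :: r)
    (hY : Y.list = l ++ h :: f :: g :: r) (x : Path 𝒢.s sh.source)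
    (m : Path sh.sink (D.bd h).source) (z : Path (D.bd h).sink 𝒢.t)
    (h₁ : w₁ = x.comp ((sh.u.comp ((D.bd f).dom.comp sh.v)).comp (m.comp ((D.bd h).dom.comp z))))
    (h₂ : w₂ = x.comp ((sh.u'.comp ((D.bd g).cod.comp sh.v')).comp
      (m.comp ((D.bd h).cod.comp z)))) (p p₁ p₂) :
    Cell₂.mk (L.hom X Y) = Cell₂.between (evalCell M σ) (Cell₁.exch (ev φ x)
        (((cell M f).whisker (ev φ sh.u) (ev φ sh.v)).comp
          ((cell M g).whisker (ev φ sh.u') (ev φ sh.v')) p) (ev φ m) (cell M h) (ev φ z))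
        (evalCell M ρ) p₁ p₂ := by
  -- The face `h` passes the pair one face at a time, its neighbour `g` first; the intermediate
  -- order `Z` contains `f`, `h`, `g`. The composite of the two interchanges is that of the pasting
  -- with `h`.
  have hb : ¬ Below (D.bd g) (D.bd h) :=
    not_below_of_comp 𝒢.acyclic (x.comp sh.u') (sh.v'.comp m) z
  obtain ⟨Z, hZ⟩ := X.exists_swap (l := l ++ [f]) (by simpa using hX) hb
  have e₁ := L.hom_swap_cell X Z (l := l ++ [f]) (by simpa using hX) hZ
    (σ.append (.single f (x.comp sh.u) (sh.v.comp (m.comp ((D.bd h).dom.comp z)))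
      (id (by simp [h₁])) rfl)) (x.comp sh.u') (sh.v'.comp m) z ρ
    (id (by simpa using sh.comp_mid x (m.comp ((D.bd h).dom.comp z)))) (id (by simp [h₂]))
  have e₂ := L.hom_swap_cell Z Y (l := l) (by simpa using hZ) hY σ (x.comp sh.u) (sh.v.comp m) z
    (.cons' g (x.comp sh.u') (sh.v'.comp (m.comp ((D.bd h).cod.comp z)))
      (id (by simpa using sh.comp_mid x (m.comp ((D.bd h).cod.comp z)))) (id (by simp [h₂])) ρ)
    (id (by simp [h₁])) (id rfl)
  rw [L.mk_hom_comp X Z Y]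
  simp only [e₁, e₂]
  exact (swapCell_pasting_left M σ ρ sh x m z p p₁ p₂ _ _ _ _ _ _
    (id (by rw [← e₁, ← e₂]; rfl))).symm

lemma Composition.hom_pasting_right {X Y : D.Order P} (hX : X.list = l ++ h :: f :: g :: r)
    (hY : Y.list = l ++ f :: g :: h :: r) (x : Path 𝒢.s (D.bd h).source)
    (m : Path (D.bd h).sink sh.source) (z : Path sh.sink 𝒢.t)
    (h₁ : w₁ = x.comp ((D.bd h).dom.comp (m.comp ((sh.u.comp ((D.bd f).dom.comp sh.v)).comp z))))
    (h₂ : w₂ = x.comp ((D.bd h).cod.comp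
      (m.comp ((sh.u'.comp ((D.bd g).cod.comp sh.v')).comp z)))) (p p₁ p₂) :
    Cell₂.mk (L.hom X Y) = Cell₂.between (evalCell M σ) (Cell₁.exch (ev φ x) (cell M h) (ev φ m)
        (((cell M f).whisker (ev φ sh.u) (ev φ sh.v)).comp
          ((cell M g).whisker (ev φ sh.u') (ev φ sh.v')) p) (ev φ z))
        (evalCell M ρ) p₁ p₂ := by
  -- Here `h` starts before the pair and passes `f` first; the intermediate order contains `f`, `h`,
  -- `g`.
  have hb : ¬ Below (D.bd h) (D.bd f) :=
    not_below_of_comp 𝒢.acyclic x (m.comp sh.u) (sh.v.comp z)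
  obtain ⟨Z, hZ⟩ := X.exists_swap (l := l) hX hb
  have e₁ := L.hom_swap_cell X Z hX hZ σ x (m.comp sh.u) (sh.v.comp z)
    (.cons' g (x.comp ((D.bd h).cod.comp (m.comp sh.u'))) (sh.v'.comp z)
      (id (by simpa using sh.comp_mid (x.comp ((D.bd h).cod.comp m)) z)) (id (by simp [h₂])) ρ)
    (id (by simp [h₁])) (id rfl)
  have e₂ := L.hom_swap_cell Z Y (l := l ++ [f]) (by simpa using hZ) (by simpa using hY)
    (σ.append (.single f (x.comp ((D.bd h).dom.comp (m.comp sh.u))) (sh.v.comp z)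
      (id (by simp [h₁])) rfl)) x (m.comp sh.u') (sh.v'.comp z) ρ
    (id (by simpa using sh.comp_mid (x.comp ((D.bd h).dom.comp m)) z)) (id (by simp [h₂]))
  rw [L.mk_hom_comp X Z Y]
  simp only [e₁, e₂]
  exact (swapCell_pasting_right M σ ρ sh x m z p p₁ p₂ _ _ _ _ _ _
    (id (by rw [← e₁, ← e₂]; rfl))).symm

end

end PastingScheme.GluePairs
end
end GrayPasting

/-! ### Gluing a pair labelled by its pasting. -/

namespace GrayPasting

section
open GrayCategory

/-- The constituents are replaced by equal ones. As the composability proofs depend on them, the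
hypothesis is quantified over these proofs. -/
lemma Cell₂.eq_between_exch {𝒦 : Type*} [GrayCategory 𝒦] {s a a' b b' t : 𝒦} {x : s ⟶ a}
    {m : a' ⟶ b} {z : b' ⟶ t} {c c' r r' : Cell₁ (s ⟶ t)} {d d' : Cell₁ (a ⟶ a')}
    {e e' : Cell₁ (b ⟶ b')} {Θ : Cell₂ (s ⟶ t)} (hc : c = c') (hd : d = d') (he : e = e')
    (hr : r = r') (h : ∀ p q, Θ = between c (Cell₁.exch x d m e z) r p q) (p' q') :
    Θ = between c' (Cell₁.exch x d' m e' z) r' p' q' := by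
  subst hc hd he hr
  exact h _ _

end

section
open Quiver GrayCategory

namespace PastingScheme.GluePairs
variable {V : Type*} [Quiver V] [Finite V] [Finite (Total V)] {𝒢 : PastingScheme V} {ι : Type*}
  {D : 𝒢.GluePairs ι} {P P' : Set ι} {𝒦 : Type*} [GrayCategory 𝒦] (ℒ : 𝒢.Labelling 𝒦)
  {A : ∀ i, D.TwoCell ℒ i}

lemma cell_extend_inr {i : ι} (h : A i = D.pasting ℒ i) (p) :
    (cell (D.extend ℒ A) (.inr i) :
      Cell₁ (ℒ.edge.obj (D.shape i).source ⟶ ℒ.edge.obj (D.shape i).sink)) =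
      ((cell (D.extend ℒ A) (.inl (D.fst i))).whisker (ev ℒ.edge (D.shape i).u)
        (ev ℒ.edge (D.shape i).v)).comp
      ((cell (D.extend ℒ A) (.inl (D.snd i))).whisker (ev ℒ.edge (D.shape i).u')
        (ev ℒ.edge (D.shape i).v')) p :=
  (congrArg Cell₁.mk h).trans (mk_D_pasting ℒ D i)

/-- An interchange in the glued scheme becomes a single interchange if neither face is unglued. If
one of them is, it becomes two interchanges, and these compose to the interchange of the pasting.
The case of two different unglued pairs is excluded by `hone`. -/
lemma mk_hom_unglueOrder_swap (hP : P ⊆ P') (hA : ∀ i ∈ P', i ∉ P → A i = D.pasting ℒ i)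
    (hone : ∀ i ∈ P', i ∉ P → ∀ j ∈ P', j ∉ P → i = j) (L : D.Composition (D.extend ℒ A) P)
    (X Y : D.Order P') {f g : D.Cell} {l r : List D.Cell} (hX : X.list = l ++ f :: g :: r)
    (hY : Y.list = l ++ g :: f :: r) (x : Path 𝒢.s (D.bd f).source)
    (m : Path (D.bd f).sink (D.bd g).source) (z : Path (D.bd g).sink 𝒢.t)
    (σ : Sweep D.bd 𝒢.top l (x.comp ((D.bd f).dom.comp (m.comp ((D.bd g).dom.comp z)))))
    (ρ : Sweep D.bd (x.comp ((D.bd f).cod.comp (m.comp ((D.bd g).cod.comp z)))) r 𝒢.bot) :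
    Cell₂.mk (L.hom (D.unglueOrder hP X) (D.unglueOrder hP Y)) =
      swapCell (D.extend ℒ A) σ x m z ρ rfl rfl := by
  have hmem : ∀ a ∈ l ++ f :: g :: r, a ∈ D.faces P' := fun a ha => (X.mem_iff a).1 (hX ▸ ha)
  obtain ⟨σ', hσ'⟩ := exists_expanded ℒ A P σ fun i hi hl => hA i (hmem (.inr i) (by simp [hl])) hi
  obtain ⟨ρ', hρ'⟩ := exists_expanded ℒ A P ρ fun i hi hl => hA i (hmem (.inr i) (by simp [hl])) hi
  have hσ : evalCell (D.extend ℒ A) σ' = evalCell (D.extend ℒ A) σ := congrArg Cell₁.mk hσ'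
  have hρ : evalCell (D.extend ℒ A) ρ' = evalCell (D.extend ℒ A) ρ := congrArg Cell₁.mk hρ'
  have hSX : (D.unglueOrder hP X).list = l.flatMap (D.expand P) ++
      (D.expand P f ++ (D.expand P g ++ r.flatMap (D.expand P))) := by
    simp [unglueOrder, hX]
  have hSY : (D.unglueOrder hP Y).list = l.flatMap (D.expand P) ++
      (D.expand P g ++ (D.expand P f ++ r.flatMap (D.expand P))) := by
    simp [unglueOrder, hY]
  -- Each of the two faces either stays a single face or splits into its pair, which gives four
  -- cases.
  have hsingle : ∀ a, D.expand P a = [a] ∨ ∃ i ∉ P, a = .inr i ∧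
      D.expand P a = [.inl (D.fst i), .inl (D.snd i)] := by
    rintro (a | i)
    · exact Or.inl rfl
    · by_cases hi : i ∈ P
      · exact Or.inl (by rw [expand, if_pos hi])
      · exact Or.inr ⟨i, hi, rfl, by rw [expand, if_neg hi]⟩
  obtain hf | ⟨i, hi, rfl, hf⟩ := hsingle f <;> obtain hg | ⟨j, hj, rfl, hg⟩ := hsingle g <;>
    rw [hf, hg] at hSX hSY
  · exact Cell₂.eq_between_exch hσ rfl rfl hρ
      (fun _ _ => L.hom_swap_cell _ _ hSX hSY σ' x m z ρ' rfl rfl) _ _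
  · have p := by simpa only [ev_comp] using congrArg (ev ℒ.edge) (D.shape j).mid
    exact Cell₂.eq_between_exch hσ rfl (cell_extend_inr ℒ (hA j (hmem (.inr j) (by simp)) hj) p).symm
      hρ (fun _ _ => L.hom_pasting_right (h := f) (f := .inl (D.fst j)) (g := .inl (D.snd j)) σ' ρ'
        (D.shape j) hSX hSY x m z rfl rfl p _ _) _ _
  · have p := by simpa only [ev_comp] using congrArg (ev ℒ.edge) (D.shape i).mid
    exact Cell₂.eq_between_exch hσ (cell_extend_inr ℒ (hA i (hmem (.inr i) (by simp)) hi) p).symm rfl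
      hρ (fun _ _ => L.hom_pasting_left (h := g) (f := .inl (D.fst i)) (g := .inl (D.snd i)) σ' ρ'
        (D.shape i) hSX hSY x m z rfl rfl p _ _) _ _
  -- If both faces split, they are the same glued face, which cannot occur twice in `X`.
  · obtain rfl := hone i (hmem (.inr i) (by simp)) hi j (hmem (.inr j) (by simp)) hj
    have := hX ▸ X.nodup
    simp [List.nodup_append] at this

/-- Gluing one pair of faces whose label is the pasting of the labels of the pair does not change
the composites. -/
lemma hom_unglueOrder (hP : P ⊆ P') (hA : ∀ i ∈ P', i ∉ P → A i = D.pasting ℒ i)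
    (hone : ∀ i ∈ P', i ∉ P → ∀ j ∈ P', j ∉ P → i = j) (L : D.Composition (D.extend ℒ A) P)
    (L' : D.Composition (D.extend ℒ A) P') (X Y : D.Order P') :
    L.hom (D.unglueOrder hP X) (D.unglueOrder hP Y) ≫ eqToHom (comp_unglueOrder ℒ A hP hA Y) =
      eqToHom (comp_unglueOrder ℒ A hP hA X) ≫ L'.hom X Y := by
  -- The restriction of `L` along ungluing, transported to the composites of the glued scheme,
  -- satisfies the description of its functor and therefore equals `L'`.
  let L'' : D.Composition (D.extend ℒ A) P' :=
    { hom X Y := eqToHom (comp_unglueOrder ℒ A hP hA X).symm ≫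
        L.hom (D.unglueOrder hP X) (D.unglueOrder hP Y) ≫
          eqToHom (comp_unglueOrder ℒ A hP hA Y)
      hom_self X := by simp [L.hom_self]
      hom_comp X Y Z := by
        rw [← L.hom_comp (D.unglueOrder hP X) (D.unglueOrder hP Y) (D.unglueOrder hP Z)]
        simp only [Category.assoc, eqToHom_trans_assoc, eqToHom_refl, Category.id_comp]
      hom_swap X Y f g l r hX hY x m z σ ρ := by
        refine Cell₂.mk_inj ?_
        rw [Cell₂.mk_eqToHom_comp, Cell₂.mk_comp_eqToHom]
        exact (mk_hom_unglueOrder_swap ℒ hP hA hone L X Y hX hY x m z σ ρ).trans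
          (mk_swap _ σ ρ _ _).symm }
  rw [Composition.subsingleton L' L'']
  simp [L'']

end PastingScheme.GluePairs
end
end GrayPasting

/-! ### Induced transformations and their composition. -/

namespace GrayPasting

section
open Quiver GrayCategory

namespace PastingScheme.GluePairs
variable {V : Type*} [Quiver V] [Finite V] [Finite (Total V)] {𝒢 : PastingScheme V} {ι : Type*}
  {D : 𝒢.GluePairs ι} {P P' P'' : Set ι} {𝒦 : Type*} [GrayCategory 𝒦] (ℒ : 𝒢.Labelling 𝒦)
  {A A' A'' : ∀ i, D.TwoCell ℒ i}

lemma unglueOrder_unglueOrder (hP : P ⊆ P') (hP' : P' ⊆ P'') (X : D.Order P'') :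
    D.unglueOrder hP (D.unglueOrder hP' X) = D.unglueOrder (hP.trans hP') X := by
  refine LinExt.ext' ?_
  have h : ∀ a, (D.expand P' a).flatMap (D.expand P) = D.expand P a := by
    rintro (a | i)
    · rfl
    · by_cases hi : i ∈ P'
      · simp [expand, hi]
      · simp [expand, hi, show i ∉ P from fun h => hi (hP h)]
  simp only [unglueOrder, List.flatMap_assoc, h]

/-- The 3-cell from the composite in the order `X` to the one in the order `Z`, in which the pairs
of faces with index in `P'` are glued. -/
noncomputable def induced (θ : ∀ i, A i ⟶ A' i) (hP : P ⊆ P')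
    (hA : ∀ i ∈ P', i ∉ P → A i = D.pasting ℒ i) (L : D.Composition (D.extend ℒ A) P)
    (X : D.Order P) (Z : D.Order P') : D.comp (D.extend ℒ A) X ⟶ D.comp (D.extend ℒ A') Z :=
  L.hom X (D.unglueOrder hP Z) ≫ eqToHom (comp_unglueOrder ℒ A hP hA Z) ≫
    D.compMap (D.extendMap ℒ θ) Z

/-- Together with `induced_hom`: the 3-cell `induced` may be moved freely along orders in both
variables. Since `inducedApp` at `X` is `induced` with second argument `J X`, this yields naturality
and shows how the choice of `J` enters. -/
lemma hom_induced (θ : ∀ i, A i ⟶ A' i) (hP : P ⊆ P')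
    (hA : ∀ i ∈ P', i ∉ P → A i = D.pasting ℒ i) (L : D.Composition (D.extend ℒ A) P)
    (X Y : D.Order P) (Z : D.Order P') :
    L.hom X Y ≫ induced ℒ θ hP hA L Y Z = induced ℒ θ hP hA L X Z := by
  rw [induced, ← Category.assoc, L.hom_comp, induced]

lemma induced_hom (θ : ∀ i, A i ⟶ A' i) (hP : P ⊆ P')
    (hA : ∀ i ∈ P', i ∉ P → A i = D.pasting ℒ i)
    (hone : ∀ i ∈ P', i ∉ P → ∀ j ∈ P', j ∉ P → i = j) (L : D.Composition (D.extend ℒ A) P)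
    (L' : D.Composition (D.extend ℒ A') P') (X : D.Order P) (Z Z' : D.Order P') :
    induced ℒ θ hP hA L X Z ≫ L'.hom Z Z' = induced ℒ θ hP hA L X Z' := by
  -- The functor `M` of the glued scheme with the old labels mediates: `hom_unglueOrder` compares it
  -- with `L`, and `hom_compMap` compares it with `L'`.
  obtain ⟨M⟩ := nonempty_composition (D.extend ℒ A) P'
  simp only [induced, Category.assoc]
  rw [← hom_compMap M L', ← L.hom_comp X (D.unglueOrder hP Z) (D.unglueOrder hP Z'),
    Category.assoc, reassoc_of% hom_unglueOrder ℒ hP hA hone L M Z Z']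

/-- By `induced_hom` the order `Y` may be replaced by the one obtained by ungluing `Z`. Along it `θ`
induces the same 3-cell as along `Z`, since it is an identity on the pairs glued in the second
stage. What remains is the composite of the changes of labels given by `θ` and `θ'` along `Z`. -/
lemma induced_induced (θ : ∀ i, A i ⟶ A' i) (θ' : ∀ i, A' i ⟶ A'' i) (hP : P ⊆ P')
    (hP' : P' ⊆ P'') (hA : ∀ i ∈ P', i ∉ P → A i = D.pasting ℒ i)
    (hA' : ∀ i ∈ P'', i ∉ P' → A' i = D.pasting ℒ i)
    (hA'' : ∀ i ∈ P'', i ∉ P → A i = D.pasting ℒ i)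
    (hθ : ∀ i ∈ P'', i ∉ P' → Cell₂.mk (θ i) = Cell₂.one ⟨D.pasting ℒ i⟩)
    (hone : ∀ i ∈ P', i ∉ P → ∀ j ∈ P', j ∉ P → i = j) (L : D.Composition (D.extend ℒ A) P)
    (L' : D.Composition (D.extend ℒ A') P') (X : D.Order P) (Y : D.Order P') (Z : D.Order P'') :
    induced ℒ θ hP hA L X Y ≫ induced ℒ θ' hP' hA' L' Y Z =
      induced ℒ (fun i => θ i ≫ θ' i) (hP.trans hP') hA'' L X Z := by
  have hθ' : (fun f => D.extendMap ℒ θ f ≫ D.extendMap ℒ θ' f) =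
      D.extendMap ℒ (fun i => θ i ≫ θ' i) := by
    funext f
    rcases f with f | i
    · exact Category.comp_id _
    · rfl
  have e : D.compMap (D.extendMap ℒ θ) (D.unglueOrder hP' Z) ≫
      eqToHom (comp_unglueOrder ℒ A' hP' hA' Z) =
      eqToHom (comp_unglueOrder ℒ A hP' (fun i hi hi' => hA'' i hi fun h => hi' (hP h)) Z) ≫
        D.compMap (D.extendMap ℒ θ) Z := by
    refine Cell₂.mk_inj ?_
    rw [Cell₂.mk_eqToHom_comp, Cell₂.mk_comp_eqToHom]
    exact compMap_unglueOrder ℒ θ hP' hθ Z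
  -- Ungluing in two stages and at once give orders that are equal but not by definition; the
  -- difference is absorbed by the transport that follows.
  have e' : ∀ W W' : D.Order P, (h : W = W') → ∀ h₁ h₂,
      L.hom X W ≫ (eqToHom h₁ : _ ⟶ D.comp (D.extend ℒ A) Z) = L.hom X W' ≫ eqToHom h₂ := by
    rintro W _ rfl _ _
    rfl
  rw [induced.eq_def ℒ θ', ← Category.assoc, induced_hom ℒ θ hP hA hone]
  simp only [induced, Category.assoc]
  rw [← hθ', ← compMap_comp, reassoc_of% e, eqToHom_trans_assoc]
  simp only [← Category.assoc]
  rw [e' _ _ (unglueOrder_unglueOrder hP hP' Z)]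

/-- The transformation induced by 3-cells between the labels of the glued faces. -/
noncomputable def inducedNatTrans (θ : ∀ i, A i ⟶ A' i) (hP : P ⊆ P')
    (hA : ∀ i ∈ P', i ∉ P → A i = D.pasting ℒ i)
    (hone : ∀ i ∈ P', i ∉ P → ∀ j ∈ P', j ∉ P → i = j) (L : D.Composition (D.extend ℒ A) P)
    (J : D.Orders P ⥤ D.Orders P') (L' : D.Composition (D.extend ℒ A') P') :
    L.functor ⟶ J ⋙ L'.functor where
  app X := D.inducedApp ℒ θ hP hA L J L' X
  -- Both composites of the naturality square are the 3-cell `induced` from `X` to `J Y`.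
  naturality X Y _ := (hom_induced ℒ θ hP hA L X.as Y.as (J.obj Y).as).trans
    (induced_hom ℒ θ hP hA hone L L' X.as (J.obj X).as (J.obj Y).as).symm

end PastingScheme.GluePairs
end
end GrayPasting
-- The theorem for two pairs of faces.
theorem mainTheorem4 {V : Type*} [Quiver V] [Finite V] [Finite (Quiver.Total V)]
    {𝒦 : Type*} [GrayCategory 𝒦] (𝒢 : PastingScheme V) (ℒ : 𝒢.Labelling 𝒦)
    (D : 𝒢.GluePairs Pair)
    (α' : D.TwoCell ℒ .fg) (π : D.pasting ℒ .fg ⟶ α')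
    (β' : D.TwoCell ℒ .hk) (ω : D.pasting ℒ .hk ⟶ β') :
    (∀ (P : Set Pair) (A : ∀ i, D.TwoCell ℒ i),
      Nonempty (Unique (D.Composition (D.extend ℒ A) P))) ∧
    ∀ (J₁ : D.Orders ∅ ⥤ D.Orders {.fg}) (J₂ : D.Orders {.fg} ⥤ D.Orders Set.univ)
      (J₃ : D.Orders ∅ ⥤ D.Orders {.hk}) (J₄ : D.Orders {.hk} ⥤ D.Orders Set.univ),
      IsPseudoInverse (D.unglue (Set.empty_subset _)) J₁ →
      IsPseudoInverse (D.unglue (Set.subset_univ _)) J₂ →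
      IsPseudoInverse (D.unglue (Set.empty_subset _)) J₃ →
      IsPseudoInverse (D.unglue (Set.subset_univ _)) J₄ →
    ∀ (L : D.Composition (D.extend ℒ (labels (D.pasting ℒ .fg) (D.pasting ℒ .hk))) ∅)
      (L₁ : D.Composition (D.extend ℒ (labels α' (D.pasting ℒ .hk))) {.fg})
      (L₂ : D.Composition (D.extend ℒ (labels (D.pasting ℒ .fg) β')) {.hk})
      (L₃ : D.Composition (D.extend ℒ (labels α' β')) Set.univ),
    ∃ (π₁ : L.functor ⟶ J₁ ⋙ L₁.functor) (ω₁ : L₁.functor ⟶ J₂ ⋙ L₃.functor)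
      (ω₂ : L.functor ⟶ J₃ ⋙ L₂.functor) (π₂ : L₂.functor ⟶ J₄ ⋙ L₃.functor),
      (∀ X, π₁.app X = D.inducedApp ℒ (labelsMap π (𝟙 (D.pasting ℒ .hk)))
        (Set.empty_subset _) (labels_fg _ _) L J₁ L₁ X) ∧
      (∀ X, ω₁.app X = D.inducedApp ℒ (labelsMap (𝟙 α') ω)
        (Set.subset_univ _) (labels_not_fg _ _) L₁ J₂ L₃ X) ∧
      (∀ X, ω₂.app X = D.inducedApp ℒ (labelsMap (𝟙 (D.pasting ℒ .fg)) ω)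
        (Set.empty_subset _) (labels_hk _ _) L J₃ L₂ X) ∧
      (∀ X, π₂.app X = D.inducedApp ℒ (labelsMap π (𝟙 β'))
        (Set.subset_univ _) (labels_not_hk _ _) L₂ J₄ L₃ X) ∧
      π₁ ≫ Functor.whiskerLeft J₁ ω₁ =
        ω₂ ≫ Functor.whiskerLeft J₃ π₂ ≫ (Functor.associator J₃ J₄ L₃.functor).inv ≫
          Functor.whiskerRight (Codiscrete.natIso : J₃ ⋙ J₄ ≅ J₁ ⋙ J₂).hom L₃.functor ≫
            (Functor.associator J₁ J₂ L₃.functor).hom := by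
  refine ⟨fun P A => nonempty_unique_composition _ P, fun J₁ J₂ J₃ J₄ _ _ _ _ L L₁ L₂ L₃ => ?_⟩
  -- Each of the four inclusions of sets of glued pairs adds only one pair, as `hom_unglueOrder`
  -- requires.
  have hfg : ∀ i ∈ ({.fg} : Set Pair), i ∉ (∅ : Set Pair) → ∀ j ∈ ({.fg} : Set Pair),
      j ∉ (∅ : Set Pair) → i = j := by
    rintro _ rfl _ _ rfl _
    rfl
  have hhk : ∀ i ∈ ({.hk} : Set Pair), i ∉ (∅ : Set Pair) → ∀ j ∈ ({.hk} : Set Pair),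
      j ∉ (∅ : Set Pair) → i = j := by
    rintro _ rfl _ _ rfl _
    rfl
  have hfg' : ∀ i ∈ (Set.univ : Set Pair), i ∉ ({.fg} : Set Pair) → ∀ j ∈ (Set.univ : Set Pair),
      j ∉ ({.fg} : Set Pair) → i = j := by
    rintro (_ | _) _ hi (_ | _) _ hj <;> first | rfl | exact (hi rfl).elim | exact (hj rfl).elim
  have hhk' : ∀ i ∈ (Set.univ : Set Pair), i ∉ ({.hk} : Set Pair) → ∀ j ∈ (Set.univ : Set Pair),
      j ∉ ({.hk} : Set Pair) → i = j := by
    rintro (_ | _) _ hi (_ | _) _ hj <;> first | rfl | exact (hi rfl).elim | exact (hj rfl).elim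
  have hA : ∀ i ∈ (Set.univ : Set Pair), i ∉ (∅ : Set Pair) →
      labels (D.pasting ℒ .fg) (D.pasting ℒ .hk) i = D.pasting ℒ i := by
    rintro (_ | _) _ _ <;> rfl
  refine ⟨inducedNatTrans ℒ (labelsMap π (𝟙 (D.pasting ℒ .hk))) _ (labels_fg _ _) hfg L J₁ L₁,
    inducedNatTrans ℒ (labelsMap (𝟙 α') ω) _ (labels_not_fg _ _) hfg' L₁ J₂ L₃,
    inducedNatTrans ℒ (labelsMap (𝟙 (D.pasting ℒ .fg)) ω) _ (labels_hk _ _) hhk L J₃ L₂,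
    inducedNatTrans ℒ (labelsMap π (𝟙 β')) _ (labels_not_hk _ _) hhk' L₂ J₄ L₃,
    fun _ => rfl, fun _ => rfl, fun _ => rfl, fun _ => rfl, ?_⟩
  ext X
  -- Both ways around are expressed by 3-cells `induced` from `X` to the same order `J₂ (J₁ X)`.
  have h₁ := induced_induced ℒ (labelsMap π (𝟙 (D.pasting ℒ .hk))) (labelsMap (𝟙 α') ω)
    (Set.empty_subset _) (Set.subset_univ _) (labels_fg _ _) (labels_not_fg _ _) hA
    (by rintro (_ | _) _ h; exacts [(h rfl).elim, rfl]) hfg L L₁ X.as (J₁.obj X).as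
    (J₂.obj (J₁.obj X)).as
  have h₂ := induced_induced ℒ (labelsMap (𝟙 (D.pasting ℒ .fg)) ω) (labelsMap π (𝟙 β'))
    (Set.empty_subset _) (Set.subset_univ _) (labels_hk _ _) (labels_not_hk _ _) hA
    (by rintro (_ | _) _ h; exacts [rfl, (h rfl).elim]) hhk L L₂ X.as (J₃.obj X).as
    (J₂.obj (J₁.obj X)).as
  -- The morphism from `J₄ (J₃ X)` to `J₂ (J₁ X)` inserted here is the component of `κ`.
  have h₃ := induced_hom ℒ (labelsMap π (𝟙 β')) (Set.subset_univ _) (labels_not_hk _ _) hhk' L₂ L₃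
    (J₃.obj X).as (J₄.obj (J₃.obj X)).as (J₂.obj (J₁.obj X)).as
  -- The order of the two changes does not matter, as on each glued face one of the two 3-cells is
  -- an identity.
  have hθ : (fun i => labelsMap π (𝟙 (D.pasting ℒ .hk)) i ≫ labelsMap (𝟙 α') ω i) =
      fun i => labelsMap (𝟙 (D.pasting ℒ .fg)) ω i ≫ labelsMap π (𝟙 β') i := by
    funext i
    rcases i with _ | _
    · exact (Category.comp_id _).trans (Category.id_comp _).symm
    · exact (Category.id_comp _).trans (Category.comp_id _).symm
  rw [hθ, ← h₂, ← h₃] at h₁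
  simp only [NatTrans.comp_app, Functor.whiskerLeft_app, Functor.associator_inv_app,
    Functor.associator_hom_app, Category.id_comp, Category.comp_id, Functor.whiskerRight_app]
  exact h₁
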